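/- **Theorem 5.** Let $\bar G=SL(3,\mathbb R)$ act on $\mathbb RP^2$, let $G\subset\bar G$ be the stationary subgroup of $o=[1:0:0]$ (the matrices of $SL(3,\mathbb R)$ whose first column is $(\ast,0,0)^T$), and let $\mathfrak g\subset\bar{\mathfrak g}=\mathfrak{sl}(3,\mathbb R)$ be their Lie algebras. A *projective connection* in the plane is a principal $G$-bundle $\pi:P\to\mathbb R^2$ with a Cartan connection $\omega$ on $P$, i.e. a smooth $\bar{\mathfrak g}$-valued 1-form with $\omega(X^*)=X$ for the fundamental fields $X^*$ of $X\in\mathfrak g$, $R_g^*\omega=(\mathrm{Ad}\,g^{-1})\omega$ for $g\in G$, and $\omega_p:T_pP\to\bar{\mathfrak g}$ an isomorphism for all $p$. A curve in the plane is a *geodesic* (unparametrized) if its development in $\bar G/G=\mathbb RP^2$ lies on a straight line. The *structure function* $c$ of $\omega$ is $c(p)(X+\mathfrak g,Y+\mathfrak g)=\Omega_p(X^*,Y^*)$, where $\Omega=d\omega+\frac12[\omega,\omega]$ and $X^*_p=\omega_p^{-1}(X)$ for $X\in\bar{\mathfrak g}$. Let $A,B,C,D$ be smooth functions on $\mathbb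 R^2$ and consider the equation $$y''=A(y')^3+B(y')^2+Cy'+D. \qquad (*)$$ Then there exist a principal $G$-bundle $\pi:P\to\mathbb R^2$ and a Cartan connection $\omega$ on $P$ such that (i) the geodesics of $\omega$ satisfy $(*)$; (ii) the structure function $c:P\to\mathcal L(\bar{\mathfrak g}/\mathfrak g\wedge\bar{\mathfrak g}/\mathfrak g,\bar{\mathfrak g})$ takes values in $$W=\left\{e_1\wedge e_2\mapsto\begin{pmatrix}0&a&b\\0&0&0\\0&0&0\end{pmatrix}\;\middle|\;a,b\in\mathbb R\right\},$$ where $e_1=E_{21}+\mathfrak g$, $e_2=E_{31}+\mathfrak g$ is the basis of $\bar{\mathfrak g}/\mathfrak g$ given by the matrix units $E_{21},E_{31}$. The pair $(P,\omega)$ is unique up to isomorphism: any other pair $(P',\omega')$ for which every geodesic that is the graph of a smooth function $y(x)$ satisfies $(*)$ and for which (ii) holds is isomorphic to it by a $G$-equivariant diffeomorphism $f:P\to P'$ over the identity of $\mathbb R^2$ with $f^*\omega'=\omega$. Moreover, the geodesics of $\omega$ are exactly the solution curves of $(*)$: a smooth regular curve $(x(t),y(t))$ on an open interval is a geodesic if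 and only if $\dot x\ddot y-\ddot x\dot y=A\dot y^3+B\dot x\dot y^2+C\dot x^2\dot y+D\dot x^3$. Finally, there is a smooth global section $s:\mathbb R^2\to P$ with $$s^*\omega=\begin{pmatrix}0&\tilde\omega_1&\tilde\omega_2\\dx&\tilde\omega^1_1&\tilde\omega^1_2\\dy&\tilde\omega^2_1&\tilde\omega^2_2\end{pmatrix},$$ $$\tilde\omega^1_1=-\tilde\omega^2_2=\tfrac13(C\,dx+B\,dy),\qquad \tilde\omega^1_2=\tfrac13B\,dx+A\,dy,\qquad \tilde\omega^2_1=-D\,dx-\tfrac13C\,dy,$$ $$\tilde\omega_1=\left(D_y-\tfrac13C_x-\tfrac23BD+\tfrac29C^2\right)dx+\left(\tfrac13C_y-\tfrac13B_x+\tfrac19BC-AD\right)dy,$$ $$\tilde\omega_2=\left(\tfrac13C_y-\tfrac13B_x+\tfrac19BC-AD\right)dx+\left(\tfrac13B_y-A_x+\tfrac29B^2-\tfrac23AC\right)dy.$$ -/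

import Mathlib

open scoped Manifold ContDiff LinearAlgebra.Projectivization

universe u v

noncomputable section

namespace ProjConn

/-! ### The plane, the group `SL(3, ℝ)`, its Lie algebra, and the stationary subgroup -/

/-- The plane `ℝ²`; its coordinates are `x = p 0` and `y = p 1`. -/
abbrev Plane : Type := EuclideanSpace ℝ (Fin 2)

/-- Real `3 × 3` matrices. -/
abbrev Mat3 : Type := Matrix (Fin 3) (Fin 3) ℝ

/-- The group `SL(3, ℝ)`. -/
abbrev SL3 : Type := Matrix.SpecialLinearGroup (Fin 3) ℝ

/-- The Lie algebra `sl(3, ℝ)` of trace-free matrices. -/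
abbrev sl3 : Submodule ℝ Mat3 := LinearMap.ker (Matrix.traceLinearMap (Fin 3) ℝ ℝ)

/-- The point `o = [1 : 0 : 0]` of the projective plane. -/
def origin : ℙ ℝ (Fin 3 → ℝ) :=
  Projectivization.mk ℝ ![1, 0, 0] (fun h => one_ne_zero (congrFun h 0))

/-- The stationary subgroup `G` of the point `[1 : 0 : 0]` in `SL(3, ℝ)`: the block matrices
`(det A)⁻¹, B; 0, A`. -/
def stabGroup : Subgroup SL3 where
  carrier := {g | (g : Mat3) 1 0 = 0 ∧ (g : Mat3) 2 0 = 0}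
  one_mem' := by simp
  mul_mem' := by
    rintro a b ⟨ha1, ha2⟩ ⟨hb1, hb2⟩
    simp [Matrix.mul_apply, Fin.sum_univ_three, ha1, ha2, hb1, hb2]
  inv_mem' := by
    rintro a ⟨ha1, ha2⟩
    change (a⁻¹ : SL3).1 1 0 = 0 ∧ (a⁻¹ : SL3).1 2 0 = 0
    rw [Matrix.SpecialLinearGroup.coe_inv]
    rw [Matrix.adjugate_fin_three]
    simp [ha1, ha2]

/-- The subalgebra of `sl(3, ℝ)` corresponding to `G`, as a linear subspace. -/
def stabAlg : Submodule ℝ sl3 where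
  carrier := {X | (X : Mat3) 1 0 = 0 ∧ (X : Mat3) 2 0 = 0}
  zero_mem' := by simp
  add_mem' := by
    rintro a b ⟨ha1, ha2⟩ ⟨hb1, hb2⟩
    simp [ha1, ha2, hb1, hb2]
  smul_mem' := by
    rintro c a ⟨ha1, ha2⟩
    simp [ha1, ha2]

/-! ### The smooth structure of `G` -/

/-- The coordinate space of `G`: the last two columns of a matrix. -/
abbrev GModel : Type := Fin 3 → Fin 2 → ℝ

/-- The global coordinates on `G`: the last two columns of a matrix, that is, the blocks `B` and
`A`. They identify `G` with the open set `det A ≠ 0`. -/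
def gCoord (g : stabGroup) : GModel := fun i j => ((g : SL3) : Mat3) i j.succ

/-- The determinant of the block `A`. -/
def blockDet (m : GModel) : ℝ := m 1 0 * m 2 1 - m 1 1 * m 2 0

/-- The element of `G` with given blocks `B` and `A`, where `det A ≠ 0`. -/
def ofCoord (m : {m : GModel // blockDet m ≠ 0}) : stabGroup :=
  ⟨⟨!![(blockDet m.1)⁻¹, m.1 0 0, m.1 0 1; 0, m.1 1 0, m.1 1 1; 0, m.1 2 0, m.1 2 1], by
    have h := inv_mul_cancel₀ m.2
    rw [Matrix.det_fin_three]
    simp [blockDet] at h ⊢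
    linear_combination h⟩, ⟨rfl, rfl⟩⟩

theorem stabGroup_det (g : stabGroup) :
    ((g : SL3) : Mat3) 0 0 * blockDet (gCoord g) = 1 := by
  obtain ⟨⟨g, hg⟩, h1, h2⟩ := g
  simp only at h1 h2
  rw [Matrix.det_fin_three, h1, h2] at hg
  simp only [blockDet, gCoord, Fin.succ_zero_eq_one, Fin.succ_one_eq_two]
  linear_combination hg

theorem continuous_blockDet : Continuous blockDet := by
  unfold blockDet; fun_prop

theorem continuous_gCoord : Continuous gCoord := by
  refine continuous_pi fun i => continuous_pi fun j => ?_
  have h : Continuous fun g : stabGroup => ((g : SL3) : Mat3) :=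
    Continuous.comp (g := fun g : SL3 => (g : Mat3)) continuous_subtype_val continuous_subtype_val
  exact h.matrix_elem i j.succ

theorem continuous_ofCoord : Continuous ofCoord := by
  refine Continuous.subtype_mk (Continuous.subtype_mk ?_ _) _
  have hd : Continuous fun m : {m : GModel // blockDet m ≠ 0} => (blockDet m.1)⁻¹ :=
    (continuous_blockDet.comp continuous_subtype_val).inv₀ fun m => m.2
  have hm : ∀ i j, Continuous fun m : {m : GModel // blockDet m ≠ 0} => m.1 i j := fun i j =>
    (continuous_apply_apply i j).comp continuous_subtype_val
  refine continuous_matrix fun i j => ?_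
  fin_cases i <;> fin_cases j <;>
    first
    | exact hd
    | exact hm _ _
    | exact continuous_const

/-- `G` is homeomorphic to the open set `det A ≠ 0` of the coordinate space. -/
def gHomeo : stabGroup ≃ₜ {m : GModel // blockDet m ≠ 0} where
  toFun g := ⟨gCoord g, fun h => by have := stabGroup_det g; simp [h] at this⟩
  invFun := ofCoord
  left_inv g := by
    have h := eq_inv_of_mul_eq_one_left (stabGroup_det g)
    obtain ⟨h1, h2⟩ := g.2
    apply Subtype.ext
    apply Subtype.ext
    ext i j
    fin_cases i <;> fin_cases j <;> simp [ofCoord, gCoord] at h h1 h2 ⊢ <;> simp [h, h1, h2]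
  right_inv m := by
    apply Subtype.ext
    funext i j
    fin_cases i <;> fin_cases j <;> simp [ofCoord, gCoord]
  continuous_toFun := continuous_gCoord.subtype_mk _
  continuous_invFun := continuous_ofCoord

theorem isOpenEmbedding_gCoord : Topology.IsOpenEmbedding gCoord :=
  (isOpen_ne_fun continuous_blockDet continuous_const).isOpenEmbedding_subtypeVal.comp
    gHomeo.isOpenEmbedding

instance : Nonempty stabGroup := ⟨1⟩

instance : ChartedSpace GModel stabGroup := isOpenEmbedding_gCoord.singletonChartedSpace

instance : IsManifold 𝓘(ℝ, GModel) ∞ stabGroup :=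
  isOpenEmbedding_gCoord.isManifold_singleton

/-! ### Principal bundles over the plane and Cartan connections -/

/-- A smooth principal fibre bundle over the plane with structure group `G`. -/
structure PrincipalBundle : Type (u + 1) where
  /-- The vector space on which the total space is modelled. -/
  Model : Type u
  [normedAddCommGroup : NormedAddCommGroup Model]
  [normedSpace : NormedSpace ℝ Model]
  [finiteDimensional : FiniteDimensional ℝ Model]
  /-- The total space, a smooth manifold. -/
  Total : Type u
  [topologicalSpace : TopologicalSpace Total]
  [chartedSpace : ChartedSpace Model Total]
  [isManifold : IsManifold 𝓘(ℝ, Model) ∞ Total]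
  /-- The projection. -/
  proj : Total → Plane
  /-- The right action of `G`. -/
  act : Total → stabGroup → Total
  act_one : ∀ p, act p 1 = p
  act_mul : ∀ p g h, act p (g * h) = act (act p g) h
  contMDiff_proj : ContMDiff 𝓘(ℝ, Model) 𝓘(ℝ, Plane) ∞ proj
  contMDiff_act : ContMDiff (𝓘(ℝ, Model).prod 𝓘(ℝ, GModel)) 𝓘(ℝ, Model) ∞
    (fun q : Total × stabGroup => act q.1 q.2)
  /-- Local triviality: near every point of the plane there is a local section `s` such that
  `(x, g) ↦ s(x) g` is a diffeomorphism of `U × G` onto the preimage of `U`, with inverse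
  `p ↦ (proj p, τ p)`. -/
  locallyTrivial : ∀ x₀ : Plane, ∃ (U : Set Plane) (s : Plane → Total) (τ : Total → stabGroup),
    IsOpen U ∧ x₀ ∈ U ∧
    ContMDiffOn 𝓘(ℝ, Plane) 𝓘(ℝ, Model) ∞ s U ∧
    ContMDiffOn 𝓘(ℝ, Model) 𝓘(ℝ, GModel) ∞ τ (proj ⁻¹' U) ∧
    (∀ x ∈ U, ∀ g, proj (act (s x) g) = x ∧ τ (act (s x) g) = g) ∧
    (∀ p, proj p ∈ U → act (s (proj p)) (τ p) = p)

attribute [instance] PrincipalBundle.normedAddCommGroup PrincipalBundle.normedSpace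
  PrincipalBundle.finiteDimensional PrincipalBundle.topologicalSpace
  PrincipalBundle.chartedSpace PrincipalBundle.isManifold

/-- The model with corners (without boundary) of the total space. -/
abbrev PrincipalBundle.I (Q : PrincipalBundle.{u}) : ModelWithCorners ℝ Q.Model Q.Model :=
  𝓘(ℝ, Q.Model)

/-- A projective connection in the plane: a smooth `sl(3, ℝ)`-valued 1-form on the total space
of a principal `G`-bundle that is a Cartan connection with the model `(SL(3, ℝ), ℝP²)`. -/
structure CartanConnection (Q : PrincipalBundle.{u}) where
  /-- The 1-form. -/
  form : ∀ p : Q.Total, TangentSpace Q.I p →ₗ[ℝ] sl3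
  /-- The form is smooth: its matrix entries are smooth functions on the tangent bundle. -/
  smooth : ∀ i j : Fin 3, ContMDiff Q.I.tangent 𝓘(ℝ, ℝ) ∞
    (fun v : TangentBundle Q.I Q.Total => (form v.proj v.snd : Mat3) i j)
  /-- `ω(X*) = X`. The fundamental field of `ξ ∈ T₁G` is the derivative at `1` of `g ↦ p g` in
  the direction `ξ`, and `ξ` is identified with a matrix by the derivative of `G ⊆ Mat3`. -/
  fundamental : ∀ (p : Q.Total) (ξ : TangentSpace 𝓘(ℝ, GModel) (1 : stabGroup)) (i j : Fin 3),
    (form (Q.act p 1) (mfderiv 𝓘(ℝ, GModel) Q.I (fun g => Q.act p g) 1 ξ) : Mat3) i j =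
      mfderiv 𝓘(ℝ, GModel) 𝓘(ℝ, ℝ) (fun g : stabGroup => ((g : SL3) : Mat3) i j) 1 ξ
  /-- `R_g^* ω = (Ad g⁻¹) ω`. -/
  equivariant : ∀ (g : stabGroup) (p : Q.Total) (v : TangentSpace Q.I p),
    (form (Q.act p g) (mfderiv Q.I Q.I (fun q => Q.act q g) p v) : Mat3) =
      ((g⁻¹ : stabGroup) : SL3) * (form p v : Mat3) * ((g : SL3) : Mat3)
  /-- `ω_p` is an isomorphism of `T_p P` onto `sl(3, ℝ)`. -/
  bijective : ∀ p : Q.Total, Function.Bijective (form p)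

/-- Isomorphism of principal bundles with Cartan connections: a `G`-equivariant diffeomorphism
over the identity of the plane that pulls one form back to the other. -/
def Isomorphic {Q : PrincipalBundle.{u}} (η : CartanConnection Q)
    {Q' : PrincipalBundle.{v}} (η' : CartanConnection Q') : Prop :=
  ∃ f : Diffeomorph Q.I Q'.I Q.Total Q'.Total ∞,
    (∀ p, Q'.proj (f p) = Q.proj p) ∧
    (∀ p g, f (Q.act p g) = Q'.act (f p) g) ∧
    (∀ (p : Q.Total) (v : TangentSpace Q.I p),
      η'.form (f p) (mfderiv Q.I Q'.I f p v) = η.form p v)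

namespace CartanConnection

variable {Q : PrincipalBundle.{u}} (η : CartanConnection Q)

/-! ### Curvature and structure function -/

/-- The derivative at `p` of the matrix entry `(i, j)` of the function `q ↦ ω_q(V q)`, along the
tangent vector `v` at `p`. -/
def entryDeriv (V : ∀ p : Q.Total, TangentSpace Q.I p) (i j : Fin 3) (p : Q.Total)
    (v : TangentSpace Q.I p) : ℝ :=
  mfderiv Q.I 𝓘(ℝ, ℝ) (fun q => (η.form q (V q) : Mat3) i j) p v

/-- The curvature form `Ω = dω + ½[ω, ω]`, evaluated on vector fields `V` and `W` at `p`, where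
`dω(V, W) = V(ω(W)) - W(ω(V)) - ω([V, W])` and `½[ω, ω](V, W) = [ω(V), ω(W)]`. -/
def curvature (V W : ∀ p : Q.Total, TangentSpace Q.I p) (p : Q.Total) : Mat3 :=
  Matrix.of fun i j =>
    η.entryDeriv W i j p (V p) - η.entryDeriv V i j p (W p)
    - (η.form p (VectorField.mlieBracket Q.I V W p) : Mat3) i j
    + ((η.form p (V p) : Mat3) * (η.form p (W p) : Mat3)
        - (η.form p (W p) : Mat3) * (η.form p (V p) : Mat3)) i j

/-- The vector field `X*` with `ω(X*) = X`, for `X` in `sl(3, ℝ)`. -/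
def star (X : sl3) : ∀ p : Q.Total, TangentSpace Q.I p :=
  fun p => (LinearEquiv.ofBijective (η.form p) (η.bijective p)).symm X

/-- The alternating bilinear maps from `sl(3, ℝ)` modulo the subalgebra of `G` to `sl(3, ℝ)`. -/
abbrev StructureSpace : Type := (sl3 ⧸ stabAlg) [⋀^Fin 2]→ₗ[ℝ] sl3

/-- `c` is the structure function: `c(p)` sends the classes of `X` and `Y` to `Ω_p(X*, Y*)`. -/
def IsStructureFunction (c : Q.Total → StructureSpace) : Prop :=
  ∀ (p : Q.Total) (X Y : sl3),
    (c p ![stabAlg.mkQ X, stabAlg.mkQ Y] : Mat3) = η.curvature (η.star X) (η.star Y) p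

end CartanConnection

/-- The matrix with a single entry `1` at the place `(i, 0)`, `i ≠ 0`. -/
def colElt (i : Fin 3) (hi : i ≠ 0) : sl3 :=
  ⟨Matrix.single i 0 1, by simp [Matrix.trace_single_eq_of_ne _ _ _ hi]⟩

/-- The subspace `W` of the alternating maps that send `e₁ ∧ e₂` to a matrix
`0 a b; 0 0 0; 0 0 0`. -/
def W : Submodule ℝ CartanConnection.StructureSpace where
  carrier := {φ | ∃ a b : ℝ,
    (φ ![stabAlg.mkQ (colElt 1 (by decide)), stabAlg.mkQ (colElt 2 (by decide))] : Mat3) =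
      !![0, a, b; 0, 0, 0; 0, 0, 0]}
  zero_mem' := ⟨0, 0, by ext i j; fin_cases i <;> fin_cases j <;> rfl⟩
  add_mem' := by
    rintro φ ψ ⟨a, b, h⟩ ⟨a', b', h'⟩
    refine ⟨a + a', b + b', ?_⟩
    rw [AlternatingMap.add_apply, Submodule.coe_add, h, h']
    ext i j; fin_cases i <;> fin_cases j <;> simp
  smul_mem' := by
    rintro c φ ⟨a, b, h⟩
    refine ⟨c * a, c * b, ?_⟩
    rw [AlternatingMap.smul_apply, Submodule.coe_smul, h]
    ext i j; fin_cases i <;> fin_cases j <;> simp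

namespace CartanConnection

variable {Q : PrincipalBundle.{u}} (η : CartanConnection Q)

/-- The structure function takes values in `W`. -/
def StructureFunctionInW : Prop :=
  ∃ c : Q.Total → StructureSpace, η.IsStructureFunction c ∧ ∀ p, c p ∈ W

/-! ### Developments and geodesics -/

/-- The pair `(q, g)` represents the curve `u(t) = [(q(t), g(t))]` in the extended bundle
`P ×_G SL(3, ℝ)`. The pull-back of the extended (ordinary) connection form to `P × SL(3, ℝ)` is
`(Ad g⁻¹) ω + g⁻¹ dg`; so `u` is a horizontal lift of the curve `x` on the interval `J` if `q`
lies over `x` and this form vanishes on the velocity of `(q, g)`. -/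
structure IsHorizontalLift (J : Set ℝ) (x : ℝ → Plane) (q : ℝ → Q.Total) (g : ℝ → SL3) :
    Prop where
  contMDiffOn : ContMDiffOn 𝓘(ℝ, ℝ) Q.I ∞ q J
  contDiffOn : ∀ i j : Fin 3, ContDiffOn ℝ ∞ (fun t => (g t : Mat3) i j) J
  proj_eq : ∀ t ∈ J, Q.proj (q t) = x t
  horizontal : ∀ t ∈ J,
    ((g t)⁻¹ : SL3) * (η.form (q t) (mfderiv 𝓘(ℝ, ℝ) Q.I q t (1 : ℝ)) : Mat3) * (g t : Mat3)
      + ((g t)⁻¹ : SL3) * (Matrix.of fun i j => deriv (fun s => (g s : Mat3) i j) t) = 0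

/-- The point `γ([(p, g)]) = g⁻¹ o` of the homogeneous space `SL(3, ℝ)/G = ℝP²`. -/
def devPoint (g : SL3) : ℙ ℝ (Fin 3 → ℝ) := g⁻¹ • origin

/-- The curve `x` on the interval `J` is a geodesic, in the unparametrized sense: its development
lies on a straight line of the projective plane. -/
def IsGeodesic (J : Set ℝ) (x : ℝ → Plane) : Prop :=
  ∃ (q : ℝ → Q.Total) (g : ℝ → SL3), η.IsHorizontalLift J x q g ∧
    ∃ L : Submodule ℝ (Fin 3 → ℝ), Module.finrank ℝ L = 2 ∧
      ∀ t ∈ J, (devPoint (g t)).submodule ≤ L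

/-- Every geodesic that is the graph of a smooth function `y` on an open interval satisfies the
equation `y'' = A (y')³ + B (y')² + C y' + D`. -/
def GeodesicsSatisfy (A B C D : Plane → ℝ) : Prop :=
  ∀ (a b : ℝ) (y : ℝ → ℝ), ContDiffOn ℝ ∞ y (Set.Ioo a b) →
    η.IsGeodesic (Set.Ioo a b) (fun t => !₂[t, y t]) →
    ∀ t ∈ Set.Ioo a b, deriv (deriv y) t =
      A !₂[t, y t] * deriv y t ^ 3 + B !₂[t, y t] * deriv y t ^ 2
        + C !₂[t, y t] * deriv y t + D !₂[t, y t]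

end CartanConnection

/-- A smooth regular curve `x` on the open interval `J`. -/
def IsRegularCurve (J : Set ℝ) (x : ℝ → Plane) : Prop :=
  IsOpen J ∧ J.OrdConnected ∧ ContDiffOn ℝ ∞ x J ∧ ∀ t ∈ J, deriv x t ≠ 0

/-- The regular curve `x` on `J`, which need not be a graph, is an unparametrized solution of
`y'' = A (y')³ + B (y')² + C y' + D`. For a graph, `x t = (t, y t)`, this is the equation
itself; for `x t = (z t, t)` it is the same equation with `x` as a function of `y`. -/
def IsSolutionCurve (A B C D : Plane → ℝ) (J : Set ℝ) (x : ℝ → Plane) : Prop :=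
  ∀ t ∈ J,
    deriv x t 0 * deriv (deriv x) t 1 - deriv (deriv x) t 0 * deriv x t 1 =
      A (x t) * deriv x t 1 ^ 3 + B (x t) * deriv x t 0 * deriv x t 1 ^ 2
        + C (x t) * deriv x t 0 ^ 2 * deriv x t 1 + D (x t) * deriv x t 0 ^ 3

/-! ### The explicit connection form -/

/-- `∂f/∂x`. -/
def dX (f : Plane → ℝ) (p : Plane) : ℝ := fderiv ℝ f p (EuclideanSpace.single 0 1)

/-- `∂f/∂y`. -/
def dY (f : Plane → ℝ) (p : Plane) : ℝ := fderiv ℝ f p (EuclideanSpace.single 1 1)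

/-- The matrix-valued 1-form on the plane given by `A, B, C, D`, at the point `p` and on the
vector `v`, with `v 0 = dx(v)` and `v 1 = dy(v)`. -/
def explicitForm (A B C D : Plane → ℝ) (p v : Plane) : Mat3 :=
  !![0,
      (dY D p - 1 / 3 * dX C p - 2 / 3 * B p * D p + 2 / 9 * C p ^ 2) * v 0
        + (1 / 3 * dY C p - 1 / 3 * dX B p + 1 / 9 * B p * C p - A p * D p) * v 1,
      (1 / 3 * dY C p - 1 / 3 * dX B p + 1 / 9 * B p * C p - A p * D p) * v 0
        + (1 / 3 * dY B p - dX A p + 2 / 9 * B p ^ 2 - 2 / 3 * A p * C p) * v 1;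
    v 0,
      1 / 3 * (C p * v 0 + B p * v 1),
      1 / 3 * B p * v 0 + A p * v 1;
    v 1,
      - D p * v 0 - 1 / 3 * C p * v 1,
      - (1 / 3 * (C p * v 0 + B p * v 1))]

/-- In some smooth global section `s` of the bundle, the form `s^* ω` is the explicit one. -/
def CartanConnection.HasExplicitForm {Q : PrincipalBundle.{u}} (η : CartanConnection Q)
    (A B C D : Plane → ℝ) : Prop :=
  ∃ s : Plane → Q.Total, ContMDiff 𝓘(ℝ, Plane) Q.I ∞ s ∧ (∀ x, Q.proj (s x) = x) ∧
    ∀ x v : Plane, (η.form (s x) (mfderiv 𝓘(ℝ, Plane) Q.I s x v) : Mat3) =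
      explicitForm A B C D x v

end ProjConn

end

open ProjConn

namespace ProjConn

/-! ### Linear differential equations -/

/-! A section s of P turns the connection into a matrix-valued form θ = s^*ω on the plane, and
replacing s by sγ replaces θ by γ⁻¹θγ + γ⁻¹dγ (`form_mfderiv_act`). Asking that the first column of
θ be (0, dx, dy) uses up exactly the freedom in γ: the entries below the corner fix the lower block
of γ up to the factor γ₀₀, the determinant fixes γ₀₀ as a real cube root, and the corner entry fixes
the rest of the first row. Hence normal sections exist locally and are unique, so they glue to a
global one (`exists_isNormalSection_near`, `IsNormalSection.eqOn`, `exists_isNormalSection`).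
Conversely, every `NormalForm` θ defines the connection g⁻¹θg + g⁻¹dg on the product of the plane
and G, and (x, g) ↦ s(x)g identifies it with any connection whose normal section pulls ω back to θ
(`NormalForm.isomorphic`). Both existence and uniqueness become statements about θ.

Geodesics: in a section, development is the linear equation h' = hΘ with Θ = θ(x'), and the
developed point is the first column of h. It lies in the kernel of a covector f exactly when the
solution r = fh of r' = rΘ has r₀ = 0. As the first column of Θ is the velocity, (r₁, r₂) must
annihilate the velocity, so r is a multiple of (0, -y', x'); inserting this in the equation for r
gives the vanishing of `geodesicDefect`. Conversely, when the defect vanishes, a rescaling of (0,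
-y', x') solves the equation. Thus the geodesics are the solutions of an equation y'' = cubic in y'
whose coefficients come from the lower right block of θ.

Curvature: at s(x)g it is the conjugate by g of a multiple of dθ + θ∧θ, and the shape required by W
is stable under this conjugation, so (ii) is a condition on θ alone. The trace-free lower block has
six unknown coefficients. The entries (1,0) and (2,0) of the curvature give two linear equations for
them, and the four coefficients of the cubic, read off from geodesics through every point with every
slope, give the other four. The entry (0,0) then makes the first row symmetric, and three further
entries express it through the block and its derivatives (`NormalForm.eq_explicitForm`). The
resulting form does satisfy all the conditions (`explicit_curv`, `explicit_isGeodesic_iff`). -/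

/-- Grönwall's inequality in both directions from t₀; the part to the left follows by reversing
time. It serves both as an a priori bound and, applied to a difference, as a uniqueness statement.
-/
theorem norm_le_mul_exp_of_hasDerivWithinAt {E : Type*} [NormedAddCommGroup E] [NormedSpace ℝ E]
    {a b t₀ K : ℝ} {y y' : ℝ → E} (h₀ : t₀ ∈ Set.Icc a b)
    (hy : ∀ t ∈ Set.Icc a b, HasDerivWithinAt y (y' t) (Set.Icc a b) t)
    (hK : ∀ t ∈ Set.Icc a b, ‖y' t‖ ≤ K * ‖y t‖) :
    ∀ t ∈ Set.Icc a b, ‖y t‖ ≤ ‖y t₀‖ * Real.exp (K * |t - t₀|) := by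
  have hc : ContinuousOn y (Set.Icc a b) := fun t ht => (hy t ht).continuousWithinAt
  intro t ht
  rcases le_total t₀ t with h | h
  · have := norm_le_gronwallBound_of_norm_deriv_right_le (f := y) (f' := y') (δ := ‖y t₀‖)
      (K := K) (ε := 0) (a := t₀) (b := b) (hc.mono (Set.Icc_subset_Icc_left h₀.1))
      (fun s hs => by
        have hs' : s ∈ Set.Icc a b := ⟨h₀.1.trans hs.1, hs.2.le⟩
        exact (hy s hs').mono_of_mem_nhdsWithin (Icc_mem_nhdsGE_of_mem ⟨hs'.1, hs.2⟩))
      le_rfl (fun s hs => by simpa using hK s ⟨h₀.1.trans hs.1, hs.2.le⟩) t ⟨h, ht.2⟩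
    rwa [gronwallBound_ε0, ← abs_of_nonneg (sub_nonneg.2 h)] at this
  · have hmap : ∀ s ∈ Set.Icc (-t₀) (-a), -s ∈ Set.Icc a b := fun s hs =>
      ⟨by linarith [hs.2], by linarith [hs.1, h₀.2]⟩
    have := norm_le_gronwallBound_of_norm_deriv_right_le (f := fun s => y (-s))
      (f' := fun s => -y' (-s)) (δ := ‖y t₀‖)
      (K := K) (ε := 0) (a := -t₀) (b := -a) (hc.comp (by fun_prop) hmap)
      (fun s hs => by
        have hs' := hmap s ⟨hs.1, hs.2.le⟩
        have h1 : HasDerivWithinAt y (y' (-s)) (Set.Iic (-s)) (-s) :=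
          (hy _ hs').mono_of_mem_nhdsWithin
            (Icc_mem_nhdsLE_of_mem ⟨by linarith [hs.2], hs'.2⟩)
        have h2 := HasDerivWithinAt.scomp (h := fun r : ℝ => -r) s h1
          (hasDerivAt_neg s).hasDerivWithinAt (s := Set.Ici s)
          (fun r hr => neg_le_neg (Set.mem_Ici.1 hr))
        simpa [Function.comp_def] using h2)
      (by simp) (fun s hs => by simpa using hK (-s) (hmap s ⟨hs.1, hs.2.le⟩)) (-t)
      ⟨by linarith, by linarith [ht.1]⟩
    rw [gronwallBound_ε0] at this
    rw [abs_of_nonpos (sub_nonpos.2 h)]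
    simpa [add_comm, sub_eq_add_neg] using this

/-- The coordinatewise truncation of a vector to the cube of half-side `M`. -/
def clamp (M : ℝ) (y : Fin 3 → ℝ) : Fin 3 → ℝ := fun i => max (-M) (min M (y i))

theorem norm_clamp_le {M : ℝ} (hM : 0 ≤ M) (y : Fin 3 → ℝ) : ‖clamp M y‖ ≤ M := by
  rw [pi_norm_le_iff_of_nonneg hM]
  intro i
  rw [Real.norm_eq_abs, abs_le]
  exact ⟨le_max_left _ _, max_le (by linarith) (min_le_left _ _)⟩

theorem norm_clamp_le_norm {M : ℝ} (hM : 0 ≤ M) (y : Fin 3 → ℝ) : ‖clamp M y‖ ≤ ‖y‖ := by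
  rw [pi_norm_le_iff_of_nonneg (norm_nonneg _)]
  intro i
  have h := norm_le_pi_norm y i
  rw [Real.norm_eq_abs, abs_le] at h ⊢
  refine ⟨?_, max_le (by linarith [norm_nonneg y]) ((min_le_right _ _).trans h.2)⟩
  exact le_max_of_le_right (le_min (by linarith [norm_nonneg y]) h.1)

theorem clamp_eq_self {M : ℝ} {y : Fin 3 → ℝ} (h : ‖y‖ ≤ M) : clamp M y = y := by
  funext i
  have := (norm_le_pi_norm y i).trans h
  rw [Real.norm_eq_abs, abs_le] at this
  rw [clamp, min_eq_right this.2, max_eq_right this.1]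

theorem lipschitzWith_clamp (M : ℝ) : LipschitzWith 1 (clamp M) := by
  have h1 : LipschitzWith 1 fun x : ℝ => max (-M) (min M x) :=
    (LipschitzWith.id.const_min M).const_max (-M)
  refine LipschitzWith.of_dist_le_mul fun x y => ?_
  rw [NNReal.coe_one, one_mul, dist_pi_le_iff dist_nonneg]
  intro i
  have h2 := h1.dist_le_mul (x i) (y i)
  rw [NNReal.coe_one, one_mul] at h2
  exact h2.trans (dist_le_pi_dist x y i)

/-- Truncating the argument makes the field bounded as well as Lipschitz, so Picard–Lindelöf covers
the whole interval at once. The truncated field still obeys the linear growth bound, and Grönwall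
shows that the solution never reaches the truncation. -/
theorem exists_linear_ode_Icc {a b t₀ : ℝ} (h₀ : t₀ ∈ Set.Icc a b)
    {A : ℝ → (Fin 3 → ℝ) →L[ℝ] (Fin 3 → ℝ)} (hA : ContinuousOn A (Set.Icc a b)) (y₀ : Fin 3 → ℝ) :
    ∃ y : ℝ → Fin 3 → ℝ, y t₀ = y₀ ∧
      ∀ t ∈ Set.Icc a b, HasDerivWithinAt y (A t (y t)) (Set.Icc a b) t := by
  obtain ⟨K₀, hK₀⟩ := isCompact_Icc.exists_bound_of_continuousOn hA
  set K : ℝ := max K₀ 0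
  have hK : ∀ t ∈ Set.Icc a b, ‖A t‖ ≤ K := fun t ht => (hK₀ t ht).trans (le_max_left _ _)
  have hK0 : 0 ≤ K := le_max_right _ _
  -- The Grönwall bound over the full length of the interval; it is the size at which truncation
  -- becomes harmless.
  set M : ℝ := ‖y₀‖ * Real.exp (K * (b - a))
  have hM : 0 ≤ M := by positivity
  have hab : 0 ≤ b - a := by linarith [h₀.1, h₀.2]
  have hPL : IsPicardLindelof (fun t y => A t (clamp M y)) (tmin := a) (tmax := b) ⟨t₀, h₀⟩ y₀
      ⟨K * M * (b - a), by positivity⟩ 0 ⟨K * M, by positivity⟩ ⟨K, hK0⟩ := by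
    constructor
    · intro t ht
      refine LipschitzWith.lipschitzOnWith (LipschitzWith.of_dist_le_mul fun x y => ?_)
      rw [dist_eq_norm, ← map_sub]
      refine ((A t).le_of_opNorm_le (hK t ht) _).trans ?_
      have := (lipschitzWith_clamp M).dist_le_mul x y
      rw [dist_eq_norm, NNReal.coe_one, one_mul] at this
      exact mul_le_mul_of_nonneg_left this hK0
    · intro x _
      exact hA.clm_apply continuousOn_const
    · intro t ht x _
      exact ((A t).le_of_opNorm_le (hK t ht) _).trans
        (mul_le_mul_of_nonneg_left (norm_clamp_le hM x) hK0)
    · simp only [NNReal.coe_zero, sub_zero]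
      refine mul_le_mul_of_nonneg_left (max_le ?_ ?_) (mul_nonneg hK0 hM)
      · linarith [h₀.1]
      · linarith [h₀.2]
  obtain ⟨y, hy0, hy⟩ := hPL.exists_eq_forall_mem_Icc_hasDerivWithinAt₀
  simp only at hy0
  have hb := norm_le_mul_exp_of_hasDerivWithinAt (K := K) h₀ hy fun t ht =>
    ((A t).le_of_opNorm_le (hK t ht) _).trans
      (mul_le_mul_of_nonneg_left (norm_clamp_le_norm hM _) hK0)
  refine ⟨y, hy0, fun t ht => ?_⟩
  have hyM : ‖y t‖ ≤ M := by
    refine (hb t ht).trans ?_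
    rw [hy0]
    have : |t - t₀| ≤ b - a := abs_le.2 ⟨by linarith [h₀.2, ht.1], by linarith [h₀.1, ht.2]⟩
    exact mul_le_mul_of_nonneg_left (Real.exp_le_exp.2 (mul_le_mul_of_nonneg_left this hK0))
      (norm_nonneg _)
  simpa only [clamp_eq_self hyM] using hy t ht

theorem exists_Icc_subset_of_isOpen {J : Set ℝ} (hJ : IsOpen J) (hJc : J.OrdConnected) {s t : ℝ}
    (hs : s ∈ J) (ht : t ∈ J) :
    ∃ a b, Set.Icc a b ⊆ J ∧ s ∈ Set.Ioo a b ∧ t ∈ Set.Ioo a b := by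
  have key : ∀ {x}, x ∈ J → ∃ a ∈ J, ∃ b ∈ J, a < x ∧ x < b := by
    intro x hx
    obtain ⟨ε, hε, h⟩ := Metric.isOpen_iff.1 hJ x hx
    refine ⟨x - ε / 2, h ?_, x + ε / 2, h ?_, by linarith, by linarith⟩ <;>
      simp [abs_of_pos hε, hε]
  rcases le_total s t with h | h
  · obtain ⟨a, ha, -, -, has, -⟩ := key hs
    obtain ⟨-, -, b, hb, -, htb⟩ := key ht
    exact ⟨a, b, hJc.out ha hb, ⟨has, by linarith⟩, ⟨by linarith, htb⟩⟩
  · obtain ⟨a, ha, -, -, has, -⟩ := key ht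
    obtain ⟨-, -, b, hb, -, htb⟩ := key hs
    exact ⟨a, b, hJc.out ha hb, ⟨by linarith, by linarith⟩, ⟨by linarith, by linarith⟩⟩

/-- Solutions on compact subintervals containing t₀ agree on overlaps, by Grönwall for their
difference, and therefore glue. -/
theorem exists_linear_ode {J : Set ℝ} (hJ : IsOpen J) (hJc : J.OrdConnected) {t₀ : ℝ}
    (h₀ : t₀ ∈ J) {A : ℝ → (Fin 3 → ℝ) →L[ℝ] (Fin 3 → ℝ)} (hA : ContinuousOn A J)
    (y₀ : Fin 3 → ℝ) :
    ∃ y : ℝ → Fin 3 → ℝ, y t₀ = y₀ ∧ ∀ t ∈ J, HasDerivAt y (A t (y t)) t := by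
  choose! a b hab h0 ht using fun t (ht : t ∈ J) => exists_Icc_subset_of_isOpen hJ hJc h₀ ht
  have hI : ∀ t ∈ J, t₀ ∈ Set.Icc (a t) (b t) := fun t h => Set.Ioo_subset_Icc_self (h0 t h)
  choose! y hy0 hy using fun t (h : t ∈ J) =>
    exists_linear_ode_Icc (hI t h) (hA.mono (hab t h)) y₀
  have huniq : ∀ s ∈ J, ∀ t ∈ J, ∀ r ∈ Set.Icc (a s) (b s) ∩ Set.Icc (a t) (b t),
      y s r = y t r := by
    intro s hs t ht' r hr
    rw [Set.Icc_inter_Icc] at hr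
    set a' := max (a s) (a t)
    set b' := min (b s) (b t)
    obtain ⟨K, hK⟩ := isCompact_Icc.exists_bound_of_continuousOn
      (hA.mono ((Set.Icc_subset_Icc (le_max_left _ _) (min_le_left _ _)).trans (hab s hs)) :
        ContinuousOn A (Set.Icc a' b'))
    have hm0 : t₀ ∈ Set.Icc a' b' :=
      ⟨max_le (h0 s hs).1.le (h0 t ht').1.le, le_min (h0 s hs).2.le (h0 t ht').2.le⟩
    have := norm_le_mul_exp_of_hasDerivWithinAt (K := K) (y := fun r => y s r - y t r)
      (y' := fun r => A r (y s r) - A r (y t r)) hm0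
      (fun r hr => ((hy s hs r ⟨(le_max_left _ _).trans hr.1, hr.2.trans (min_le_left _ _)⟩).mono
        (Set.Icc_subset_Icc (le_max_left _ _) (min_le_left _ _))).sub
        ((hy t ht' r ⟨(le_max_right _ _).trans hr.1, hr.2.trans (min_le_right _ _)⟩).mono
        (Set.Icc_subset_Icc (le_max_right _ _) (min_le_right _ _))))
      (fun r hr => by rw [← map_sub]; exact (A r).le_of_opNorm_le (hK r hr) _) r hr
    simp only [hy0 s hs, hy0 t ht', sub_self, norm_zero, zero_mul] at this
    exact sub_eq_zero.1 (norm_le_zero_iff.1 this)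
  -- The glued solution is the diagonal: at t, use the solution chosen on an interval with t in its
  -- interior.
  refine ⟨fun t => y t t, hy0 t₀ h₀, fun t htJ => ?_⟩
  have hnear : (fun s => y s s) =ᶠ[nhds t] y t := by
    filter_upwards [Ioo_mem_nhds (ht t htJ).1 (ht t htJ).2] with s hs
    have hsJ : s ∈ J := hab t htJ (Set.Ioo_subset_Icc_self hs)
    exact huniq s hsJ t htJ s
      ⟨Set.Ioo_subset_Icc_self (ht s hsJ), Set.Ioo_subset_Icc_self hs⟩
  exact ((hy t htJ t (Set.Ioo_subset_Icc_self (ht t htJ))).hasDerivAt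
    (Icc_mem_nhds (ht t htJ).1 (ht t htJ).2)).congr_of_eventuallyEq hnear

/-! ### Smooth maps into the stationary subgroup -/

/-- The matrix of an element of the stationary subgroup. -/
abbrev mat (g : stabGroup) : Mat3 := ((g : SL3) : Mat3)

theorem mat_mul (g h : stabGroup) : mat (g * h) = mat g * mat h := rfl

theorem mat_one : mat 1 = 1 := rfl

theorem mat_mul_inv (g : stabGroup) : mat g * mat g⁻¹ = 1 := by
  rw [← mat_mul, mul_inv_cancel, mat_one]

theorem mat_inv_mul (g : stabGroup) : mat g⁻¹ * mat g = 1 := by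
  rw [← mat_mul, inv_mul_cancel, mat_one]

theorem mat_one_zero (g : stabGroup) : mat g 1 0 = 0 := g.2.1

theorem mat_two_zero (g : stabGroup) : mat g 2 0 = 0 := g.2.2

theorem mat_inv (g : stabGroup) : mat g⁻¹ = (mat g).adjugate :=
  Matrix.SpecialLinearGroup.coe_inv _

theorem blockDet_gCoord_ne_zero (g : stabGroup) : blockDet (gCoord g) ≠ 0 := (gHomeo g).2

theorem mat_zero_zero (g : stabGroup) : mat g 0 0 = (blockDet (gCoord g))⁻¹ :=
  eq_inv_of_mul_eq_one_left (stabGroup_det g)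

theorem mat_zero_zero_ne_zero (g : stabGroup) : mat g 0 0 ≠ 0 := by
  rw [mat_zero_zero]; exact inv_ne_zero (blockDet_gCoord_ne_zero g)

theorem mat_injective : Function.Injective mat := fun _ _ h => Subtype.ext (Subtype.ext h)

/-- The element of the stationary subgroup with given coordinates, and `1` where the coordinates
are not admissible. -/
noncomputable def gInv (m : GModel) : stabGroup :=
  open Classical in if h : blockDet m ≠ 0 then ofCoord ⟨m, h⟩ else 1

theorem gInv_gCoord (g : stabGroup) : gInv (gCoord g) = g := by
  rw [gInv, dif_pos (blockDet_gCoord_ne_zero g)]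
  exact gHomeo.left_inv g

theorem gCoord_gInv {m : GModel} (h : blockDet m ≠ 0) : gCoord (gInv m) = m := by
  rw [gInv, dif_pos h]
  exact congrArg Subtype.val (gHomeo.right_inv ⟨m, h⟩)

theorem range_gCoord : Set.range gCoord = {m | blockDet m ≠ 0} := by
  ext m
  exact ⟨by rintro ⟨g, rfl⟩; exact blockDet_gCoord_ne_zero g, fun h => ⟨gInv m, gCoord_gInv h⟩⟩

theorem isOpen_blockDet_ne_zero : IsOpen {m : GModel | blockDet m ≠ 0} :=
  isOpen_ne_fun continuous_blockDet continuous_const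

theorem contMDiff_gCoord : ContMDiff 𝓘(ℝ, GModel) 𝓘(ℝ, GModel) ∞ gCoord :=
  contMDiff_isOpenEmbedding isOpenEmbedding_gCoord

theorem contMDiffOn_gInv :
    ContMDiffOn 𝓘(ℝ, GModel) 𝓘(ℝ, GModel) ∞ gInv {m | blockDet m ≠ 0} := by
  have h := contMDiffOn_isOpenEmbedding_symm (I := 𝓘(ℝ, GModel)) (n := ∞) isOpenEmbedding_gCoord
  rw [range_gCoord] at h
  refine h.congr fun m hm => ?_
  obtain ⟨g, rfl⟩ : m ∈ Set.range gCoord := by rwa [range_gCoord]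
  rw [gInv_gCoord, Topology.IsOpenEmbedding.toOpenPartialHomeomorph_left_inv]

theorem contDiff_blockDet : ContDiff ℝ ∞ blockDet := by
  unfold blockDet; fun_prop

theorem contMDiff_mat (i j : Fin 3) :
    ContMDiff 𝓘(ℝ, GModel) 𝓘(ℝ, ℝ) ∞ (fun g : stabGroup => mat g i j) := by
  induction j using Fin.cases with
  | zero =>
    fin_cases i
    · have h : ContMDiffOn 𝓘(ℝ, GModel) 𝓘(ℝ, ℝ) ∞ (fun m : GModel => (blockDet m)⁻¹)
          {m | blockDet m ≠ 0} :=
        (contDiff_blockDet.contDiffOn.inv fun m hm => hm).contMDiffOn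
      exact (h.comp_contMDiff contMDiff_gCoord blockDet_gCoord_ne_zero).congr mat_zero_zero
    · exact contMDiff_const.congr mat_one_zero
    · exact contMDiff_const.congr mat_two_zero
  | succ j =>
    have h : ContMDiff 𝓘(ℝ, GModel) 𝓘(ℝ, ℝ) ∞ (fun m : GModel => m i j) :=
      ContDiff.contMDiff (by fun_prop)
    exact h.comp contMDiff_gCoord

section Maps

variable {E H M : Type*} [NormedAddCommGroup E] [NormedSpace ℝ E] [TopologicalSpace H]
  {I : ModelWithCorners ℝ E H} [TopologicalSpace M] [ChartedSpace H M] {s : Set M} {x : M}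
  {γ δ : M → stabGroup}

/-- Two columns of the matrix are global coordinates on G, so smoothness can be tested on entries.
Products and inverses are then smooth because their entries are polynomials in the given ones. -/
theorem contMDiffWithinAt_stabGroup
    (h : ∀ i j, ContMDiffWithinAt I 𝓘(ℝ, ℝ) ∞ (fun m => mat (γ m) i j) s x) :
    ContMDiffWithinAt I 𝓘(ℝ, GModel) ∞ γ s x := by
  have h1 : ContMDiffWithinAt I 𝓘(ℝ, GModel) ∞ (fun m => gCoord (γ m)) s x := by
    rw [contMDiffWithinAt_pi_space]
    intro i
    rw [contMDiffWithinAt_pi_space]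
    intro j
    exact h i j.succ
  have h2 := (contMDiffOn_gInv.contMDiffAt
    (isOpen_blockDet_ne_zero.mem_nhds (blockDet_gCoord_ne_zero (γ x)))).comp_contMDiffWithinAt
      x h1
  exact h2.congr (fun m _ => (gInv_gCoord _).symm) (gInv_gCoord _).symm

theorem contMDiffWithinAt_mat (h : ContMDiffWithinAt I 𝓘(ℝ, GModel) ∞ γ s x) (i j : Fin 3) :
    ContMDiffWithinAt I 𝓘(ℝ, ℝ) ∞ (fun m => mat (γ m) i j) s x :=
  (contMDiff_mat i j).contMDiffAt.comp_contMDiffWithinAt x h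

theorem contMDiffWithinAt_mul (h : ContMDiffWithinAt I 𝓘(ℝ, GModel) ∞ γ s x)
    (h' : ContMDiffWithinAt I 𝓘(ℝ, GModel) ∞ δ s x) :
    ContMDiffWithinAt I 𝓘(ℝ, GModel) ∞ (fun m => γ m * δ m) s x := by
  refine contMDiffWithinAt_stabGroup fun i j => ?_
  simp only [mat_mul, Matrix.mul_apply, Fin.sum_univ_three]
  have h1 := contMDiffWithinAt_mat h
  have h2 := contMDiffWithinAt_mat h'
  exact (((h1 i 0).mul (h2 0 j)).add ((h1 i 1).mul (h2 1 j))).add ((h1 i 2).mul (h2 2 j))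

theorem contMDiffWithinAt_inv (h : ContMDiffWithinAt I 𝓘(ℝ, GModel) ∞ γ s x) :
    ContMDiffWithinAt I 𝓘(ℝ, GModel) ∞ (fun m => (γ m)⁻¹) s x := by
  refine contMDiffWithinAt_stabGroup fun i j => ?_
  simp only [mat_inv, Matrix.adjugate_fin_three]
  have h1 := contMDiffWithinAt_mat h
  fin_cases i <;> fin_cases j <;> simp <;>
    first
    | exact ((h1 _ _).mul (h1 _ _)).sub ((h1 _ _).mul (h1 _ _))
    | exact (((h1 _ _).mul (h1 _ _)).neg).add ((h1 _ _).mul (h1 _ _))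

end Maps

/-! ### The action of the group on sections -/

section Gauge

variable {E H M : Type*} [NormedAddCommGroup E] [NormedSpace ℝ E] [TopologicalSpace H]
  {I : ModelWithCorners ℝ E H} [TopologicalSpace M] [ChartedSpace H M]

/-- The derivative of the matrix of a map into the stationary subgroup. -/
noncomputable def dMat (I : ModelWithCorners ℝ E H) (γ : M → stabGroup) (m : M)
    (v : TangentSpace I m) : Mat3 :=
  Matrix.of fun i j => mfderiv I 𝓘(ℝ, ℝ) (fun m => mat (γ m) i j) m v

theorem mdifferentiableAt_mat {γ : M → stabGroup} {m : M}
    (h : MDifferentiableAt I 𝓘(ℝ, GModel) γ m) (i j : Fin 3) :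
    MDifferentiableAt I 𝓘(ℝ, ℝ) (fun m => mat (γ m) i j) m :=
  ((contMDiff_mat i j).mdifferentiableAt (by simp)).comp m h

/-- Every tangent space is the model space, so one vector can be read at both points. This is needed
wherever base points agree only propositionally. -/
theorem CartanConnection.form_congr {Q : PrincipalBundle.{u}} (η : CartanConnection Q)
    {p p' : Q.Total} (h : p = p') (v : Q.Model) :
    (η.form p (v : TangentSpace Q.I p)) = η.form p' (v : TangentSpace Q.I p') := by
  subst h; rfl

theorem mdifferentiableAt_const_mul (g : stabGroup) {γ : M → stabGroup} {m : M}
    (h : MDifferentiableAt I 𝓘(ℝ, GModel) γ m) :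
    MDifferentiableAt I 𝓘(ℝ, GModel) (fun m => g * γ m) m := by
  have : ContMDiff 𝓘(ℝ, GModel) 𝓘(ℝ, GModel) ∞ (fun h : stabGroup => g * h) := fun h =>
    contMDiffWithinAt_mul contMDiffWithinAt_const contMDiffWithinAt_id
  exact (this.mdifferentiableAt (by simp)).comp m h

theorem dMat_const_mul (g : stabGroup) {γ : M → stabGroup} {m : M}
    (h : MDifferentiableAt I 𝓘(ℝ, GModel) γ m) (v : TangentSpace I m) :
    dMat I (fun m => g * γ m) m v = mat g * dMat I γ m v := by
  ext i j
  have h1 : ∀ k, HasMFDerivAt I 𝓘(ℝ, ℝ) (fun m => mat g i k * mat (γ m) k j) m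
      (mat g i k • mfderiv I 𝓘(ℝ, ℝ) (fun m => mat (γ m) k j) m) := fun k =>
    (mdifferentiableAt_mat h k j).hasMFDerivAt.const_smul (mat g i k)
  have h2 := ((h1 0).add (h1 1)).add (h1 2)
  have h3 : (fun m => mat (g * γ m) i j) =
    (fun m => mat g i 0 * mat (γ m) 0 j) + (fun m => mat g i 1 * mat (γ m) 1 j)
      + (fun m => mat g i 2 * mat (γ m) 2 j) := by
    funext m; simp [mat_mul, Matrix.mul_apply, Fin.sum_univ_three]
  rw [Matrix.mul_apply, Fin.sum_univ_three]
  change mfderiv I 𝓘(ℝ, ℝ) (fun m => mat (g * γ m) i j) m v = _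
  rw [h3, h2.mfderiv]
  rfl

/-- The gauge formula. By the product rule the derivative of σγ splits into a motion of σ with γ
frozen, governed by equivariance, and a motion along the fibre, governed by the values of ω on
fundamental fields. -/
theorem form_mfderiv_act {Q : PrincipalBundle.{u}} (η : CartanConnection Q) {σ : M → Q.Total}
    {γ : M → stabGroup} {m : M} (hσ : MDifferentiableAt I Q.I σ m)
    (hγ : MDifferentiableAt I 𝓘(ℝ, GModel) γ m) (v : TangentSpace I m) :
    (η.form (Q.act (σ m) (γ m)) (mfderiv I Q.I (fun m => Q.act (σ m) (γ m)) m v) : Mat3) =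
      mat (γ m)⁻¹ * (η.form (σ m) (mfderiv I Q.I σ m v) : Mat3) * mat (γ m)
        + mat (γ m)⁻¹ * dMat I γ m v := by
  set g := γ m with hg
  have hact : MDifferentiableAt (𝓘(ℝ, Q.Model).prod 𝓘(ℝ, GModel)) 𝓘(ℝ, Q.Model)
      (fun q : Q.Total × stabGroup => Q.act q.1 q.2) (σ m, γ m) :=
    Q.contMDiff_act.mdifferentiableAt (by simp)
  have h1 : mfderiv I Q.I (fun m => Q.act (σ m) (γ m)) m v =
      mfderiv Q.I Q.I (fun q => Q.act q g) (σ m) (mfderiv I Q.I σ m v)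
        + mfderiv 𝓘(ℝ, GModel) Q.I (fun h => Q.act (σ m) h) g
            (mfderiv I 𝓘(ℝ, GModel) γ m v) := by
    have hc := mfderiv_comp_apply (I' := 𝓘(ℝ, Q.Model).prod 𝓘(ℝ, GModel)) m hact
      (hσ.prodMk hγ) v
    have hd := mfderiv_prod_eq_add_apply hact (v := mfderiv I (𝓘(ℝ, Q.Model).prod 𝓘(ℝ, GModel))
      (fun x => (σ x, γ x)) m v)
    rw [hσ.mfderiv_prod hγ] at hc hd
    exact hc.trans hd
  -- Fundamental fields are derivatives at the identity. The fibre motion from σ m through γ is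
  -- therefore rewritten as the motion from p = σ m · g through g⁻¹γ, which passes through 1 at m.
  have hγ' := mdifferentiableAt_const_mul g⁻¹ hγ
  have hone : g⁻¹ * γ m = 1 := inv_mul_cancel g
  set p := Q.act (σ m) g
  have hp : ∀ p : Q.Total, ContMDiff 𝓘(ℝ, GModel) Q.I ∞ (fun h : stabGroup => Q.act p h) :=
    fun p => Q.contMDiff_act.comp (contMDiff_const.prodMk contMDiff_id)
  have h2 : mfderiv 𝓘(ℝ, GModel) Q.I (fun h => Q.act (σ m) h) g
            (mfderiv I 𝓘(ℝ, GModel) γ m v) =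
      mfderiv 𝓘(ℝ, GModel) Q.I (fun h => Q.act p h) 1
        (mfderiv I 𝓘(ℝ, GModel) (fun m => g⁻¹ * γ m) m v) := by
    have e : (fun h => Q.act (σ m) h) ∘ γ = (fun h => Q.act p h) ∘ (fun m => g⁻¹ * γ m) := by
      funext m'
      simp only [Function.comp, p]
      rw [← Q.act_mul, mul_inv_cancel_left]
    have c1 := mfderiv_comp_apply m (((hp (σ m)).mdifferentiable (by simp)) (γ m)) hγ v
    have c2 := mfderiv_comp_apply_of_eq m (((hp p).mdifferentiable (by simp)) 1) hγ' hone v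
    rw [e] at c1
    exact c1.symm.trans c2
  have h3 : (η.form p (mfderiv 𝓘(ℝ, GModel) Q.I (fun h => Q.act p h) 1
        (mfderiv I 𝓘(ℝ, GModel) (fun m => g⁻¹ * γ m) m v)) : Mat3) =
      mat g⁻¹ * dMat I γ m v := by
    rw [← dMat_const_mul g⁻¹ hγ v]
    ext i j
    have f := η.fundamental p (mfderiv I 𝓘(ℝ, GModel) (fun m => g⁻¹ * γ m) m v) i j
    have c := mfderiv_comp_apply_of_eq m (((contMDiff_mat i j).mdifferentiable (by simp)) 1)
      hγ' hone v
    have e := congrArg (fun X : sl3 => (X : Mat3) i j) (η.form_congr (Q.act_one p)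
      (mfderiv 𝓘(ℝ, GModel) Q.I (fun h => Q.act p h) 1
        (mfderiv I 𝓘(ℝ, GModel) (fun m => g⁻¹ * γ m) m v)))
    exact e.symm.trans (f.trans c.symm)
  rw [h1, map_add, Submodule.coe_add, η.equivariant, h2, h3]

end Gauge

/-! ### Fibres of a principal bundle and the trivializations defined by sections -/

namespace PrincipalBundle

variable (Q : PrincipalBundle.{u})

theorem proj_act (p : Q.Total) (g : stabGroup) : Q.proj (Q.act p g) = Q.proj p := by
  obtain ⟨U, s, τ, -, hx, -, -, h1, h2⟩ := Q.locallyTrivial (Q.proj p)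
  rw [← h2 p hx, ← Q.act_mul, (h1 _ hx _).1, (h1 _ hx _).1]

theorem act_left_injective (p : Q.Total) : Function.Injective (Q.act p) := by
  intro g h hgh
  obtain ⟨U, s, τ, -, hx, -, -, h1, h2⟩ := Q.locallyTrivial (Q.proj p)
  rw [← h2 p hx, ← Q.act_mul, ← Q.act_mul] at hgh
  have := congrArg τ hgh
  rwa [(h1 _ hx _).2, (h1 _ hx _).2, mul_right_inj] at this

/-- Compare s with the local sections supplied by the bundle. The group coordinate relative to s is
unique because the action is free on fibres, so a pointwise choice agrees with the smooth local
formulas. -/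
theorem exists_trivialization {U : Set Plane} (hU : IsOpen U) {s : Plane → Q.Total}
    (hs : ContMDiffOn 𝓘(ℝ, Plane) Q.I ∞ s U) (hsec : ∀ x ∈ U, Q.proj (s x) = x) :
    ∃ τ : Q.Total → stabGroup, ContMDiffOn Q.I 𝓘(ℝ, GModel) ∞ τ (Q.proj ⁻¹' U) ∧
      ∀ p, Q.proj p ∈ U → Q.act (s (Q.proj p)) (τ p) = p := by
  have key : ∀ x₀ ∈ U, ∃ (V : Set Plane) (τ : Q.Total → stabGroup), IsOpen V ∧ x₀ ∈ V ∧
      ContMDiffOn Q.I 𝓘(ℝ, GModel) ∞ τ (Q.proj ⁻¹' (U ∩ V)) ∧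
      ∀ p, Q.proj p ∈ U ∩ V → Q.act (s (Q.proj p)) (τ p) = p := by
    intro x₀ hx₀
    obtain ⟨V, r, τ, hV, hx, -, hτ, h1, h2⟩ := Q.locallyTrivial x₀
    -- If r is the given local section, then s = r τ(s) and p = r τ(p), whence p = s τ(s)⁻¹ τ(p).
    refine ⟨V, fun p => (τ (s (Q.proj p)))⁻¹ * τ p, hV, hx, ?_, ?_⟩
    · have e1 : ContMDiffOn Q.I 𝓘(ℝ, GModel) ∞ (fun p => τ (s (Q.proj p)))
          (Q.proj ⁻¹' (U ∩ V)) := by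
        refine hτ.comp ((hs.comp (t := U) Q.contMDiff_proj.contMDiffOn fun p hp => hp.1) ) ?_
        intro p hp
        simp only [Set.mem_preimage]
        rw [hsec _ hp.1]
        exact hp.2
      exact fun p hp => contMDiffWithinAt_mul (contMDiffWithinAt_inv (e1 p hp))
        ((hτ p hp.2).mono fun q hq => hq.2)
    · intro p hp
      have h3 := h2 (s (Q.proj p)) (by rw [hsec _ hp.1]; exact hp.2)
      rw [hsec _ hp.1] at h3
      conv_lhs => rw [← h3, ← Q.act_mul, mul_inv_cancel_left]
      exact h2 p hp.2
  have ex : ∀ p, ∃ g, Q.proj p ∈ U → Q.act (s (Q.proj p)) g = p := by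
    intro p
    by_cases hp : Q.proj p ∈ U
    · obtain ⟨V, τ, -, hx, -, h⟩ := key _ hp
      exact ⟨τ p, fun _ => h p ⟨hp, hx⟩⟩
    · exact ⟨1, fun h => absurd h hp⟩
  choose τ hτ using ex
  refine ⟨τ, fun p hp => ?_, hτ⟩
  obtain ⟨V, τ', hV, hx, hs', h⟩ := key _ hp
  have hopen : IsOpen (Q.proj ⁻¹' (U ∩ V)) :=
    (hU.inter hV).preimage Q.contMDiff_proj.continuous
  refine (((hs' p ⟨hp, hx⟩).contMDiffAt (hopen.mem_nhds ⟨hp, hx⟩)).congr_of_eventuallyEq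
    ?_).contMDiffWithinAt
  filter_upwards [hopen.mem_nhds ⟨hp, hx⟩] with q hq
  exact Q.act_left_injective _ ((hτ q hq.1).trans (h q hq).symm)

end PrincipalBundle

/-- Take the straight line in the coordinates of G. Its corner entry is the reciprocal of the block
determinant, whose derivative at 1 is minus the trace of the block of X; this is the corner of X
because X is trace-free. -/
theorem exists_curve_stabGroup {X : sl3} (hX : X ∈ stabAlg) :
    ∃ γ : ℝ → stabGroup, γ 0 = 1 ∧ MDifferentiableAt 𝓘(ℝ, ℝ) 𝓘(ℝ, GModel) γ 0 ∧
      dMat 𝓘(ℝ, ℝ) γ 0 (1 : ℝ) = X := by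
  set c : ℝ → GModel := fun t => gCoord 1 + t • fun i j => (X : Mat3) i j.succ
  have hc0 : c 0 = gCoord 1 := by simp [c]
  have hd : blockDet (c 0) ≠ 0 := by rw [hc0]; exact blockDet_gCoord_ne_zero 1
  have hc : ContDiff ℝ ∞ c := by fun_prop
  have hγ : MDifferentiableAt 𝓘(ℝ, ℝ) 𝓘(ℝ, GModel) (fun t => gInv (c t)) 0 :=
    ((contMDiffOn_gInv.contMDiffAt (isOpen_blockDet_ne_zero.mem_nhds hd)).comp (0 : ℝ)
      hc.contMDiff.contMDiffAt).mdifferentiableAt (by simp)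
  have hev : ∀ᶠ t in nhds (0 : ℝ), blockDet (c t) ≠ 0 :=
    (continuous_blockDet.comp hc.continuous).continuousAt.eventually_ne hd
  refine ⟨fun t => gInv (c t), by simp only [hc0, gInv_gCoord], hγ, ?_⟩
  have htr : (X : Mat3) 0 0 + (X : Mat3) 1 1 + (X : Mat3) 2 2 = 0 := by
    have := X.2
    rw [LinearMap.mem_ker, Matrix.traceLinearMap_apply, Matrix.trace_fin_three] at this
    exact this
  ext i j
  change mfderiv 𝓘(ℝ, ℝ) 𝓘(ℝ, ℝ) (fun t => mat (gInv (c t)) i j) 0 (1 : ℝ) = _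
  rw [mfderiv_eq_fderiv]
  change fderiv ℝ (fun t => mat (gInv (c t)) i j) 0 1 = _
  rw [fderiv_apply_one_eq_deriv]
  induction j using Fin.cases with
  | succ j =>
    have e : (fun t => mat (gInv (c t)) i j.succ) =ᶠ[nhds 0]
        fun t => gCoord 1 i j + t * (X : Mat3) i j.succ := by
      filter_upwards [hev] with t ht
      exact congrFun (congrFun (gCoord_gInv ht) i) j
    rw [e.deriv_eq]
    simp
  | zero =>
    fin_cases i
    · have e : (fun t => mat (gInv (c t)) 0 0) =ᶠ[nhds 0] fun t => (blockDet (c t))⁻¹ := by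
        filter_upwards [hev] with t ht
        rw [mat_zero_zero, gCoord_gInv ht]
      have hb : HasDerivAt (fun t => blockDet (c t)) ((X : Mat3) 1 1 + (X : Mat3) 2 2) 0 := by
        have e' : (fun t => blockDet (c t)) = fun t => (1 + t * (X : Mat3) 1 1) *
            (1 + t * (X : Mat3) 2 2) - (t * (X : Mat3) 1 2) * (t * (X : Mat3) 2 1) := by
          funext t
          simp [blockDet, c, gCoord]
        rw [e']
        have h1 : ∀ a : ℝ, HasDerivAt (fun t : ℝ => t * a) a 0 := fun a => by
          simpa using (hasDerivAt_id (0 : ℝ)).mul_const a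
        have := (((h1 ((X : Mat3) 1 1)).const_add 1).mul ((h1 ((X : Mat3) 2 2)).const_add 1)).sub
          ((h1 ((X : Mat3) 1 2)).mul (h1 ((X : Mat3) 2 1)))
        simpa [Pi.mul_def, Pi.sub_def] using this
      have h1 : blockDet (c 0) = 1 := by simp [blockDet, c, gCoord]
      change deriv (fun t => mat (gInv (c t)) 0 0) 0 = _
      change _ = (X : Mat3) 0 0
      have hi : HasDerivAt (fun t => (blockDet (c t))⁻¹) _ 0 := hb.inv hd
      rw [e.deriv_eq, hi.deriv, h1]
      linarith
    · change deriv (fun t => mat (gInv (c t)) 1 0) 0 = (X : Mat3) 1 0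
      simp only [mat_one_zero, deriv_const]
      exact hX.1.symm
    · change deriv (fun t => mat (gInv (c t)) 2 0) 0 = (X : Mat3) 2 0
      simp only [mat_two_zero, deriv_const]
      exact hX.2.symm

/-- If ω(w) lies in the subalgebra, then w is the velocity of a curve p γ(t) inside the fibre, since
both vectors have the same image under the injective map ω_p. The projection is constant on that
curve. -/
theorem CartanConnection.mfderiv_proj_eq_zero {Q : PrincipalBundle.{u}} (η : CartanConnection Q)
    {p : Q.Total} {w : TangentSpace Q.I p} (h : η.form p w ∈ stabAlg) :
    mfderiv Q.I 𝓘(ℝ, Plane) Q.proj p w = 0 := by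
  obtain ⟨γ, h0, hγ, hX⟩ := exists_curve_stabGroup h
  have h1 := form_mfderiv_act η (σ := fun _ : ℝ => p) mdifferentiableAt_const hγ (1 : ℝ)
  have hq : MDifferentiableAt 𝓘(ℝ, ℝ) Q.I (fun t => Q.act p (γ t)) 0 :=
    MDifferentiableAt.comp (g := fun q : Q.Total × stabGroup => Q.act q.1 q.2)
      (f := fun t => (p, γ t)) (0 : ℝ) (Q.contMDiff_act.mdifferentiable (by simp) _)
      (mdifferentiableAt_const.prodMk hγ)
  have h2 := mfderiv_comp_apply (0 : ℝ)
    ((Q.contMDiff_proj.mdifferentiable (by simp)) (Q.act p (γ 0))) hq (1 : ℝ)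
  have h3 : Q.proj ∘ (fun t => Q.act p (γ t)) = fun _ => Q.proj p := by
    funext t; exact Q.proj_act p _
  rw [h3, mfderiv_const] at h2
  rw [mfderiv_const] at h1
  set w' : Q.Model := mfderiv 𝓘(ℝ, ℝ) Q.I (fun t => Q.act p (γ t)) 0 (1 : ℝ)
  have key : ∀ p' : Q.Total, p' = p → mfderiv Q.I 𝓘(ℝ, Plane) Q.proj p' w' = 0 →
      (η.form p' (w' : TangentSpace Q.I p') : Mat3) = (η.form p w : Mat3) →
      mfderiv Q.I 𝓘(ℝ, Plane) Q.proj p w = 0 := by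
    rintro _ rfl e1 e2
    rwa [(η.bijective _).1 (Subtype.ext e2)] at e1
  refine key (Q.act p (γ 0)) (by rw [h0, Q.act_one]) h2.symm ?_
  refine h1.trans ?_
  have hz : (η.form p ((0 : TangentSpace 𝓘(ℝ, ℝ) (0:ℝ) →L[ℝ] TangentSpace Q.I p) (1 : ℝ))) = 0 :=
    map_zero (η.form p)
  rw [hz, hX, h0]
  simp [mat_one]

/-! ### Pull-backs of the connection form -/

/-- A linear map on trace-free matrices extends to all matrices, and so is a combination of the
entries with constant coefficients. -/
theorem contDiffOn_linear_comp_of_entries {F G : Type*} [NormedAddCommGroup F] [NormedSpace ℝ F]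
    [NormedAddCommGroup G] [NormedSpace ℝ G] {U : Set F} {f : F → sl3}
    (h : ∀ i j, ContDiffOn ℝ ∞ (fun z => (f z : Mat3) i j) U) (κ : sl3 →ₗ[ℝ] G) :
    ContDiffOn ℝ ∞ (fun z => κ (f z)) U := by
  obtain ⟨κ', hκ⟩ := κ.exists_extend
  have e : ∀ X : sl3, κ X = ∑ i, ∑ j, (X : Mat3) i j • κ' (Matrix.single i j 1) := by
    intro X
    have h1 : κ' (X : Mat3) = κ X := LinearMap.congr_fun hκ X
    rw [← h1]
    conv_lhs => rw [Matrix.matrix_eq_sum_single (X : Mat3)]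
    simp only [map_sum]
    refine Finset.sum_congr rfl fun i _ => Finset.sum_congr rfl fun j _ => ?_
    rw [← map_smul, Matrix.smul_single, smul_eq_mul, mul_one]
  simp only [e]
  exact ContDiffOn.sum fun i _ => ContDiffOn.sum fun j _ => (h i j).smul contDiffOn_const

namespace CartanConnection

variable {Q : PrincipalBundle.{u}} (η : CartanConnection Q)
  {F : Type*} [NormedAddCommGroup F] [NormedSpace ℝ F]

/-- The pull-back of the connection form by a map from a normed space. -/
noncomputable def pull (s : F → Q.Total) (z : F) : F →ₗ[ℝ] sl3 where
  toFun v := η.form (s z) (mfderiv 𝓘(ℝ, F) Q.I s z v)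
  map_add' v w := by
    have := map_add (mfderiv 𝓘(ℝ, F) Q.I s z) v w
    exact (congrArg _ this).trans (map_add _ _ _)
  map_smul' c v := by
    have := map_smul (mfderiv 𝓘(ℝ, F) Q.I s z) c v
    exact (congrArg _ this).trans (map_smul _ _ _)

theorem pull_congr {s s' : F → Q.Total} {z : F} (h : s =ᶠ[nhds z] s') :
    η.pull s z = η.pull s' z := by
  ext1 v
  change η.form (s z) (mfderiv 𝓘(ℝ, F) Q.I s z v) = η.form (s' z) (mfderiv 𝓘(ℝ, F) Q.I s' z v)
  rw [Filter.EventuallyEq.mfderiv_eq h]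
  exact η.form_congr h.eq_of_nhds _

theorem contDiffOn_pull {U : Set F} (hU : IsOpen U) {s : F → Q.Total}
    (hs : ContMDiffOn 𝓘(ℝ, F) Q.I ∞ s U) {V : F → F} (hV : ContDiffOn ℝ ∞ V U) (i j : Fin 3) :
    ContDiffOn ℝ ∞ (fun z => (η.pull s z (V z) : Mat3) i j) U := by
  have h1 := hs.contMDiffOn_tangentMapWithin (m := ∞) (by simp) hU.uniqueMDiffOn
  have h2 := (contMDiffOn_vectorSpace_iff_contDiffOn
    (V := (V : ∀ z : F, TangentSpace 𝓘(ℝ, F) z)) (s := U) (n := ∞)).2 hV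
  have h3 := (η.smooth i j).comp_contMDiffOn (h1.comp h2 fun z hz => hz)
  refine h3.contDiffOn.congr fun z hz => ?_
  change (η.form (s z) (mfderiv 𝓘(ℝ, F) Q.I s z (V z)) : Mat3) i j =
    (η.form (s z) (mfderivWithin 𝓘(ℝ, F) Q.I s U z (V z)) : Mat3) i j
  rw [mfderivWithin_of_isOpen hU hz]

/-- A matrix entry of the pull-back, as a continuous linear form. -/
noncomputable def pullEntry [FiniteDimensional ℝ F] (s : F → Q.Total) (i j : Fin 3) (z : F) :
    F →L[ℝ] ℝ :=
  LinearMap.toContinuousLinearMap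
    { toFun := fun v => (η.pull s z v : Mat3) i j
      map_add' := fun v w => by simp
      map_smul' := fun c v => by simp }

theorem pullEntry_apply [FiniteDimensional ℝ F] (s : F → Q.Total) (i j : Fin 3) (z v : F) :
    η.pullEntry s i j z v = (η.pull s z v : Mat3) i j := rfl

theorem contDiffOn_pullEntry [FiniteDimensional ℝ F] {U : Set F} (hU : IsOpen U)
    {s : F → Q.Total} (hs : ContMDiffOn 𝓘(ℝ, F) Q.I ∞ s U) (i j : Fin 3) :
    ContDiffOn ℝ ∞ (η.pullEntry s i j) U :=
  contDiffOn_clm_apply.2 fun _ => η.contDiffOn_pull hU hs contDiffOn_const i j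

/-! ### The connection form and the fields X* in a chart -/

theorem form_eq_pull_chart {p₀ p : Q.Total} (hp : p ∈ (extChartAt Q.I p₀).source)
    (w : TangentSpace Q.I p) :
    η.form p w = η.pull (extChartAt Q.I p₀).symm (extChartAt Q.I p₀ p)
      (mfderiv Q.I 𝓘(ℝ, Q.Model) (extChartAt Q.I p₀) p w) := by
  have hp' : p ∈ (chartAt Q.Model p₀).source := by rwa [extChartAt_source] at hp
  have h1 := mfderiv_comp_apply p (g := (extChartAt Q.I p₀).symm) (I'' := Q.I)
    (((contMDiffOn_extChartAt_symm (n := ∞) p₀).contMDiffAt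
      ((isOpen_extChartAt_target p₀).mem_nhds ((extChartAt Q.I p₀).map_source hp))).mdifferentiableAt
      (by simp)) (mdifferentiableAt_extChartAt hp') w
  have h2 : (extChartAt Q.I p₀).symm ∘ (extChartAt Q.I p₀) =ᶠ[nhds p] id := by
    filter_upwards [(isOpen_extChartAt_source p₀).mem_nhds hp] with q hq
    exact (extChartAt Q.I p₀).left_inv hq
  rw [Filter.EventuallyEq.mfderiv_eq h2, mfderiv_id] at h1
  change _ = η.form _ (mfderiv 𝓘(ℝ, Q.Model) Q.I (extChartAt Q.I p₀).symm _ _)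
  refine (η.form_congr ((extChartAt Q.I p₀).left_inv hp).symm w).trans ?_
  exact congrArg (η.form _) h1

theorem pull_eq_pull_chart {p₀ : Q.Total} {s : F → Q.Total} {z : F}
    (hs : MDifferentiableAt 𝓘(ℝ, F) Q.I s z) (hz : s z ∈ (extChartAt Q.I p₀).source) (v : F) :
    η.pull s z v = η.pull (extChartAt Q.I p₀).symm (extChartAt Q.I p₀ (s z))
      (fderiv ℝ (extChartAt Q.I p₀ ∘ s) z v) := by
  have h := η.form_eq_pull_chart hz (mfderiv 𝓘(ℝ, F) Q.I s z v)
  have hz' : s z ∈ (chartAt Q.Model p₀).source := by rwa [extChartAt_source] at hz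
  have h1 := mfderiv_comp_apply z (mdifferentiableAt_extChartAt hz' (I := Q.I)) hs v
  rw [mfderiv_eq_fderiv] at h1
  exact h.trans (congrArg _ h1.symm)

theorem isInvertible_mfderiv_chart_symm (p₀ : Q.Total) {y : Q.Model}
    (hy : y ∈ (extChartAt Q.I p₀).target) :
    (mfderiv 𝓘(ℝ, Q.Model) Q.I (extChartAt Q.I p₀).symm y).IsInvertible := by
  have := isInvertible_mfderivWithin_extChartAt_symm hy
  rwa [ModelWithCorners.range_eq_univ, mfderivWithin_univ] at this

theorem pull_chart_bijective (p₀ : Q.Total) {y : Q.Model} (hy : y ∈ (extChartAt Q.I p₀).target) :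
    Function.Bijective (η.pull (extChartAt Q.I p₀).symm y) :=
  (η.bijective _).comp (isInvertible_mfderiv_chart_symm p₀ hy).bijective

theorem form_star (X : sl3) (p : Q.Total) : η.form p (η.star X p) = X :=
  (LinearEquiv.ofBijective (η.form p) (η.bijective p)).apply_symm_apply X

/-- The representative in a chart of the field `X*`. -/
noncomputable def chartStar (p₀ : Q.Total) (X : sl3) (y : Q.Model) : Q.Model :=
  (mfderiv 𝓘(ℝ, Q.Model) Q.I (extChartAt Q.I p₀).symm y).inverse
    (η.star X ((extChartAt Q.I p₀).symm y))

theorem mfderiv_chartStar (p₀ : Q.Total) (X : sl3) {y : Q.Model}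
    (hy : y ∈ (extChartAt Q.I p₀).target) :
    mfderiv 𝓘(ℝ, Q.Model) Q.I (extChartAt Q.I p₀).symm y (η.chartStar p₀ X y) =
      η.star X ((extChartAt Q.I p₀).symm y) := by
  obtain ⟨e, he⟩ := isInvertible_mfderiv_chart_symm p₀ hy
  unfold chartStar
  rw [← he, ContinuousLinearMap.inverse_equiv]
  exact e.apply_symm_apply _

theorem pull_chartStar (p₀ : Q.Total) (X : sl3) {y : Q.Model}
    (hy : y ∈ (extChartAt Q.I p₀).target) :
    η.pull (extChartAt Q.I p₀).symm y (η.chartStar p₀ X y) = X :=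
  (congrArg _ (η.mfderiv_chartStar p₀ X hy)).trans (η.form_star X _)

/-- The field is obtained by inverting the pulled-back form. Composition with the inverse of its
value at y₀ turns the form into a smooth family of endomorphisms of the model space, where inversion
of operators is smooth. -/
theorem contDiffOn_chartStar (p₀ : Q.Total) (X : sl3) :
    ContDiffOn ℝ ∞ (η.chartStar p₀ X) (extChartAt Q.I p₀).target := by
  set T := (extChartAt Q.I p₀).target
  have hT : IsOpen T := isOpen_extChartAt_target p₀
  have hs : ContMDiffOn 𝓘(ℝ, Q.Model) Q.I ∞ (extChartAt Q.I p₀).symm T :=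
    contMDiffOn_extChartAt_symm p₀
  intro y₀ hy₀
  set e := LinearEquiv.ofBijective _ (η.pull_chart_bijective p₀ hy₀) with he
  set B : Q.Model → Q.Model →L[ℝ] Q.Model := fun y =>
    LinearMap.toContinuousLinearMap (e.symm.toLinearMap ∘ₗ η.pull (extChartAt Q.I p₀).symm y)
    with hBdef
  have hB : ContDiffOn ℝ ∞ B T := contDiffOn_clm_apply.2 fun v =>
    contDiffOn_linear_comp_of_entries
      (fun i j => η.contDiffOn_pull hT hs contDiffOn_const i j) e.symm.toLinearMap
  have hbij : ∀ y ∈ T, ∃ b : Q.Model ≃L[ℝ] Q.Model, (b : Q.Model →L[ℝ] Q.Model) = B y :=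
    fun y hy => ⟨((LinearEquiv.ofBijective _ (η.pull_chart_bijective p₀ hy)).trans
      e.symm).toContinuousLinearEquiv, by ext v; rfl⟩
  have heq : ∀ y ∈ T, η.chartStar p₀ X y = (B y).inverse (e.symm X) := by
    intro y hy
    obtain ⟨b, hb⟩ := hbij y hy
    rw [← hb, ContinuousLinearMap.inverse_equiv]
    change _ = b.symm _
    rw [ContinuousLinearEquiv.eq_symm_apply]
    change (b : Q.Model →L[ℝ] Q.Model) _ = _
    rw [hb]
    exact congrArg e.symm (η.pull_chartStar p₀ X hy)
  have hinv : ContDiffWithinAt ℝ ∞ (fun y => (B y).inverse) T y₀ := by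
    obtain ⟨b, hb⟩ := hbij y₀ hy₀
    have h1 : ContDiffAt ℝ ∞ ContinuousLinearMap.inverse (B y₀) := by
      rw [← hb]; exact contDiffAt_map_inverse b
    exact h1.comp_contDiffWithinAt y₀ (hB y₀ hy₀)
  exact (hinv.clm_apply contDiffWithinAt_const).congr heq (heq y₀ hy₀)

/-- In the chart, differentiating the constant ω(X*) = X moves a derivative of the field onto the
form with a minus sign. Applied to both terms of the bracket, this yields -dω(X*, Y*), with no
derivatives of the fields left. -/
theorem form_mlieBracket_star (X Y : sl3) (p₀ : Q.Total) (i j : Fin 3) :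
    (η.form p₀ (VectorField.mlieBracket Q.I (η.star X) (η.star Y) p₀) : Mat3) i j =
      fderiv ℝ (η.pullEntry (extChartAt Q.I p₀).symm i j) (extChartAt Q.I p₀ p₀)
          (η.chartStar p₀ Y (extChartAt Q.I p₀ p₀)) (η.chartStar p₀ X (extChartAt Q.I p₀ p₀))
        - fderiv ℝ (η.pullEntry (extChartAt Q.I p₀).symm i j) (extChartAt Q.I p₀ p₀)
          (η.chartStar p₀ X (extChartAt Q.I p₀ p₀)) (η.chartStar p₀ Y (extChartAt Q.I p₀ p₀)) := by
  set T := (extChartAt Q.I p₀).target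
  set y₀ := extChartAt Q.I p₀ p₀
  have hy₀ : y₀ ∈ T := mem_extChartAt_target p₀
  have hT : T ∈ nhds y₀ := (isOpen_extChartAt_target p₀).mem_nhds hy₀
  have hs : ContMDiffOn 𝓘(ℝ, Q.Model) Q.I ∞ (extChartAt Q.I p₀).symm T :=
    contMDiffOn_extChartAt_symm p₀
  have hbr : VectorField.mlieBracket Q.I (η.star X) (η.star Y) p₀ =
      (mfderiv Q.I 𝓘(ℝ, Q.Model) (extChartAt Q.I p₀) p₀).inverse
        (VectorField.lieBracket ℝ (E := Q.Model) (η.chartStar p₀ X) (η.chartStar p₀ Y) y₀) := by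
    rw [← VectorField.mlieBracketWithin_univ, VectorField.mlieBracketWithin_apply]
    simp only [ModelWithCorners.range_eq_univ, Set.preimage_univ, Set.inter_univ]
    have hZ : ∀ Z, VectorField.mpullbackWithin 𝓘(ℝ, Q.Model) Q.I (extChartAt Q.I p₀).symm
        (η.star Z) Set.univ = η.chartStar p₀ Z := fun Z => by
      rw [VectorField.mpullbackWithin_univ]; rfl
    rw [hZ, hZ]
    exact congrArg _ (congrFun (VectorField.lieBracketWithin_univ (𝕜 := ℝ) (E := Q.Model)) _)
  have hform : η.form p₀ (VectorField.mlieBracket Q.I (η.star X) (η.star Y) p₀) =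
      η.pull (extChartAt Q.I p₀).symm y₀
        (VectorField.lieBracket ℝ (E := Q.Model) (η.chartStar p₀ X) (η.chartStar p₀ Y) y₀) := by
    rw [η.form_eq_pull_chart (mem_extChartAt_source p₀)]
    obtain ⟨e, he⟩ := isInvertible_mfderiv_extChartAt (mem_extChartAt_source (I := Q.I) p₀)
    rw [hbr, ← he, ContinuousLinearMap.inverse_equiv]
    exact congrArg _ (e.apply_symm_apply _)
  have hd : DifferentiableAt ℝ (η.pullEntry (extChartAt Q.I p₀).symm i j) y₀ :=
    ((η.contDiffOn_pullEntry (isOpen_extChartAt_target p₀) hs i j).contDiffAt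
      hT).differentiableAt (by simp)
  have key : ∀ (Z : sl3) (u : Q.Model), η.pullEntry (extChartAt Q.I p₀).symm i j y₀
      (fderiv ℝ (η.chartStar p₀ Z) y₀ u) =
      - fderiv ℝ (η.pullEntry (extChartAt Q.I p₀).symm i j) y₀ u (η.chartStar p₀ Z y₀) := by
    intro Z u
    have hZ : DifferentiableAt ℝ (η.chartStar p₀ Z) y₀ :=
      ((η.contDiffOn_chartStar p₀ Z).contDiffAt hT).differentiableAt (by simp)
    have h1 := hd.hasFDerivAt.clm_apply hZ.hasFDerivAt
    have h2 : (fun y => η.pullEntry (extChartAt Q.I p₀).symm i j y (η.chartStar p₀ Z y))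
        =ᶠ[nhds y₀] fun _ => (Z : Mat3) i j := by
      filter_upwards [hT] with y hy
      rw [pullEntry_apply, η.pull_chartStar p₀ Z hy]
    have h3 := DFunLike.congr_fun (h1.fderiv.symm.trans h2.fderiv_eq) u
    simp only [add_apply, ContinuousLinearMap.comp_apply,
      ContinuousLinearMap.flip_apply, fderiv_fun_const, Pi.zero_apply,
      zero_apply] at h3
    linarith
  rw [hform, ← pullEntry_apply]
  change η.pullEntry _ i j y₀ (fderiv ℝ (η.chartStar p₀ Y) y₀ (η.chartStar p₀ X y₀) -
    fderiv ℝ (η.chartStar p₀ X) y₀ (η.chartStar p₀ Y y₀)) = _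
  rw [map_sub, key, key]
  ring

/-- The curvature is defined through vector fields on P; this computes it as dθ + [θ, θ]/2 for the
pull-back θ of ω by any smooth map s. The functions ω(X*) are constant, so only the bracket
contributes to dω, and d commutes with pull-back. -/
theorem curvature_star [FiniteDimensional ℝ F] {U : Set F} (hU : IsOpen U) {s : F → Q.Total}
    (hs : ContMDiffOn 𝓘(ℝ, F) Q.I ∞ s U) {x : F} (hx : x ∈ U) (u v : F) (i j : Fin 3) :
    η.curvature (η.star (η.pull s x u)) (η.star (η.pull s x v)) (s x) i j =
      fderiv ℝ (η.pullEntry s i j) x u v - fderiv ℝ (η.pullEntry s i j) x v u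
        + ((η.pull s x u : Mat3) * (η.pull s x v : Mat3)
          - (η.pull s x v : Mat3) * (η.pull s x u : Mat3)) i j := by
  set p₀ := s x
  set T := (extChartAt Q.I p₀).target
  set c := extChartAt Q.I p₀ ∘ s with hc
  have hT : IsOpen T := isOpen_extChartAt_target p₀
  have hy₀ : c x ∈ T := mem_extChartAt_target p₀
  have hsx : ContMDiffAt 𝓘(ℝ, F) Q.I ∞ s x := hs.contMDiffAt (hU.mem_nhds hx)
  have hcd : ContDiffAt ℝ ∞ c x :=
    (ContMDiffAt.comp x (contMDiffAt_extChartAt (n := ∞) (I := Q.I)) hsx).contDiffAt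
  have hnear : ∀ᶠ z in nhds x, ∀ w, η.pull s z w =
      η.pull (extChartAt Q.I p₀).symm (c z) (fderiv ℝ c z w) := by
    filter_upwards [hU.mem_nhds hx, hsx.continuousAt.preimage_mem_nhds
      ((isOpen_extChartAt_source (I := Q.I) p₀).mem_nhds (mem_extChartAt_source p₀))] with z hz hz' w
    exact η.pull_eq_pull_chart ((hs.contMDiffAt (hU.mem_nhds hz)).mdifferentiableAt (by simp))
      hz' w
  have hd : DifferentiableAt ℝ (η.pullEntry (extChartAt Q.I p₀).symm i j) (c x) :=
    ((η.contDiffOn_pullEntry hT (contMDiffOn_extChartAt_symm p₀) i j).contDiffAt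
      (hT.mem_nhds hy₀)).differentiableAt (by simp)
  have hc1 : DifferentiableAt ℝ c x := hcd.differentiableAt (by simp)
  have hc2 : DifferentiableAt ℝ (fderiv ℝ c) x :=
    (hcd.fderiv_right (m := 1) (by norm_cast)).differentiableAt (by simp)
  have hps : DifferentiableAt ℝ (η.pullEntry s i j) x :=
    ((η.contDiffOn_pullEntry hU hs i j).contDiffAt (hU.mem_nhds hx)).differentiableAt (by simp)
  have key : ∀ a b : F, fderiv ℝ (η.pullEntry s i j) x a b =
      fderiv ℝ (η.pullEntry (extChartAt Q.I p₀).symm i j) (c x) (fderiv ℝ c x a)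
        (fderiv ℝ c x b) + η.pullEntry (extChartAt Q.I p₀).symm i j (c x)
          (fderiv ℝ (fderiv ℝ c) x a b) := by
    intro a b
    have h1 : (fun z => η.pullEntry s i j z b) =ᶠ[nhds x] fun z =>
        (η.pullEntry (extChartAt Q.I p₀).symm i j ∘ c) z (fderiv ℝ c z b) := by
      filter_upwards [hnear] with z hz
      rw [pullEntry_apply, hz]; rfl
    have h2 := (hd.hasFDerivAt.comp x hc1.hasFDerivAt).clm_apply
      (hc2.hasFDerivAt.clm_apply (hasFDerivAt_const b x))
    have h3 := (hps.hasFDerivAt.clm_apply (hasFDerivAt_const b x)).fderiv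
    rw [h1.fderiv_eq, h2.fderiv] at h3
    have h4 := DFunLike.congr_fun h3 a
    simp only [add_apply, ContinuousLinearMap.comp_apply,
      ContinuousLinearMap.flip_apply, zero_apply, map_zero, zero_add,
      Function.comp_apply] at h4
    linarith
  -- The second derivatives of s in the chart are the only obstruction to pulling back d; they
  -- cancel by symmetry.
  have hsymm : fderiv ℝ (fderiv ℝ c) x u v = fderiv ℝ (fderiv ℝ c) x v u :=
    (hcd.isSymmSndFDerivAt (by
      rw [minSmoothness_of_isRCLikeNormedField]; exact WithTop.coe_le_coe.2 le_top)) u v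
  have hstar : ∀ a : F, η.chartStar p₀ (η.pull s x a) (c x) = fderiv ℝ c x a := by
    intro a
    refine (η.pull_chart_bijective p₀ hy₀).1 ?_
    rw [η.pull_chartStar p₀ _ hy₀, hnear.self_of_nhds]
  have hentry : ∀ (X : sl3) (w : TangentSpace Q.I p₀), η.entryDeriv (η.star X) i j p₀ w = 0 := by
    intro X w
    have : (fun q => (η.form q (η.star X q) : Mat3) i j) = fun _ => (X : Mat3) i j := by
      funext q; rw [η.form_star]
    unfold entryDeriv
    rw [this, mfderiv_const]
    rfl
  unfold curvature
  rw [Matrix.of_apply, hentry, hentry, η.form_mlieBracket_star, η.form_star, η.form_star]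
  have e : extChartAt Q.I p₀ p₀ = c x := rfl
  rw [e, hstar, hstar, key u v, key v u, hsymm]
  ring

end CartanConnection

/-! ### Matrix-valued curves -/

/-- The matrix-valued curve `M` has the derivative `M'` at `t`, entry by entry. -/
def HasMatDerivAt (M : ℝ → Mat3) (M' : Mat3) (t : ℝ) : Prop :=
  ∀ i j, HasDerivAt (fun s => M s i j) (M' i j) t

theorem HasMatDerivAt.mul {M N : ℝ → Mat3} {M' N' : Mat3} {t : ℝ} (hM : HasMatDerivAt M M' t)
    (hN : HasMatDerivAt N N' t) :
    HasMatDerivAt (fun s => M s * N s) (M' * N t + M t * N') t := by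
  intro i j
  have h := ((((hM i 0).mul (hN 0 j)).add ((hM i 1).mul (hN 1 j))).add ((hM i 2).mul (hN 2 j)))
  refine (h.congr_of_eventuallyEq (Filter.Eventually.of_forall fun s => ?_)).congr_deriv ?_
  · simp [Matrix.mul_apply, Fin.sum_univ_three]
  · simp only [Matrix.add_apply, Matrix.mul_apply, Fin.sum_univ_three]
    ring

theorem HasMatDerivAt.unique {M : ℝ → Mat3} {M' N' : Mat3} {t : ℝ} (h : HasMatDerivAt M M' t)
    (h' : HasMatDerivAt M N' t) : M' = N' := by
  ext i j; exact (h i j).unique (h' i j)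

theorem hasMatDerivAt_const (N : Mat3) (t : ℝ) : HasMatDerivAt (fun _ => N) 0 t :=
  fun _ _ => hasDerivAt_const _ _

theorem HasMatDerivAt.congr_of_eventuallyEq {M N : ℝ → Mat3} {M' : Mat3} {t : ℝ}
    (h : HasMatDerivAt M M' t) (hN : N =ᶠ[nhds t] M) : HasMatDerivAt N M' t := fun i j =>
  (h i j).congr_of_eventuallyEq (hN.mono fun _ hs => congrFun (congrFun hs i) j)

theorem SL3.mul_inv_coe (g : SL3) : (g : Mat3) * ((g⁻¹ : SL3) : Mat3) = 1 := by
  rw [← Matrix.SpecialLinearGroup.coe_mul, mul_inv_cancel, Matrix.SpecialLinearGroup.coe_one]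

theorem SL3.inv_mul_coe (g : SL3) : ((g⁻¹ : SL3) : Mat3) * (g : Mat3) = 1 := by
  rw [← Matrix.SpecialLinearGroup.coe_mul, inv_mul_cancel, Matrix.SpecialLinearGroup.coe_one]

theorem SL3.inv_entry_contDiffOn {J : Set ℝ} {g : ℝ → SL3}
    (hg : ∀ i j, ContDiffOn ℝ ∞ (fun t => (g t : Mat3) i j) J) (i j : Fin 3) :
    ContDiffOn ℝ ∞ (fun t => (((g t)⁻¹ : SL3) : Mat3) i j) J := by
  simp only [Matrix.SpecialLinearGroup.coe_inv, Matrix.adjugate_fin_three]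
  fin_cases i <;> fin_cases j <;> simp <;>
    first
    | exact ((hg _ _).mul (hg _ _)).sub ((hg _ _).mul (hg _ _))
    | exact (((hg _ _).mul (hg _ _)).neg).add ((hg _ _).mul (hg _ _))

theorem SL3.inv_entry_differentiableAt {t : ℝ} {g : ℝ → SL3} {g' : Mat3}
    (hg : HasMatDerivAt (fun t => (g t : Mat3)) g' t) (i j : Fin 3) :
    DifferentiableAt ℝ (fun t => (((g t)⁻¹ : SL3) : Mat3) i j) t := by
  have hd : ∀ i j, DifferentiableAt ℝ (fun t => (g t : Mat3) i j) t := fun i j =>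
    (hg i j).differentiableAt
  simp only [Matrix.SpecialLinearGroup.coe_inv, Matrix.adjugate_fin_three]
  fin_cases i <;> fin_cases j <;> simp <;>
    first
    | exact ((hd _ _).mul (hd _ _)).sub ((hd _ _).mul (hd _ _))
    | exact (((hd _ _).mul (hd _ _)).neg).add ((hd _ _).mul (hd _ _))

/-- Differentiability of the inverse comes from the adjugate; the formula then follows by
differentiating g g⁻¹ = 1. -/
theorem HasMatDerivAt.inv {g : ℝ → SL3} {g' : Mat3} {t : ℝ}
    (hg : HasMatDerivAt (fun t => (g t : Mat3)) g' t) :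
    HasMatDerivAt (fun t => (((g t)⁻¹ : SL3) : Mat3))
      (-(((g t)⁻¹ : SL3) * g' * ((g t)⁻¹ : SL3))) t := by
  set N : Mat3 := Matrix.of fun i j => deriv (fun t => (((g t)⁻¹ : SL3) : Mat3) i j) t
  have hN : HasMatDerivAt (fun t => (((g t)⁻¹ : SL3) : Mat3)) N t := fun i j =>
    (SL3.inv_entry_differentiableAt hg i j).hasDerivAt
  have h1 := hg.mul hN
  simp only [SL3.mul_inv_coe] at h1
  have h2 := h1.unique (hasMatDerivAt_const 1 t)
  have h3 : N = -(((g t)⁻¹ : SL3) * g' * ((g t)⁻¹ : SL3)) := by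
    have h4 := congrArg (fun M => (((g t)⁻¹ : SL3) : Mat3) * M) h2
    simp only [mul_add, mul_zero, ← mul_assoc, SL3.inv_mul_coe, one_mul] at h4
    exact eq_neg_of_add_eq_zero_right h4
  rwa [h3] at hN

/-- Bootstrap: if h is of class Cⁿ, so is h' = hΘ. -/
theorem contDiffOn_of_hasMatDerivAt {J : Set ℝ} (hJ : IsOpen J) {h Θ : ℝ → Mat3}
    (hΘ : ∀ i j, ContDiffOn ℝ ∞ (fun t => Θ t i j) J)
    (hh : ∀ t ∈ J, HasMatDerivAt h (h t * Θ t) t) (i j : Fin 3) :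
    ContDiffOn ℝ ∞ (fun t => h t i j) J := by
  have key : ∀ n : ℕ, ∀ i j, ContDiffOn ℝ n (fun t => h t i j) J := by
    intro n
    induction n with
    | zero =>
      intro i j
      rw [Nat.cast_zero, contDiffOn_zero]
      exact fun t ht => (hh t ht i j).continuousAt.continuousWithinAt
    | succ n ih =>
      intro i j
      rw [Nat.cast_succ, contDiffOn_succ_iff_deriv_of_isOpen hJ]
      refine ⟨fun t ht => (hh t ht i j).differentiableAt.differentiableWithinAt, by simp, ?_⟩
      have hp : ContDiffOn ℝ n (fun t => ∑ k, h t i k * Θ t k j) J :=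
        ContDiffOn.sum fun k _ => (ih i k).mul ((hΘ k j).of_le (by exact_mod_cast le_top))
      refine hp.congr fun t ht => ?_
      rw [(hh t ht i j).deriv, Matrix.mul_apply]
  exact contDiffOn_infty.2 fun n => key n i j

theorem hasDerivAt_det {h : ℝ → Mat3} {Θ : Mat3} {t : ℝ} (hh : HasMatDerivAt h (h t * Θ) t) :
    HasDerivAt (fun s => (h s).det) ((h t).det * Θ.trace) t := by
  have e : (fun s => (h s).det) = fun s => h s 0 0 * h s 1 1 * h s 2 2
      - h s 0 0 * h s 1 2 * h s 2 1 - h s 0 1 * h s 1 0 * h s 2 2 + h s 0 1 * h s 1 2 * h s 2 0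
      + h s 0 2 * h s 1 0 * h s 2 1 - h s 0 2 * h s 1 1 * h s 2 0 := by
    funext s; exact Matrix.det_fin_three _
  rw [e]
  have m : ∀ a b c d p q : Fin 3, HasDerivAt (fun s => h s a b * h s c d * h s p q)
      (((h t * Θ) a b * h t c d + h t a b * (h t * Θ) c d) * h t p q
        + h t a b * h t c d * (h t * Θ) p q) t :=
    fun a b c d p q => ((hh a b).mul (hh c d)).mul (hh p q)
  refine ((((((m 0 0 1 1 2 2).sub (m 0 0 1 2 2 1)).sub (m 0 1 1 0 2 2)).add
    (m 0 1 1 2 2 0)).add (m 0 2 1 0 2 1)).sub (m 0 2 1 1 2 0)).congr_deriv ?_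
  rw [Matrix.det_fin_three, Matrix.trace_fin_three]
  simp only [Matrix.mul_apply, Fin.sum_univ_three]
  ring

/-- The rows of h solve one and the same linear equation y' = yΘ. By Liouville's formula the
determinant is constant when Θ is trace-free, so the solution starting at 1 stays in SL(3, ℝ). -/
theorem exists_SL3_ode {J : Set ℝ} (hJ : IsOpen J) (hJc : J.OrdConnected) {Θ : ℝ → Mat3}
    (hΘ : ∀ i j, ContinuousOn (fun t => Θ t i j) J) (htr : ∀ t ∈ J, (Θ t).trace = 0) :
    ∃ h : ℝ → SL3, ∀ t ∈ J, HasMatDerivAt (fun t => (h t : Mat3)) ((h t : Mat3) * Θ t) t := by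
  rcases J.eq_empty_or_nonempty with rfl | ⟨t₀, h₀⟩
  · exact ⟨fun _ => 1, fun t ht => ht.elim⟩
  set A : ℝ → (Fin 3 → ℝ) →L[ℝ] (Fin 3 → ℝ) := fun t =>
    LinearMap.toContinuousLinearMap (Matrix.vecMulLinear (Θ t))
  have hA : ContinuousOn A J := by
    refine continuousOn_clm_apply.2 fun y => continuousOn_pi.2 fun j => ?_
    have : (fun t => A t y j) = fun t => ∑ k, y k * Θ t k j := by
      funext t; rfl
    rw [this]
    exact continuousOn_finsetSum _ fun k _ => continuousOn_const.mul (hΘ k j)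
  choose y hy0 hy using fun i : Fin 3 => exists_linear_ode hJ hJc h₀ hA (Pi.single i 1)
  set M : ℝ → Mat3 := fun t => Matrix.of fun i j => y i t j
  have hM : ∀ t ∈ J, HasMatDerivAt M (M t * Θ t) t := by
    intro t ht i j
    exact (hasDerivAt_pi.1 (hy i t ht) j)
  have hdet : ∀ t ∈ J, (M t).det = 1 := by
    intro t ht
    have hd : ∀ t ∈ J, HasDerivAt (fun s => (M s).det) 0 t := fun t ht => by
      have := hasDerivAt_det (hM t ht)
      rwa [htr t ht, mul_zero] at this
    have := hJ.is_const_of_deriv_eq_zero hJc.isPreconnected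
      (fun t ht => (hd t ht).differentiableAt.differentiableWithinAt)
      (fun t ht => (hd t ht).deriv) ht h₀
    rw [this]
    have : M t₀ = 1 := by
      ext i j
      change y i t₀ j = _
      rw [hy0, Matrix.one_apply, Pi.single_apply]
      simp only [eq_comm]
    rw [this, Matrix.det_one]
  have hex : ∀ t, ∃ g : SL3, t ∈ J → (g : Mat3) = M t := fun t => by
    by_cases ht : t ∈ J
    · exact ⟨⟨M t, hdet t ht⟩, fun _ => rfl⟩
    · exact ⟨1, fun h => absurd h ht⟩
  choose h hM' using hex
  refine ⟨h, fun t ht => ?_⟩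
  rw [hM' t ht]
  exact (hM t ht).congr_of_eventuallyEq
    (Filter.eventuallyEq_of_mem (hJ.mem_nhds ht) hM')

theorem exists_antideriv {J : Set ℝ} (hJ : IsOpen J) (hJc : J.OrdConnected) {f : ℝ → ℝ}
    (hf : ContinuousOn f J) : ∃ F : ℝ → ℝ, ∀ t ∈ J, HasDerivAt F (f t) t := by
  rcases J.eq_empty_or_nonempty with rfl | ⟨t₀, h₀⟩
  · exact ⟨fun _ => 1, fun t ht => ht.elim⟩
  refine ⟨fun t => ∫ s in t₀..t, f s, fun t ht => ?_⟩
  exact intervalIntegral.integral_hasDerivAt_right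
    (hf.mono (hJc.uIcc_subset h₀ ht)).intervalIntegrable
    (hf.stronglyMeasurableAtFilter hJ t ht) (hf.continuousAt (hJ.mem_nhds ht))

/-! ### Geodesics in a section of the bundle -/

namespace CartanConnection

variable {Q : PrincipalBundle.{u}} (η : CartanConnection Q)

/-- A section over `U` in which the first column of the connection form is `(0, dx, dy)`. -/
structure IsNormalSection (U : Set Plane) (s : Plane → Q.Total) : Prop where
  contMDiffOn : ContMDiffOn 𝓘(ℝ, Plane) Q.I ∞ s U
  proj_eq : ∀ x ∈ U, Q.proj (s x) = x
  zero_zero : ∀ x ∈ U, ∀ v : Plane, (η.pull s x v : Mat3) 0 0 = 0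
  one_zero : ∀ x ∈ U, ∀ v : Plane, (η.pull s x v : Mat3) 1 0 = v 0
  two_zero : ∀ x ∈ U, ∀ v : Plane, (η.pull s x v : Mat3) 2 0 = v 1

theorem pull_comp_curve {s : Plane → Q.Total} (hs : ContMDiff 𝓘(ℝ, Plane) Q.I ∞ s)
    {x : ℝ → Plane} {t : ℝ} (hx : DifferentiableAt ℝ x t) :
    η.pull (s ∘ x) t 1 = η.pull s (x t) (deriv x t) := by
  have h := mfderiv_comp_apply t ((hs.mdifferentiable (by simp)) (x t))
    hx.mdifferentiableAt (1 : ℝ)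
  rw [mfderiv_eq_fderiv] at h
  exact congrArg (η.form _) h

theorem trace_sl3 (X : sl3) : (X : Mat3).trace = 0 := X.2

theorem sl3_trace_eq (X : sl3) : (X : Mat3) 0 0 + (X : Mat3) 1 1 + (X : Mat3) 2 2 = 0 := by
  have := trace_sl3 X
  rwa [Matrix.trace_fin_three] at this

/-- The development of a curve, with respect to a global section, lies on a line. -/
def DevelopsOnLine (J : Set ℝ) (x : ℝ → Plane) (s : Plane → Q.Total) : Prop :=
  ∃ h : ℝ → SL3,
    (∀ t ∈ J, HasMatDerivAt (fun t => (h t : Mat3))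
      ((h t : Mat3) * (η.pull s (x t) (deriv x t) : Mat3)) t) ∧
    ∃ f : Module.Dual ℝ (Fin 3 → ℝ), f ≠ 0 ∧ ∀ t ∈ J, f (fun i => (h t : Mat3) i 0) = 0

theorem devPoint_submodule (g : SL3) :
    (devPoint g).submodule = ℝ ∙ (fun i => ((g⁻¹ : SL3) : Mat3) i 0) := by
  have h : devPoint g = Projectivization.mk ℝ (g⁻¹ • (![1, 0, 0] : Fin 3 → ℝ))
    (by
      rw [Ne, smul_eq_zero_iff_eq]
      exact fun h => one_ne_zero (congrFun h 0)) := rfl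
  rw [h, Projectivization.submodule_mk]
  have e : g⁻¹ • (![1, 0, 0] : Fin 3 → ℝ) = fun i => ((g⁻¹ : SL3) : Mat3) i 0 := by
    funext i
    change (((g⁻¹ : SL3) : Mat3).mulVec ![1, 0, 0]) i = _
    rw [Matrix.mulVec_eq_sum, Fin.sum_univ_three]
    simp
  rw [e]

/-- A horizontal lift (q, g) may be moved along the fibres of P: if q = s(x)γ, then (s(x), γg)
represents the same curve. Since γ fixes o, the developed point is unchanged, and only the equation
for the inverse of γg in the section s remains. -/
theorem isGeodesic_iff_developsOnLine {J : Set ℝ} (hJ : IsOpen J) {x : ℝ → Plane}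
    (hx : ContDiffOn ℝ ∞ x J) {s : Plane → Q.Total} (hs : ContMDiff 𝓘(ℝ, Plane) Q.I ∞ s)
    (hsec : ∀ x, Q.proj (s x) = x) :
    η.IsGeodesic J x ↔ η.DevelopsOnLine J x s := by
  constructor
  · rintro ⟨q, g, hl, L, hL, hdev⟩
    obtain ⟨τ, hτ, hact⟩ := Q.exists_trivialization isOpen_univ hs.contMDiffOn
      (fun x _ => hsec x)
    set γ : ℝ → stabGroup := fun t => τ (q t) with hγdef
    have hγ : ContMDiffOn 𝓘(ℝ, ℝ) 𝓘(ℝ, GModel) ∞ γ J :=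
      (hτ.comp hl.contMDiffOn (fun t _ => Set.mem_preimage.2 (Set.mem_univ _)))
    have hq : ∀ t ∈ J, q t = Q.act (s (x t)) (γ t) := fun t ht => by
      rw [← hl.proj_eq t ht]; exact (hact _ (Set.mem_univ _)).symm
    -- The gauge formula turns horizontality into (γg)' = -Θγg, which is h' = hΘ for this inverse.
    refine ⟨fun t => ((γ t : SL3) * g t)⁻¹, fun t ht => ?_, ?_⟩
    · have htJ := hJ.mem_nhds ht
      have hγt : MDifferentiableAt 𝓘(ℝ, ℝ) 𝓘(ℝ, GModel) γ t :=
        (hγ.contMDiffAt htJ).mdifferentiableAt (by simp)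
      have hxt : DifferentiableAt ℝ x t := (hx.contDiffAt htJ).differentiableAt (by simp)
      have hσ : MDifferentiableAt 𝓘(ℝ, ℝ) Q.I (s ∘ x) t :=
        ((hs.mdifferentiable (by simp)) (x t)).comp t hxt.mdifferentiableAt
      have h1 := form_mfderiv_act η hσ hγt (1 : ℝ)
      have h2 : (η.form (q t) (mfderiv 𝓘(ℝ, ℝ) Q.I q t (1 : ℝ)) : Mat3) =
          mat (γ t)⁻¹ * (η.pull (s ∘ x) t 1 : Mat3) * mat (γ t)
            + mat (γ t)⁻¹ * dMat 𝓘(ℝ, ℝ) γ t (1 : ℝ) := by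
        refine Eq.trans ?_ h1
        have e : q =ᶠ[nhds t] fun t => Q.act ((s ∘ x) t) (γ t) :=
          Filter.eventuallyEq_of_mem htJ hq
        rw [e.mfderiv_eq]
        exact congrArg Subtype.val (η.form_congr (hq t ht) _)
      rw [η.pull_comp_curve hs hxt] at h2
      set Θ : Mat3 := (η.pull s (x t) (deriv x t) : Mat3)
      have hγ' : HasMatDerivAt (fun t => mat (γ t)) (dMat 𝓘(ℝ, ℝ) γ t (1 : ℝ)) t := by
        intro i j
        have := (mdifferentiableAt_mat hγt i j)
        have h3 := this.differentiableAt.hasDerivAt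
        refine h3.congr_deriv ?_
        change _ = mfderiv 𝓘(ℝ, ℝ) 𝓘(ℝ, ℝ) (fun t => mat (γ t) i j) t (1 : ℝ)
        rw [mfderiv_eq_fderiv]
        rfl
      set g' : Mat3 := Matrix.of fun i j => deriv (fun s => (g s : Mat3) i j) t
      have hg' : HasMatDerivAt (fun t => (g t : Mat3)) g' t := fun i j =>
        (((hl.contDiffOn i j).contDiffAt htJ).differentiableAt (by simp)).hasDerivAt
      have hor := hl.horizontal t ht
      rw [h2] at hor
      set Γ' := dMat 𝓘(ℝ, ℝ) γ t (1 : ℝ)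
      have hg'eq : g' = -((mat (γ t)⁻¹ * Θ * mat (γ t) + mat (γ t)⁻¹ * Γ') * (g t : Mat3)) := by
        have := congrArg (fun M => (g t : Mat3) * M) hor
        simp only [mul_add, mul_zero, ← mul_assoc, SL3.mul_inv_coe, one_mul] at this
        exact eq_neg_of_add_eq_zero_right this
      have hprod : HasMatDerivAt (fun t => (((γ t : SL3) * g t : SL3) : Mat3))
          (-(Θ * (((γ t : SL3) * g t : SL3) : Mat3))) t := by
        have h3 := hγ'.mul hg'
        have h4 : Γ' * (g t : Mat3) + mat (γ t) * g' =
            -(Θ * (((γ t : SL3) * g t : SL3) : Mat3)) := by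
          rw [hg'eq, Matrix.SpecialLinearGroup.coe_mul]
          have h5 := mat_mul_inv (γ t)
          calc _ = Γ' * (g t : Mat3) - (mat (γ t) * mat (γ t)⁻¹) * (Θ * mat (γ t) + Γ')
                * (g t : Mat3) := by noncomm_ring
            _ = _ := by rw [h5]; noncomm_ring
        rw [h4] at h3
        exact h3
      have h6 := hprod.inv
      have h7 : -((((γ t : SL3) * g t)⁻¹ : SL3) * -(Θ * (((γ t : SL3) * g t : SL3) : Mat3)) *
          (((γ t : SL3) * g t)⁻¹ : SL3)) = ((((γ t : SL3) * g t)⁻¹ : SL3) : Mat3) * Θ := by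
        set k : SL3 := (γ t : SL3) * g t
        calc _ = ((k⁻¹ : SL3) : Mat3) * Θ * ((k : Mat3) * ((k⁻¹ : SL3) : Mat3)) := by noncomm_ring
          _ = _ := by rw [SL3.mul_inv_coe, mul_one]
      rw [h7] at h6
      exact h6
    · obtain ⟨f, hf, hLf⟩ := L.exists_le_ker_of_lt_top (lt_top_iff_ne_top.2 fun h => by
        rw [h, finrank_top] at hL; simp at hL)
      refine ⟨f, hf, fun t ht => ?_⟩
      have h1 : (fun i => (((g t)⁻¹ : SL3) : Mat3) i 0) ∈ L := by
        have := hdev t ht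
        rw [devPoint_submodule] at this
        exact this (Submodule.mem_span_singleton_self _)
      -- The first column of γ⁻¹ is a multiple of the first basis vector, so multiplication by γ⁻¹
      -- on the right only rescales the first column.
      have h2 : (fun i => ((((γ t : SL3) * g t)⁻¹ : SL3) : Mat3) i 0) =
          mat (γ t)⁻¹ 0 0 • fun i => (((g t)⁻¹ : SL3) : Mat3) i 0 := by
        funext i
        have h3 : ((((γ t : SL3) * g t)⁻¹ : SL3) : Mat3) =
            (((g t)⁻¹ : SL3) : Mat3) * mat (γ t)⁻¹ := by
          rw [mul_inv_rev, Matrix.SpecialLinearGroup.coe_mul]; rfl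
        rw [h3, Matrix.mul_apply, Fin.sum_univ_three, mat_one_zero, mat_two_zero, Pi.smul_apply,
          smul_eq_mul]
        ring
      simp only [h2, map_smul]
      rw [LinearMap.mem_ker.1 (hLf h1), smul_zero]
  · rintro ⟨h, hh, f, hf, hfh⟩
    have hxd : ∀ t ∈ J, DifferentiableAt ℝ x t := fun t ht =>
      (hx.contDiffAt (hJ.mem_nhds ht)).differentiableAt (by simp)
    have hsx : ContMDiffOn 𝓘(ℝ, ℝ) Q.I ∞ (s ∘ x) J := hs.comp_contMDiffOn hx.contMDiffOn
    have hΘ : ∀ i j, ContDiffOn ℝ ∞ (fun t => (η.pull s (x t) (deriv x t) : Mat3) i j) J :=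
      fun i j => (η.contDiffOn_pull hJ hsx (contDiffOn_const (c := (1 : ℝ))) i j).congr
        fun t ht => by rw [η.pull_comp_curve hs (hxd t ht)]
    have hsm := contDiffOn_of_hasMatDerivAt hJ hΘ hh
    refine ⟨s ∘ x, fun t => (h t)⁻¹, ⟨hsx, SL3.inv_entry_contDiffOn hsm,
      fun t _ => hsec _, fun t ht => ?_⟩, LinearMap.ker f, ?_, fun t ht => ?_⟩
    · have h1 : η.form ((s ∘ x) t) (mfderiv 𝓘(ℝ, ℝ) Q.I (s ∘ x) t (1 : ℝ)) =
          η.pull s (x t) (deriv x t) := η.pull_comp_curve hs (hxd t ht)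
      have h2 := (hh t ht).inv
      have h3 : (Matrix.of fun i j => deriv (fun s => (((h s)⁻¹ : SL3) : Mat3) i j) t) =
          -(((h t)⁻¹ : SL3) * ((h t : Mat3) * (η.pull s (x t) (deriv x t) : Mat3))
            * ((h t)⁻¹ : SL3)) := by
        ext i j; exact (h2 i j).deriv
      rw [h1, h3, inv_inv, ← mul_assoc, SL3.inv_mul_coe, one_mul, mul_neg, mul_assoc, add_neg_cancel]
    · have := Module.Dual.finrank_ker_add_one_of_ne_zero hf
      rw [Module.finrank_fin_fun] at this
      omega
    · rw [devPoint_submodule, Submodule.span_singleton_le_iff_mem, inv_inv]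
      exact hfh t ht

/-- The left-hand side minus the right-hand side of the geodesic equation in a section. -/
noncomputable def geodesicDefect (s : Plane → Q.Total) (x : ℝ → Plane) (t : ℝ) : ℝ :=
  deriv x t 0 * (deriv (deriv x) t 1
      + (η.pull s (x t) (deriv x t) : Mat3) 2 1 * deriv x t 0
      + (η.pull s (x t) (deriv x t) : Mat3) 2 2 * deriv x t 1)
    - deriv x t 1 * (deriv (deriv x) t 0
      + (η.pull s (x t) (deriv x t) : Mat3) 1 1 * deriv x t 0
      + (η.pull s (x t) (deriv x t) : Mat3) 1 2 * deriv x t 1)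

theorem hasDerivAt_deriv_apply {J : Set ℝ} (hJ : IsOpen J) {x : ℝ → Plane}
    (hx : ContDiffOn ℝ ∞ x J) {t : ℝ} (ht : t ∈ J) (i : Fin 2) :
    HasDerivAt (fun t => deriv x t i) (deriv (deriv x) t i) t := by
  have h1 : ContDiffOn ℝ 1 (deriv x) J :=
    ((contDiffOn_infty_iff_deriv_of_isOpen hJ).1 hx).2.of_le (by exact_mod_cast le_top)
  have h2 : HasDerivAt (deriv x) (deriv (deriv x) t) t :=
    ((h1.contDiffAt (hJ.mem_nhds ht)).differentiableAt (by simp)).hasDerivAt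
  exact (EuclideanSpace.proj i : Plane →L[ℝ] ℝ).hasFDerivAt.comp_hasDerivAt t h2

/-- The covector r = fh satisfies r' = rΘ, and r₀ = 0 says that the development stays on the line.
Differentiating r₀ = 0 once gives r₁x' + r₂y' = 0; differentiating again brings in the second
derivatives, and eliminating r leaves the defect. -/
theorem geodesicDefect_eq_zero {J : Set ℝ} (hJ : IsOpen J) {x : ℝ → Plane}
    (hx : ContDiffOn ℝ ∞ x J) {s : Plane → Q.Total} (hs : η.IsNormalSection Set.univ s)
    (hg : η.IsGeodesic J x) : ∀ t ∈ J, η.geodesicDefect s x t = 0 := by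
  obtain ⟨h, hh, f, hf, hfh⟩ := (η.isGeodesic_iff_developsOnLine hJ hx
    (contMDiffOn_univ.1 hs.contMDiffOn) fun x => hs.proj_eq x (Set.mem_univ _)).1 hg
  set Θ : ℝ → Mat3 := fun t => (η.pull s (x t) (deriv x t) : Mat3) with hΘ
  set l : Fin 3 → ℝ := fun i => f (fun j => if i = j then 1 else 0) with hl
  have hfl : ∀ v, f v = v 0 * l 0 + v 1 * l 1 + v 2 * l 2 := fun v => by
    rw [f.pi_apply_eq_sum_univ v, Fin.sum_univ_three]
    simp only [smul_eq_mul, hl]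
  set r : Fin 3 → ℝ → ℝ := fun j t => f (fun i => (h t : Mat3) i j) with hr
  have hr' : ∀ t ∈ J, ∀ j, HasDerivAt (r j) (r 0 t * Θ t 0 j + r 1 t * Θ t 1 j + r 2 t * Θ t 2 j)
      t := by
    intro t ht j
    have h1 := hh t ht
    have h2 := (((h1 0 j).mul_const (l 0)).add ((h1 1 j).mul_const (l 1))).add
      ((h1 2 j).mul_const (l 2))
    have h3 : r j = fun t => (h t : Mat3) 0 j * l 0 + (h t : Mat3) 1 j * l 1
        + (h t : Mat3) 2 j * l 2 := by funext t; exact hfl _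
    rw [h3]
    refine h2.congr_deriv ?_
    simp only [hr, hfl, Matrix.mul_apply, Fin.sum_univ_three, hΘ]
    ring
  -- Otherwise f would annihilate all three columns of the invertible matrix h.
  have hne : ∀ t ∈ J, r 1 t ≠ 0 ∨ r 2 t ≠ 0 := by
    intro t ht
    by_contra! hc
    have h0 : ∀ j, r j t = 0 := by
      intro j; fin_cases j
      exacts [hfh t ht, hc.1, hc.2]
    refine hf (LinearMap.ext fun v => ?_)
    set w := ((((h t)⁻¹ : SL3) : Mat3).mulVec v)
    have hv : v = ∑ j, w j • fun i => (h t : Mat3) i j := by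
      have h1 : (h t : Mat3).mulVec w = v := by
        rw [Matrix.mulVec_mulVec, SL3.mul_inv_coe, Matrix.one_mulVec]
      funext i
      conv_lhs => rw [← h1]
      simp [Matrix.mulVec, dotProduct, mul_comm]
    rw [hv, map_sum]
    exact Finset.sum_eq_zero fun j _ => by rw [map_smul]; exact (congrArg _ (h0 j)).trans (smul_zero _)
  intro t ht
  have e0 : ∀ t ∈ J, r 0 t = 0 := hfh
  have e1 : ∀ t ∈ J, r 1 t * deriv x t 0 + r 2 t * deriv x t 1 = 0 := by
    intro t ht
    have h1 := hr' t ht 0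
    have h2 : r 0 =ᶠ[nhds t] fun _ => 0 := Filter.eventuallyEq_of_mem (hJ.mem_nhds ht) e0
    have h3 := h1.unique ((hasDerivAt_const t (0 : ℝ)).congr_of_eventuallyEq h2)
    rw [e0 t ht] at h3
    have h4 := hs.one_zero (x t) (Set.mem_univ _) (deriv x t)
    have h5 := hs.two_zero (x t) (Set.mem_univ _) (deriv x t)
    simp only [hΘ] at h3
    rw [h4, h5] at h3
    linarith
  have e2 : (r 1 t * Θ t 1 1 + r 2 t * Θ t 2 1) * deriv x t 0 + r 1 t * deriv (deriv x) t 0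
      + ((r 1 t * Θ t 1 2 + r 2 t * Θ t 2 2) * deriv x t 1 + r 2 t * deriv (deriv x) t 1) = 0 := by
    have h1 := ((hr' t ht 1).mul (hasDerivAt_deriv_apply hJ hx ht 0)).add
      ((hr' t ht 2).mul (hasDerivAt_deriv_apply hJ hx ht 1))
    have h2 := h1.unique ((hasDerivAt_const t (0 : ℝ)).congr_of_eventuallyEq
      (Filter.eventuallyEq_of_mem (hJ.mem_nhds ht) e1))
    rw [e0 t ht] at h2
    linarith
  have e1t := e1 t ht
  unfold geodesicDefect
  simp only [hΘ] at e2
  rcases hne t ht with h1 | h1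
  · refine (mul_eq_zero.1 ?_).resolve_left h1
    linear_combination (-deriv x t 1) * e2 + (deriv (deriv x) t 1
      + (η.pull s (x t) (deriv x t) : Mat3) 2 1 * deriv x t 0
      + (η.pull s (x t) (deriv x t) : Mat3) 2 2 * deriv x t 1) * e1t
  · refine (mul_eq_zero.1 ?_).resolve_left h1
    linear_combination (deriv x t 0) * e2 - (deriv (deriv x) t 0
      + (η.pull s (x t) (deriv x t) : Mat3) 1 1 * deriv x t 0
      + (η.pull s (x t) (deriv x t) : Mat3) 1 2 * deriv x t 1) * e1t

/-- Put λ = (0, -y', x'). Vanishing of the defect says that λΘ - λ' is a multiple μλ, so with F' = μ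
the covector e^F λ h⁻¹ is constant. Paired with the first column of h it gives e^F λ₀ = 0, which
places the development on a line. -/
theorem isGeodesic_of_geodesicDefect_eq_zero {J : Set ℝ} {x : ℝ → Plane}
    (hx : IsRegularCurve J x) {s : Plane → Q.Total} (hs : η.IsNormalSection Set.univ s)
    (h0 : ∀ t ∈ J, η.geodesicDefect s x t = 0) : η.IsGeodesic J x := by
  obtain ⟨hJ, hJc, hxs, hreg⟩ := hx
  have hsm : ContMDiff 𝓘(ℝ, Plane) Q.I ∞ s := contMDiffOn_univ.1 hs.contMDiffOn
  refine (η.isGeodesic_iff_developsOnLine hJ hxs hsm fun x => hs.proj_eq x (Set.mem_univ _)).2 ?_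
  set Θ : ℝ → Mat3 := fun t => (η.pull s (x t) (deriv x t) : Mat3) with hΘdef
  have hxd : ∀ t ∈ J, DifferentiableAt ℝ x t := fun t ht =>
    (hxs.contDiffAt (hJ.mem_nhds ht)).differentiableAt (by simp)
  have hsx : ContMDiffOn 𝓘(ℝ, ℝ) Q.I ∞ (s ∘ x) J := hsm.comp_contMDiffOn hxs.contMDiffOn
  have hΘ : ∀ i j, ContDiffOn ℝ ∞ (fun t => Θ t i j) J :=
    fun i j => (η.contDiffOn_pull hJ hsx (contDiffOn_const (c := (1 : ℝ))) i j).congr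
      fun t ht => by rw [η.pull_comp_curve hsm (hxd t ht)]
  obtain ⟨h, hh⟩ := exists_SL3_ode hJ hJc (fun i j => (hΘ i j).continuousOn)
    (fun t _ => trace_sl3 (η.pull s (x t) (deriv x t)))
  refine ⟨h, hh, ?_⟩
  have hx' : ∀ i : Fin 2, ∀ t ∈ J, HasDerivAt (fun t => deriv x t i) (deriv (deriv x) t i) t :=
    fun i t ht => hasDerivAt_deriv_apply hJ hxs ht i
  have hx2 : ContDiffOn ℝ ∞ (deriv (deriv x)) J :=
    ((contDiffOn_infty_iff_deriv_of_isOpen hJ).1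
      ((contDiffOn_infty_iff_deriv_of_isOpen hJ).1 hxs).2).2
  have hc2 : ∀ i : Fin 2, ContinuousOn (fun t => deriv (deriv x) t i) J := fun i =>
    (EuclideanSpace.proj i : Plane →L[ℝ] ℝ).continuous.comp_continuousOn hx2.continuousOn
  have hc1 : ∀ i : Fin 2, ContinuousOn (fun t => deriv x t i) J := fun i t ht =>
    (hx' i t ht).continuousAt.continuousWithinAt
  have hcΘ : ∀ i j, ContinuousOn (fun t => Θ t i j) J := fun i j => (hΘ i j).continuousOn
  have hN : ∀ t ∈ J, deriv x t 0 ^ 2 + deriv x t 1 ^ 2 ≠ 0 := by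
    intro t ht h
    apply hreg t ht
    have a0 : deriv x t 0 = 0 := by nlinarith [sq_nonneg (deriv x t 0), sq_nonneg (deriv x t 1)]
    have a1 : deriv x t 1 = 0 := by nlinarith [sq_nonneg (deriv x t 0), sq_nonneg (deriv x t 1)]
    ext i; fin_cases i
    exacts [a0, a1]
  -- the rate at which the covector `(0, -y', x')` is rescaled by parallel transport
  set μ : ℝ → ℝ := fun t => (deriv x t 1 * (deriv x t 1 * Θ t 1 1 - deriv x t 0 * Θ t 2 1
      - deriv (deriv x) t 1) + deriv x t 0 * (-deriv x t 1 * Θ t 1 2 + deriv x t 0 * Θ t 2 2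
      - deriv (deriv x) t 0)) / (deriv x t 0 ^ 2 + deriv x t 1 ^ 2) with hμ
  have hμc : ContinuousOn μ J := by
    refine ContinuousOn.div ?_ (((hc1 0).pow 2).add ((hc1 1).pow 2)) hN
    exact ((hc1 1).mul ((((hc1 1).mul (hcΘ 1 1)).sub ((hc1 0).mul (hcΘ 2 1))).sub (hc2 1))).add
      ((hc1 0).mul ((((hc1 1).neg.mul (hcΘ 1 2)).add ((hc1 0).mul (hcΘ 2 2))).sub (hc2 0)))
  obtain ⟨F, hF⟩ := exists_antideriv hJ hJc hμc
  -- The components of μλ = λΘ - λ'. Here μ is the projection of the right-hand side on λ, so each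
  -- component holds up to a multiple of the defect; the component of index 0 is trivial, as the
  -- first column of Θ is (0, x', y').
  have hμ1 : ∀ t ∈ J, -deriv x t 1 * μ t =
      -deriv x t 1 * Θ t 1 1 + deriv x t 0 * Θ t 2 1 + deriv (deriv x) t 1 := by
    intro t ht
    have h1 := h0 t ht
    unfold geodesicDefect at h1
    simp only [hμ, hΘdef]
    rw [mul_div_assoc', div_eq_iff (hN t ht)]
    linear_combination (-deriv x t 0) * h1
  have hμ2 : ∀ t ∈ J, deriv x t 0 * μ t =
      -deriv x t 1 * Θ t 1 2 + deriv x t 0 * Θ t 2 2 - deriv (deriv x) t 0 := by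
    intro t ht
    have h1 := h0 t ht
    unfold geodesicDefect at h1
    simp only [hμ, hΘdef]
    rw [mul_div_assoc', div_eq_iff (hN t ht)]
    linear_combination (-deriv x t 1) * h1
  set k : ℝ → Mat3 := fun t => (((h t)⁻¹ : SL3) : Mat3) with hk
  have hk' : ∀ t ∈ J, HasMatDerivAt k (-(Θ t * k t)) t := by
    intro t ht
    have h1 := (hh t ht).inv
    have h2 : -((((h t)⁻¹ : SL3) : Mat3) * ((h t : Mat3) * Θ t) * (((h t)⁻¹ : SL3) : Mat3)) =
        -(Θ t * k t) := by
      rw [← mul_assoc, SL3.inv_mul_coe, one_mul]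
    rw [← h2]
    exact h1
  set g : Fin 3 → ℝ → ℝ := fun j t =>
    Real.exp (F t) * (-deriv x t 1 * k t 1 j + deriv x t 0 * k t 2 j) with hg
  have hg' : ∀ j, ∀ t ∈ J, HasDerivAt (g j) 0 t := by
    intro j t ht
    have h1 := ((hF t ht).exp).mul ((((hx' 1 t ht).neg).mul (hk' t ht 1 j)).add
      ((hx' 0 t ht).mul (hk' t ht 2 j)))
    refine h1.congr_deriv ?_
    have h4 : Θ t 1 0 = deriv x t 0 := hs.one_zero (x t) (Set.mem_univ _) (deriv x t)
    have h5 : Θ t 2 0 = deriv x t 1 := hs.two_zero (x t) (Set.mem_univ _) (deriv x t)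
    simp only [Matrix.neg_apply, Matrix.mul_apply, Fin.sum_univ_three, h4, h5, Pi.neg_apply,
      Pi.add_apply, Pi.mul_apply]
    linear_combination Real.exp (F t) * (k t 1 j * hμ1 t ht + k t 2 j * hμ2 t ht)
  have hgc : ∀ j, ∀ t ∈ J, ∀ t' ∈ J, g j t = g j t' := fun j t ht t' ht' =>
    hJ.is_const_of_deriv_eq_zero hJc.isPreconnected
      (fun t ht => (hg' j t ht).differentiableAt.differentiableWithinAt)
      (fun t ht => (hg' j t ht).deriv) ht ht'
  have hkh : ∀ t i, k t i 0 * (h t : Mat3) 0 i + k t i 1 * (h t : Mat3) 1 i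
      + k t i 2 * (h t : Mat3) 2 i = 1 := by
    intro t i
    have := congrFun (congrFun (SL3.inv_mul_coe (h t)) i) i
    rwa [Matrix.mul_apply, Fin.sum_univ_three, Matrix.one_apply_eq] at this
  have hkh' : ∀ t i j, i ≠ j → k t i 0 * (h t : Mat3) 0 j + k t i 1 * (h t : Mat3) 1 j
      + k t i 2 * (h t : Mat3) 2 j = 0 := by
    intro t i j hij
    have := congrFun (congrFun (SL3.inv_mul_coe (h t)) i) j
    rwa [Matrix.mul_apply, Fin.sum_univ_three, Matrix.one_apply_ne hij] at this
  rcases J.eq_empty_or_nonempty with rfl | ⟨t₀, ht₀⟩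
  · refine ⟨LinearMap.proj 0, fun h => ?_, fun t ht => ht.elim⟩
    exact one_ne_zero (LinearMap.congr_fun h (fun _ => (1 : ℝ)))
  -- The constant covector e^F λ h⁻¹. It is nonzero because its values on the last two columns of h
  -- are the components of e^F λ, and the curve is regular.
  refine ⟨∑ j, g j t₀ • LinearMap.proj j, fun hf => hreg t₀ ht₀ ?_, fun t ht => ?_⟩
  · have hz : ∀ v : Fin 3 → ℝ, g 0 t₀ * v 0 + g 1 t₀ * v 1 + g 2 t₀ * v 2 = 0 := fun v => by
      have := LinearMap.congr_fun hf v
      simpa [Fin.sum_univ_three] using this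
    have hexp := Real.exp_ne_zero (F t₀)
    have z1 := hz fun i => (h t₀ : Mat3) i 1
    have z2 := hz fun i => (h t₀ : Mat3) i 2
    simp only [hg] at z1 z2
    have a1 : deriv x t₀ 1 = 0 := by
      refine (mul_eq_zero.1 ?_).resolve_left hexp
      linear_combination -z1 - Real.exp (F t₀) * deriv x t₀ 1 * (hkh t₀ 1)
        + Real.exp (F t₀) * deriv x t₀ 0 * (hkh' t₀ 2 1 (by decide))
    have a0 : deriv x t₀ 0 = 0 := by
      refine (mul_eq_zero.1 ?_).resolve_left hexp
      linear_combination z2 - Real.exp (F t₀) * deriv x t₀ 0 * (hkh t₀ 2)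
        + Real.exp (F t₀) * deriv x t₀ 1 * (hkh' t₀ 1 2 (by decide))
    ext i; fin_cases i
    exacts [a0, a1]
  · have : (∑ j, g j t₀ • (LinearMap.proj j : (Fin 3 → ℝ) →ₗ[ℝ] ℝ))
        (fun i => (h t : Mat3) i 0) = g 0 t₀ * (h t : Mat3) 0 0 + g 1 t₀ * (h t : Mat3) 1 0
          + g 2 t₀ * (h t : Mat3) 2 0 := by
      simp [Fin.sum_univ_three]
    rw [this, hgc 0 t₀ ht₀ t ht, hgc 1 t₀ ht₀ t ht, hgc 2 t₀ ht₀ t ht]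
    simp only [hg]
    linear_combination -Real.exp (F t) * deriv x t 1 * (hkh' t 1 0 (by decide))
      + Real.exp (F t) * deriv x t 0 * (hkh' t 2 0 (by decide))

end CartanConnection

/-! ### The trivial bundle -/

/-- The model with corners of the total space of the trivial bundle. -/
noncomputable abbrev trivI : ModelWithCorners ℝ (Plane × GModel) (Plane × GModel) :=
  𝓘(ℝ, Plane × GModel)

/-- A `PrincipalBundle` uses the standard model of a single vector space, while products of
manifolds use the product model; this equality carries facts about products over. -/
theorem trivI_eq : trivI = 𝓘(ℝ, Plane).prod 𝓘(ℝ, GModel) := modelWithCornersSelf_prod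

noncomputable instance : ChartedSpace (Plane × GModel) (Plane × stabGroup) :=
  inferInstanceAs (ChartedSpace (ModelProd Plane GModel) (Plane × stabGroup))

instance : IsManifold trivI ∞ (Plane × stabGroup) := by
  rw [trivI_eq]
  exact inferInstanceAs (IsManifold (𝓘(ℝ, Plane).prod 𝓘(ℝ, GModel)) ∞ (Plane × stabGroup))

theorem contMDiff_trivI_fst :
    ContMDiff trivI 𝓘(ℝ, Plane) ∞ (Prod.fst : Plane × stabGroup → Plane) := by
  rw [trivI_eq]; exact contMDiff_fst

theorem contMDiff_trivI_snd :
    ContMDiff trivI 𝓘(ℝ, GModel) ∞ (Prod.snd : Plane × stabGroup → stabGroup) := by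
  rw [trivI_eq]; exact contMDiff_snd

section

variable {E H M : Type*} [NormedAddCommGroup E] [NormedSpace ℝ E] [TopologicalSpace H]
  {I : ModelWithCorners ℝ E H} [TopologicalSpace M] [ChartedSpace H M]

theorem contMDiffWithinAt_trivI_prodMk {f : M → Plane} {g : M → stabGroup} {s : Set M} {x : M}
    (hf : ContMDiffWithinAt I 𝓘(ℝ, Plane) ∞ f s x)
    (hg : ContMDiffWithinAt I 𝓘(ℝ, GModel) ∞ g s x) :
    ContMDiffWithinAt I trivI ∞ (fun m => (f m, g m)) s x := by
  rw [trivI_eq]; exact hf.prodMk hg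

theorem dMat_comp {E' H' N : Type*} [NormedAddCommGroup E'] [NormedSpace ℝ E']
    [TopologicalSpace H'] {I' : ModelWithCorners ℝ E' H'} [TopologicalSpace N]
    [ChartedSpace H' N] {f : M → N} {γ : N → stabGroup} {m : M}
    (hγ : MDifferentiableAt I' 𝓘(ℝ, GModel) γ (f m)) (hf : MDifferentiableAt I I' f m)
    (v : TangentSpace I m) :
    dMat I' γ (f m) (mfderiv I I' f m v) = dMat I (γ ∘ f) m v := by
  ext i j
  exact (mfderiv_comp_apply m (mdifferentiableAt_mat hγ i j) hf v).symm

theorem dMat_mul_const (g : stabGroup) {γ : M → stabGroup} {m : M}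
    (h : MDifferentiableAt I 𝓘(ℝ, GModel) γ m) (v : TangentSpace I m) :
    dMat I (fun m => γ m * g) m v = dMat I γ m v * mat g := by
  ext i j
  have h1 : ∀ k, HasMFDerivAt I 𝓘(ℝ, ℝ) (fun m => mat g k j * mat (γ m) i k) m
      (mat g k j • mfderiv I 𝓘(ℝ, ℝ) (fun m => mat (γ m) i k) m) := fun k =>
    (mdifferentiableAt_mat h i k).hasMFDerivAt.const_smul (mat g k j)
  have h2 := ((h1 0).add (h1 1)).add (h1 2)
  have h3 : (fun m => mat (γ m * g) i j) =
    (fun m => mat g 0 j * mat (γ m) i 0) + (fun m => mat g 1 j * mat (γ m) i 1)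
      + (fun m => mat g 2 j * mat (γ m) i 2) := by
    funext m; simp [mat_mul, Matrix.mul_apply, Fin.sum_univ_three, mul_comm]
  have h4 : dMat I (fun m => γ m * g) m v i j =
      mat g 0 j * dMat I γ m v i 0 + mat g 1 j * dMat I γ m v i 1
        + mat g 2 j * dMat I γ m v i 2 := by
    change mfderiv I 𝓘(ℝ, ℝ) (fun m => mat (γ m * g) i j) m v = _
    rw [h3, h2.mfderiv]; rfl
  rw [Matrix.mul_apply, Fin.sum_univ_three, h4]
  ring

theorem dMat_one_zero (γ : M → stabGroup) (m : M) (v : TangentSpace I m) :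
    dMat I γ m v 1 0 = 0 := by
  change mfderiv I 𝓘(ℝ, ℝ) (fun m => mat (γ m) 1 0) m v = 0
  have h : (fun m => mat (γ m) 1 0) = fun _ => (0 : ℝ) := funext fun m => mat_one_zero (γ m)
  rw [h, mfderiv_const]
  rfl

theorem dMat_two_zero (γ : M → stabGroup) (m : M) (v : TangentSpace I m) :
    dMat I γ m v 2 0 = 0 := by
  change mfderiv I 𝓘(ℝ, ℝ) (fun m => mat (γ m) 2 0) m v = 0
  have h : (fun m => mat (γ m) 2 0) = fun _ => (0 : ℝ) := funext fun m => mat_two_zero (γ m)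
  rw [h, mfderiv_const]
  rfl

/-- Differentiate the determinant relation g₀₀ det A = 1. -/
theorem trace_inv_mul_dMat {γ : M → stabGroup} {m : M}
    (h : MDifferentiableAt I 𝓘(ℝ, GModel) γ m) (v : TangentSpace I m) :
    (mat (γ m)⁻¹ * dMat I γ m v).trace = 0 := by
  have hd := fun i j => (mdifferentiableAt_mat h i j).hasMFDerivAt
  have h1 := (hd 0 0).mul (((hd 1 1).mul (hd 2 2)).sub ((hd 1 2).mul (hd 2 1)))
  have h2 : ((fun m => mat (γ m) 0 0) * ((fun m => mat (γ m) 1 1) * (fun m => mat (γ m) 2 2)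
      - (fun m => mat (γ m) 1 2) * (fun m => mat (γ m) 2 1))) = fun _ => (1 : ℝ) := by
    funext m; exact stabGroup_det (γ m)
  rw [h2] at h1
  have h3 := congrArg (fun T : TangentSpace I m →L[ℝ] ℝ => T v)
    (h1.mfderiv.symm.trans (mfderiv_const (c := (1 : ℝ))))
  have h4 : mat (γ m) 0 0 * (mat (γ m) 1 1 * dMat I γ m v 2 2 + mat (γ m) 2 2 * dMat I γ m v 1 1
      - (mat (γ m) 1 2 * dMat I γ m v 2 1 + mat (γ m) 2 1 * dMat I γ m v 1 2))
      + (mat (γ m) 1 1 * mat (γ m) 2 2 - mat (γ m) 1 2 * mat (γ m) 2 1) * dMat I γ m v 0 0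
      = 0 := by
    exact h3
  rw [mat_inv, Matrix.adjugate_fin_three, Matrix.trace_fin_three]
  simp only [Matrix.mul_apply, Fin.sum_univ_three, mat_one_zero, mat_two_zero, dMat_one_zero,
    dMat_two_zero]
  simp
  linear_combination h4

theorem contMDiff_mfderiv_apply [IsManifold I ∞ M] {V : Type*} [NormedAddCommGroup V]
    [NormedSpace ℝ V]
    {f : M → V} (hf : ContMDiff I 𝓘(ℝ, V) ∞ f) :
    ContMDiff I.tangent 𝓘(ℝ, V) ∞
      (fun v : TangentBundle I M => (mfderiv I 𝓘(ℝ, V) f v.proj v.snd : V)) :=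
  (contMDiff_snd_tangentBundle_modelSpace V 𝓘(ℝ, V)).comp
    (hf.contMDiff_tangentMap (m := ∞) (by simp))

end

/-- The trivial principal bundle over the plane. -/
noncomputable abbrev trivialBundle : PrincipalBundle.{0} where
  Model := Plane × GModel
  Total := Plane × stabGroup
  proj := Prod.fst
  act p g := (p.1, p.2 * g)
  act_one p := by simp
  act_mul p g h := by simp [mul_assoc]
  contMDiff_proj := contMDiff_trivI_fst
  contMDiff_act := fun q => by
    refine contMDiffWithinAt_trivI_prodMk
      (contMDiff_trivI_fst.comp contMDiff_fst q) (contMDiffWithinAt_mul ?_ ?_)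
    · exact contMDiff_trivI_snd.comp contMDiff_fst q
    · exact contMDiff_snd q
  locallyTrivial x₀ := ⟨Set.univ, fun x => (x, 1), Prod.snd, isOpen_univ, Set.mem_univ _,
    fun _ _ => contMDiffWithinAt_trivI_prodMk contMDiffWithinAt_id contMDiffWithinAt_const,
    contMDiff_trivI_snd.contMDiffOn, fun x _ g => ⟨rfl, one_mul g⟩,
    fun p _ => by simp⟩

/-! ### The connection on the trivial bundle defined by a form on the plane -/

/-- A smooth `sl(3, ℝ)`-valued form on the plane whose first column is `(0, dx, dy)`. -/
structure NormalForm where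
  /-- The form. -/
  toFun : Plane → Plane →ₗ[ℝ] sl3
  smooth : ∀ v i j, ContDiff ℝ ∞ (fun x => (toFun x v : Mat3) i j)
  zero_zero : ∀ x v, (toFun x v : Mat3) 0 0 = 0
  one_zero : ∀ x v, (toFun x v : Mat3) 1 0 = v 0
  two_zero : ∀ x v, (toFun x v : Mat3) 2 0 = v 1

theorem trace_conj (g : stabGroup) (X : sl3) :
    (mat g⁻¹ * (X : Mat3) * mat g).trace = 0 := by
  rw [Matrix.trace_mul_comm, ← mul_assoc, mat_mul_inv, one_mul]
  exact X.2

theorem finrank_sl3 : Module.finrank ℝ sl3 = 8 := by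
  have h := LinearMap.finrank_range_add_finrank_ker (Matrix.traceLinearMap (Fin 3) ℝ ℝ)
  have h1 : LinearMap.range (Matrix.traceLinearMap (Fin 3) ℝ ℝ) = ⊤ := by
    rw [LinearMap.range_eq_top]
    intro c
    exact ⟨Matrix.single 0 0 c, by simp⟩
  have h2 : Module.finrank ℝ Mat3 = 9 := by
    rw [Module.finrank_matrix]; simp
  rw [h1, finrank_top, Module.finrank_self, h2] at h
  change 1 + Module.finrank ℝ sl3 = 9 at h
  omega

theorem mdifferentiable_trivI_fst :
    MDifferentiable trivI 𝓘(ℝ, Plane) (Prod.fst : Plane × stabGroup → Plane) :=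
  contMDiff_trivI_fst.mdifferentiable (by simp)

theorem mdifferentiable_trivI_snd :
    MDifferentiable trivI 𝓘(ℝ, GModel) (Prod.snd : Plane × stabGroup → stabGroup) :=
  contMDiff_trivI_snd.mdifferentiable (by simp)

theorem dMat_add {E H M : Type*} [NormedAddCommGroup E] [NormedSpace ℝ E] [TopologicalSpace H]
    {I : ModelWithCorners ℝ E H} [TopologicalSpace M] [ChartedSpace H M] (γ : M → stabGroup)
    (m : M) (v w : TangentSpace I m) : dMat I γ m (v + w) = dMat I γ m v + dMat I γ m w := by
  ext i j; exact map_add (mfderiv I 𝓘(ℝ, ℝ) (fun m => mat (γ m) i j) m) v w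

theorem dMat_smul {E H M : Type*} [NormedAddCommGroup E] [NormedSpace ℝ E] [TopologicalSpace H]
    {I : ModelWithCorners ℝ E H} [TopologicalSpace M] [ChartedSpace H M] (γ : M → stabGroup)
    (m : M) (c : ℝ) (v : TangentSpace I m) : dMat I γ m (c • v) = c • dMat I γ m v := by
  ext i j; exact map_smul (mfderiv I 𝓘(ℝ, ℝ) (fun m => mat (γ m) i j) m) c v

/-- The form `g⁻¹ θ g + g⁻¹ dg` on the trivial bundle. -/
noncomputable def NormalForm.extend (θ : NormalForm) (p : Plane × stabGroup) :
    TangentSpace trivI p →ₗ[ℝ] sl3 where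
  toFun v := ⟨mat p.2⁻¹ * (θ.toFun p.1 (mfderiv trivI 𝓘(ℝ, Plane) Prod.fst p v) : Mat3) * mat p.2
      + mat p.2⁻¹ * dMat trivI Prod.snd p v, by
    rw [LinearMap.mem_ker, Matrix.traceLinearMap_apply, Matrix.trace_add, trace_conj,
      trace_inv_mul_dMat (mdifferentiable_trivI_snd p), add_zero]⟩
  map_add' v w := by
    have h : θ.toFun p.1 (mfderiv trivI 𝓘(ℝ, Plane) Prod.fst p (v + w)) =
      θ.toFun p.1 (mfderiv trivI 𝓘(ℝ, Plane) Prod.fst p v) +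
      θ.toFun p.1 (mfderiv trivI 𝓘(ℝ, Plane) Prod.fst p w) :=
      (congrArg _ (map_add (mfderiv trivI 𝓘(ℝ, Plane) Prod.fst p) v w)).trans (map_add _ _ _)
    apply Subtype.ext
    rw [Submodule.coe_add]
    simp only [h, dMat_add, Submodule.coe_add]
    noncomm_ring
  map_smul' c v := by
    have h : θ.toFun p.1 (mfderiv trivI 𝓘(ℝ, Plane) Prod.fst p (c • v)) =
      c • θ.toFun p.1 (mfderiv trivI 𝓘(ℝ, Plane) Prod.fst p v) :=
      (congrArg _ (map_smul (mfderiv trivI 𝓘(ℝ, Plane) Prod.fst p) c v)).trans (map_smul _ _ _)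
    apply Subtype.ext
    rw [RingHom.id_apply, Submodule.coe_smul]
    simp only [h, dMat_smul, Submodule.coe_smul]
    rw [smul_add, mul_smul_comm, smul_mul_assoc, mul_smul_comm]

theorem NormalForm.extend_apply (θ : NormalForm) (p : Plane × stabGroup)
    (v : TangentSpace trivI p) : (θ.extend p v : Mat3) =
      mat p.2⁻¹ * (θ.toFun p.1 (mfderiv trivI 𝓘(ℝ, Plane) Prod.fst p v) : Mat3) * mat p.2
      + mat p.2⁻¹ * dMat trivI Prod.snd p v := rfl

/-- The group part of the vector is detected by `gCoord`, whose components are matrix entries and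
whose derivative has a left inverse, the derivative of `gInv`. -/
theorem tangent_eq_zero {p : Plane × stabGroup} {v : TangentSpace trivI p}
    (h1 : mfderiv trivI 𝓘(ℝ, Plane) Prod.fst p v = 0) (h2 : dMat trivI Prod.snd p v = 0) :
    v = 0 := by
  have e1 : (mfderiv trivI 𝓘(ℝ, Plane) Prod.fst p v : Plane) = (v : Plane × GModel).1 := by
    have : mfderiv trivI 𝓘(ℝ, Plane) (Prod.fst : Plane × stabGroup → Plane) p =
        mfderiv (𝓘(ℝ, Plane).prod 𝓘(ℝ, GModel)) 𝓘(ℝ, Plane) Prod.fst p := by rw [trivI_eq]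
    rw [this, mfderiv_fst]
    rfl
  have e2 : (mfderiv trivI 𝓘(ℝ, GModel) Prod.snd p v : GModel) = (v : Plane × GModel).2 := by
    have : mfderiv trivI 𝓘(ℝ, GModel) (Prod.snd : Plane × stabGroup → stabGroup) p =
        mfderiv (𝓘(ℝ, Plane).prod 𝓘(ℝ, GModel)) 𝓘(ℝ, GModel) Prod.snd p := by rw [trivI_eq]
    rw [this, mfderiv_snd]
    rfl
  set w : GModel := mfderiv trivI 𝓘(ℝ, GModel) Prod.snd p v with hw
  have hgc : MDifferentiableAt 𝓘(ℝ, GModel) 𝓘(ℝ, GModel) gCoord p.2 :=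
    contMDiff_gCoord.mdifferentiable (by simp) p.2
  have e3 : (mfderiv 𝓘(ℝ, GModel) 𝓘(ℝ, GModel) gCoord p.2 w : GModel) = 0 := by
    funext i j
    have hl : MDifferentiableAt 𝓘(ℝ, GModel) 𝓘(ℝ, ℝ) (fun m : GModel => m i j) (gCoord p.2) :=
      DifferentiableAt.mdifferentiableAt (by fun_prop)
    have c1 := mfderiv_comp_apply p.2 hl hgc w
    have c2 := mfderiv_comp_apply p ((contMDiff_mat i j.succ).mdifferentiable (by simp) p.2)
      (mdifferentiable_trivI_snd p) v
    have c3 : mfderiv 𝓘(ℝ, GModel) 𝓘(ℝ, ℝ) (fun g => mat g i j.succ) p.2 w = 0 :=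
      c2.symm.trans (congrFun (congrFun h2 i) j.succ)
    have c4 : ∀ u : GModel, mfderiv 𝓘(ℝ, GModel) 𝓘(ℝ, ℝ) (fun m : GModel => m i j)
        (gCoord p.2) u = u i j := by
      intro u
      set l : GModel →L[ℝ] ℝ := (ContinuousLinearMap.proj j : (Fin 2 → ℝ) →L[ℝ] ℝ).comp
        (ContinuousLinearMap.proj i)
      have : (fun m : GModel => m i j) = l := rfl
      rw [this, mfderiv_eq_fderiv]
      exact congrFun (congrArg DFunLike.coe l.fderiv) u
    exact (c4 _).symm.trans (c1.symm.trans c3)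
  have e4 : w = 0 := by
    have hi : MDifferentiableAt 𝓘(ℝ, GModel) 𝓘(ℝ, GModel) gInv (gCoord p.2) :=
      (contMDiffOn_gInv.contMDiffAt (isOpen_blockDet_ne_zero.mem_nhds
        (blockDet_gCoord_ne_zero _))).mdifferentiableAt (by simp)
    have c1 := mfderiv_comp_apply p.2 hi hgc w
    have c2 : gInv ∘ gCoord = id := funext gInv_gCoord
    rw [c2, mfderiv_id] at c1
    refine c1.trans ?_
    exact (congrArg _ e3).trans (map_zero _)
  exact Prod.ext (e1.symm.trans h1) (e2.symm.trans e4)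

/-- A vector of the kernel satisfies θg + dg = 0. Below the corner, the first column of dg vanishes
and that of θg is g₀₀(dx, dy), so the vector is vertical; then θ drops out and dg = 0. -/
theorem NormalForm.extend_injective (θ : NormalForm) (p : Plane × stabGroup) :
    Function.Injective (θ.extend p) := by
  rw [← LinearMap.ker_eq_bot, LinearMap.ker_eq_bot']
  intro v hv
  set d : Plane := mfderiv trivI 𝓘(ℝ, Plane) Prod.fst p v with hdd
  set E : Mat3 := (θ.toFun p.1 d : Mat3) with hE
  have h1 : E * mat p.2 + dMat trivI Prod.snd p v = 0 := by
    have h2 : mat p.2 * (θ.extend p v : Mat3) = 0 := by rw [hv]; simp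
    rw [θ.extend_apply, ← hdd, mul_add, ← mul_assoc, ← mul_assoc, ← mul_assoc, mat_mul_inv, one_mul,
      one_mul] at h2
    exact h2
  have hcol : ∀ i : Fin 3, E i 0 * mat p.2 0 0 + dMat trivI Prod.snd p v i 0 = 0 := by
    intro i
    have := congrFun (congrFun h1 i) 0
    rw [Matrix.add_apply, Matrix.mul_apply, Fin.sum_univ_three, mat_one_zero, mat_two_zero] at this
    simpa using this
  have hd : d = 0 := by
    have e1 := hcol 1
    have e2 := hcol 2
    rw [dMat_one_zero, add_zero, hE, θ.one_zero] at e1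
    rw [dMat_two_zero, add_zero, hE, θ.two_zero] at e2
    have f1 := (mul_eq_zero.1 e1).resolve_right (mat_zero_zero_ne_zero p.2)
    have f2 := (mul_eq_zero.1 e2).resolve_right (mat_zero_zero_ne_zero p.2)
    ext i; fin_cases i
    exacts [f1, f2]
  refine tangent_eq_zero hd ?_
  have hE0 : E = 0 := by
    rw [hE, hd, map_zero]
    rfl
  rwa [hE0, zero_mul, zero_add] at h1

/-- Injectivity suffices, since 2 + 6 = 8 is the dimension of sl(3, ℝ). -/
theorem NormalForm.extend_bijective (θ : NormalForm) (p : Plane × stabGroup) :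
    Function.Bijective (θ.extend p) := by
  have hf : Module.finrank ℝ (Plane × GModel) = Module.finrank ℝ sl3 := by
    rw [finrank_sl3, Module.finrank_prod, finrank_euclideanSpace_fin, Module.finrank_pi_fintype]
    simp
  have : Function.Injective (θ.extend p : Plane × GModel →ₗ[ℝ] sl3) := θ.extend_injective p
  exact ⟨this, (LinearMap.injective_iff_surjective_of_finrank_eq_finrank hf).1 this⟩

theorem plane_eq (v : Plane) :
    v = v 0 • EuclideanSpace.single 0 1 + v 1 • EuclideanSpace.single 1 1 := by
  ext i; fin_cases i <;> simp

theorem NormalForm.apply_entry (θ : NormalForm) (x v : Plane) (i j : Fin 3) :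
    (θ.toFun x v : Mat3) i j = v 0 * (θ.toFun x (EuclideanSpace.single 0 1) : Mat3) i j
      + v 1 * (θ.toFun x (EuclideanSpace.single 1 1) : Mat3) i j := by
  conv_lhs => rw [plane_eq v]
  rw [map_add, map_smul, map_smul]
  rfl

theorem NormalForm.contMDiff_extend (θ : NormalForm) (i j : Fin 3) :
    ContMDiff trivI.tangent 𝓘(ℝ, ℝ) ∞
      (fun v : TangentBundle trivI (Plane × stabGroup) =>
        (θ.extend v.proj v.snd : Mat3) i j) := by
  have hproj : ContMDiff trivI.tangent trivI ∞
      (fun v : TangentBundle trivI (Plane × stabGroup) => v.proj) :=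
    Bundle.contMDiff_proj (TangentSpace trivI : Plane × stabGroup → Type)
  have hmat : ∀ i j, ContMDiff trivI.tangent 𝓘(ℝ, ℝ) ∞
      (fun v : TangentBundle trivI (Plane × stabGroup) => mat v.proj.2 i j) := fun i j =>
    (contMDiff_mat i j).comp (contMDiff_trivI_snd.comp hproj)
  have hinv : ∀ i j, ContMDiff trivI.tangent 𝓘(ℝ, ℝ) ∞
      (fun v : TangentBundle trivI (Plane × stabGroup) => mat v.proj.2⁻¹ i j) := fun i j v =>
    contMDiffWithinAt_mat (contMDiffWithinAt_inv ((contMDiff_trivI_snd.comp hproj) v)) i j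
  have hd : ContMDiff trivI.tangent 𝓘(ℝ, Plane) ∞
      (fun v : TangentBundle trivI (Plane × stabGroup) =>
        (mfderiv trivI 𝓘(ℝ, Plane) Prod.fst v.proj v.snd : Plane)) :=
    contMDiff_mfderiv_apply contMDiff_trivI_fst
  have hdc : ∀ k : Fin 2, ContMDiff trivI.tangent 𝓘(ℝ, ℝ) ∞
      (fun v : TangentBundle trivI (Plane × stabGroup) =>
        (EuclideanSpace.proj k : Plane →L[ℝ] ℝ)
          (mfderiv trivI 𝓘(ℝ, Plane) Prod.fst v.proj v.snd)) := fun k =>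
    (EuclideanSpace.proj k : Plane →L[ℝ] ℝ).contMDiff.comp hd
  have hθ : ∀ w k l, ContMDiff trivI.tangent 𝓘(ℝ, ℝ) ∞
      (fun v : TangentBundle trivI (Plane × stabGroup) =>
        (θ.toFun v.proj.1 w : Mat3) k l) := fun w k l =>
    (θ.smooth w k l).contMDiff.comp (contMDiff_trivI_fst.comp hproj)
  have hE : ∀ k l, ContMDiff trivI.tangent 𝓘(ℝ, ℝ) ∞
      (fun v : TangentBundle trivI (Plane × stabGroup) =>
        (θ.toFun v.proj.1 (mfderiv trivI 𝓘(ℝ, Plane) Prod.fst v.proj v.snd) : Mat3) k l) :=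
    fun k l => (((hdc 0).mul (hθ _ k l)).add ((hdc 1).mul (hθ _ k l))).congr
      fun v => θ.apply_entry _ _ k l
  have hD : ∀ k l, ContMDiff trivI.tangent 𝓘(ℝ, ℝ) ∞
      (fun v : TangentBundle trivI (Plane × stabGroup) =>
        dMat trivI Prod.snd v.proj v.snd k l) := fun k l =>
    contMDiff_mfderiv_apply ((contMDiff_mat k l).comp contMDiff_trivI_snd)
  have h1 : ContMDiff trivI.tangent 𝓘(ℝ, ℝ) ∞
      (fun v : TangentBundle trivI (Plane × stabGroup) =>
        ∑ l, (∑ k, mat v.proj.2⁻¹ i k *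
          (θ.toFun v.proj.1 (mfderiv trivI 𝓘(ℝ, Plane) Prod.fst v.proj v.snd) : Mat3) k l)
            * mat v.proj.2 l j
        + ∑ k, mat v.proj.2⁻¹ i k * dMat trivI Prod.snd v.proj v.snd k j) := by
    refine ContMDiff.add (contMDiff_finsetSum fun l _ => ContMDiff.mul
      (contMDiff_finsetSum fun k _ => (hinv i k).mul (hE k l)) (hmat l j))
      (contMDiff_finsetSum fun k _ => (hinv i k).mul (hD k j))
  refine h1.congr fun v => ?_
  rw [θ.extend_apply, Matrix.add_apply, Matrix.mul_apply, Matrix.mul_apply]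
  simp only [Matrix.mul_apply]

theorem NormalForm.extend_right_mul (θ : NormalForm) (g : stabGroup) (p : Plane × stabGroup)
    (v : TangentSpace trivI p) :
    (θ.extend (p.1, p.2 * g) (mfderiv trivI trivI
      (fun q : Plane × stabGroup => (q.1, q.2 * g)) p v) : Mat3) =
      mat g⁻¹ * (θ.extend p v : Mat3) * mat g := by
  have hR : MDifferentiableAt trivI trivI (fun q : Plane × stabGroup => (q.1, q.2 * g)) p :=
    ContMDiffAt.mdifferentiableAt (n := ∞) (contMDiffWithinAt_trivI_prodMk
      (contMDiff_trivI_fst p)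
      (contMDiffWithinAt_mul (contMDiff_trivI_snd p) contMDiffWithinAt_const)) (by simp)
  have c1 : mfderiv trivI 𝓘(ℝ, Plane) Prod.fst (p.1, p.2 * g) (mfderiv trivI trivI
      (fun q : Plane × stabGroup => (q.1, q.2 * g)) p v) =
      mfderiv trivI 𝓘(ℝ, Plane) Prod.fst p v :=
    (mfderiv_comp_apply p (mdifferentiable_trivI_fst (p.1, p.2 * g)) hR v).symm
  have c2 : dMat trivI Prod.snd (p.1, p.2 * g) (mfderiv trivI trivI
      (fun q : Plane × stabGroup => (q.1, q.2 * g)) p v) = dMat trivI Prod.snd p v * mat g :=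
    (dMat_comp (f := fun q : Plane × stabGroup => (q.1, q.2 * g))
      (mdifferentiable_trivI_snd (p.1, p.2 * g)) hR v).trans
      (dMat_mul_const g (mdifferentiable_trivI_snd p) v)
  rw [θ.extend_apply, θ.extend_apply, c1, c2]
  simp only [mul_inv_rev, mat_mul]
  noncomm_ring

theorem NormalForm.extend_fundamental (θ : NormalForm) (p : Plane × stabGroup)
    (ξ : TangentSpace 𝓘(ℝ, GModel) (1 : stabGroup)) :
    (θ.extend (p.1, p.2 * 1) (mfderiv 𝓘(ℝ, GModel) trivI
      (fun g : stabGroup => (p.1, p.2 * g)) 1 ξ) : Mat3) =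
      dMat 𝓘(ℝ, GModel) id 1 ξ := by
  have hid : MDifferentiableAt 𝓘(ℝ, GModel) 𝓘(ℝ, GModel) (id : stabGroup → stabGroup) 1 :=
    mdifferentiableAt_id
  have hR : MDifferentiableAt 𝓘(ℝ, GModel) trivI (fun g : stabGroup => (p.1, p.2 * g)) 1 :=
    ContMDiffAt.mdifferentiableAt (n := ∞) (contMDiffWithinAt_trivI_prodMk
      contMDiffWithinAt_const
      (contMDiffWithinAt_mul contMDiffWithinAt_const contMDiffWithinAt_id)) (by simp)
  have c1 : mfderiv trivI 𝓘(ℝ, Plane) Prod.fst (p.1, p.2 * 1) (mfderiv 𝓘(ℝ, GModel) trivI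
      (fun g : stabGroup => (p.1, p.2 * g)) 1 ξ) = (0 : Plane) := by
    refine (mfderiv_comp_apply 1 (mdifferentiable_trivI_fst (p.1, p.2 * 1)) hR ξ).symm.trans ?_
    have : (Prod.fst : Plane × stabGroup → Plane) ∘ (fun g : stabGroup => (p.1, p.2 * g)) =
      fun _ => p.1 := rfl
    rw [this, mfderiv_const]
    rfl
  have c2 : dMat trivI Prod.snd (p.1, p.2 * 1) (mfderiv 𝓘(ℝ, GModel) trivI
      (fun g : stabGroup => (p.1, p.2 * g)) 1 ξ) = mat p.2 * dMat 𝓘(ℝ, GModel) id 1 ξ :=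
    (dMat_comp (f := fun g : stabGroup => (p.1, p.2 * g))
      (mdifferentiable_trivI_snd (p.1, p.2 * 1)) hR ξ).trans
      (dMat_const_mul p.2 hid ξ)
  have c3 : θ.toFun p.1 (0 : Plane) = 0 := map_zero _
  rw [θ.extend_apply, c1, c2]
  simp only [c3, mul_one, Submodule.coe_zero, mul_zero, zero_mul, zero_add]
  rw [← mul_assoc, mat_inv_mul, one_mul]

/-- The Cartan connection `g⁻¹ θ g + g⁻¹ dg` on the trivial bundle. -/
noncomputable def NormalForm.connection (θ : NormalForm) : CartanConnection trivialBundle where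
  form := θ.extend
  smooth := θ.contMDiff_extend
  fundamental p ξ i j := congrFun (congrFun (θ.extend_fundamental p ξ) i) j
  equivariant g p v := θ.extend_right_mul g p v
  bijective := θ.extend_bijective

/-! ### Curvature of the connection on the trivial bundle -/

section

variable {F : Type*} [NormedAddCommGroup F] [NormedSpace ℝ F]

theorem NormalForm.pull_connection (θ : NormalForm) {f : F → Plane} {γ : F → stabGroup} {z : F}
    (hs : MDifferentiableAt 𝓘(ℝ, F) trivI (fun z => (f z, γ z)) z) (w : F) :
    (θ.connection.pull (fun z => ((f z, γ z) : trivialBundle.Total)) z w : Mat3) =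
      mat (γ z)⁻¹ * (θ.toFun (f z) (fderiv ℝ f z w) : Mat3) * mat (γ z)
        + mat (γ z)⁻¹ * dMat 𝓘(ℝ, F) γ z w := by
  have c1 : mfderiv trivI 𝓘(ℝ, Plane) Prod.fst (f z, γ z)
      (mfderiv 𝓘(ℝ, F) trivI (fun z => (f z, γ z)) z w) = fderiv ℝ f z w := by
    refine (mfderiv_comp_apply z (mdifferentiable_trivI_fst (f z, γ z)) hs w).symm.trans ?_
    have : (Prod.fst : Plane × stabGroup → Plane) ∘ (fun z => (f z, γ z)) = f := rfl
    rw [this, mfderiv_eq_fderiv]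
    rfl
  have c2 : dMat trivI Prod.snd (f z, γ z)
      (mfderiv 𝓘(ℝ, F) trivI (fun z => (f z, γ z)) z w) = dMat 𝓘(ℝ, F) γ z w :=
    dMat_comp (f := fun z => (f z, γ z)) (mdifferentiable_trivI_snd (f z, γ z)) hs w
  refine (θ.extend_apply _ _).trans ?_
  rw [c1, c2]

end

theorem NormalForm.pull_unit_section (θ : NormalForm) (x v : Plane) :
    θ.connection.pull (fun x => ((x, 1) : trivialBundle.Total)) x v = θ.toFun x v := by
  apply Subtype.ext
  rw [θ.pull_connection (f := fun x => x) (γ := fun _ => 1) (ContMDiffAt.mdifferentiableAt (n := ∞)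
      (contMDiffWithinAt_trivI_prodMk contMDiffWithinAt_id contMDiffWithinAt_const) (by simp))]
  have h1 : dMat 𝓘(ℝ, Plane) (fun _ : Plane => (1 : stabGroup)) x v = 0 := by
    ext i j
    change mfderiv 𝓘(ℝ, Plane) 𝓘(ℝ, ℝ) (fun _ => mat 1 i j) x v = 0
    rw [mfderiv_const]; rfl
  have h2 : fderiv ℝ (fun x : Plane => x) x v = v := by rw [fderiv_fun_id]; rfl
  rw [h1, h2]
  simp [mat_one]

theorem NormalForm.isNormalSection (θ : NormalForm) :
    θ.connection.IsNormalSection Set.univ (fun x => ((x, 1) : trivialBundle.Total)) where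
  contMDiffOn _ _ := contMDiffWithinAt_trivI_prodMk contMDiffWithinAt_id contMDiffWithinAt_const
  proj_eq _ _ := rfl
  zero_zero x _ v := by rw [θ.pull_unit_section]; exact θ.zero_zero x v
  one_zero x _ v := by rw [θ.pull_unit_section]; exact θ.one_zero x v
  two_zero x _ v := by rw [θ.pull_unit_section]; exact θ.two_zero x v

/-- The curvature `dθ + θ ∧ θ` of a form on the plane. -/
noncomputable def NormalForm.curv (θ : NormalForm) (x u v : Plane) : Mat3 :=
  Matrix.of (fun i j => fderiv ℝ (fun x => (θ.toFun x v : Mat3) i j) x u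
    - fderiv ℝ (fun x => (θ.toFun x u : Mat3) i j) x v)
  + ((θ.toFun x u : Mat3) * (θ.toFun x v : Mat3) - (θ.toFun x v : Mat3) * (θ.toFun x u : Mat3))

/-- The algebra behind the transformation of curvature, with h = g⁻¹: a and b are the values of θ in
two directions, a' is the derivative of b in the first and b' that of a in the second, p and q are
the derivatives of g, and r is its mixed second derivative, which cancels. -/
theorem gauge_curvature_identity {R : Type*} [Ring R] {g h : R} (hg : g * h = 1)
    (a b a' b' p q r : R) :
    (-(h * p * h) * b * g + h * a' * g + h * b * p + (-(h * p * h) * q + h * r))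
      - (-(h * q * h) * a * g + h * b' * g + h * a * q + (-(h * q * h) * p + h * r))
      + ((h * a * g + h * p) * (h * b * g + h * q) - (h * b * g + h * q) * (h * a * g + h * p))
      = h * (a' - b' + (a * b - b * a)) * g := by
  have e1 : (h * a * g + h * p) * (h * b * g + h * q) =
      h * a * (g * h) * b * g + h * a * (g * h) * q + h * p * h * b * g + h * p * h * q := by
    noncomm_ring
  have e2 : (h * b * g + h * q) * (h * a * g + h * p) =
      h * b * (g * h) * a * g + h * b * (g * h) * p + h * q * h * a * g + h * q * h * p := by
    noncomm_ring
  rw [e1, e2, hg]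
  noncomm_ring

theorem two_le_infty : (2 : WithTop ℕ∞) ≤ ∞ :=
  WithTop.coe_le_coe.2 (le_top : (2 : ℕ∞) ≤ ⊤)

/-- The parametrization of the trivial bundle by the plane and the coordinates of the group. -/
noncomputable def trivParam (z : Plane × GModel) : trivialBundle.Total := (z.1, gInv z.2)

theorem isOpen_snd_blockDet_ne_zero : IsOpen {z : Plane × GModel | blockDet z.2 ≠ 0} :=
  isOpen_blockDet_ne_zero.preimage continuous_snd

theorem contMDiffOn_gInv_snd : ContMDiffOn 𝓘(ℝ, Plane × GModel) 𝓘(ℝ, GModel) ∞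
    (fun z : Plane × GModel => gInv z.2) {z | blockDet z.2 ≠ 0} :=
  contMDiffOn_gInv.comp contDiff_snd.contMDiff.contMDiffOn fun _ hz => hz

theorem contMDiffOn_trivParam : ContMDiffOn 𝓘(ℝ, Plane × GModel) trivI ∞ trivParam
    {z | blockDet z.2 ≠ 0} := fun z hz =>
  contMDiffWithinAt_trivI_prodMk (contDiff_fst.contMDiff z).contMDiffWithinAt
    (contMDiffOn_gInv_snd z hz)

theorem contDiffOn_mat_gInv_snd (i j : Fin 3) : ContDiffOn ℝ ∞
    (fun z : Plane × GModel => mat (gInv z.2) i j) {z | blockDet z.2 ≠ 0} :=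
  ContMDiffOn.contDiffOn fun z hz => contMDiffWithinAt_mat (contMDiffOn_gInv_snd z hz) i j

/-- The derivative of the matrix with given coordinates. -/
noncomputable def dMatCoord (z w : Plane × GModel) : Mat3 :=
  Matrix.of fun i j => fderiv ℝ (fun z : Plane × GModel => mat (gInv z.2) i j) z w

theorem NormalForm.pull_trivParam (θ : NormalForm) {z : Plane × GModel} (hz : blockDet z.2 ≠ 0)
    (w : Plane × GModel) :
    (θ.connection.pull trivParam z w : Mat3) =
      mat (gInv z.2)⁻¹ * (θ.toFun z.1 w.1 : Mat3) * mat (gInv z.2)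
        + mat (gInv z.2)⁻¹ * dMatCoord z w := by
  have hn := isOpen_snd_blockDet_ne_zero.mem_nhds hz
  refine (θ.pull_connection (f := Prod.fst) (γ := fun z => gInv z.2)
    ((contMDiffOn_trivParam.contMDiffAt hn).mdifferentiableAt (by simp)) w).trans ?_
  have h1 : fderiv ℝ (Prod.fst : Plane × GModel → Plane) z w = w.1 := by rw [fderiv_fst]; rfl
  have h2 : dMat 𝓘(ℝ, Plane × GModel) (fun z : Plane × GModel => gInv z.2) z w =
      dMatCoord z w := by
    ext i j
    change mfderiv 𝓘(ℝ, Plane × GModel) 𝓘(ℝ, ℝ) _ z w = _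
    rw [mfderiv_eq_fderiv]; rfl
  rw [h1, h2]

theorem dMatCoord_succ {z : Plane × GModel} (hz : blockDet z.2 ≠ 0) (w : Plane × GModel)
    (i : Fin 3) (j : Fin 2) : dMatCoord z w i j.succ = w.2 i j := by
  have h1 : (fun z : Plane × GModel => mat (gInv z.2) i j.succ) =ᶠ[nhds z] fun z => z.2 i j :=
    Filter.eventually_of_mem (isOpen_snd_blockDet_ne_zero.mem_nhds hz) fun y hy =>
      congrFun (congrFun (gCoord_gInv hy) i) j
  change fderiv ℝ _ z w = _
  rw [h1.fderiv_eq]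
  have h2 : HasFDerivAt (fun z : Plane × GModel => z.2 i j)
      ((ContinuousLinearMap.proj j).comp ((ContinuousLinearMap.proj i).comp
        (ContinuousLinearMap.snd ℝ Plane GModel))) z :=
    ((ContinuousLinearMap.proj j).comp ((ContinuousLinearMap.proj i).comp
        (ContinuousLinearMap.snd ℝ Plane GModel))).hasFDerivAt
  rw [h2.fderiv]
  rfl

theorem dMatCoord_zero_col (z w : Plane × GModel)
    {i : Fin 3} (hi : i ≠ 0) : dMatCoord z w i 0 = 0 := by
  have h1 : (fun z : Plane × GModel => mat (gInv z.2) i 0) = fun z => 0 := by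
    funext z
    obtain rfl | rfl : i = 1 ∨ i = 2 := by fin_cases i <;> simp at hi ⊢
    · exact mat_one_zero _
    · exact mat_two_zero _
  change fderiv ℝ _ z w = _
  rw [h1]; simp

theorem mat_inv_mul_cancel_left (g : stabGroup) (M : Mat3) : mat g * (mat g⁻¹ * M) = M := by
  rw [← mul_assoc, mat_mul_inv, one_mul]

theorem mat_inv_mul_col (g : stabGroup) {M : Mat3} (h : ∀ i : Fin 3, i ≠ 0 → M i 0 = 0)
    {i : Fin 3} (hi : i ≠ 0) : (mat g⁻¹ * M) i 0 = 0 := by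
  rw [Matrix.mul_apply, Fin.sum_univ_three, h 1 (by simp), h 2 (by simp)]
  obtain rfl | rfl : i = 1 ∨ i = 2 := by fin_cases i <;> simp at hi ⊢
  · rw [mat_one_zero]; ring
  · rw [mat_two_zero]; ring

theorem NormalForm.pull_trivParam_bijective (θ : NormalForm) {z : Plane × GModel}
    (hz : blockDet z.2 ≠ 0) : Function.Bijective (θ.connection.pull trivParam z) := by
  have hinj : Function.Injective (θ.connection.pull trivParam z) := by
    rw [← LinearMap.ker_eq_bot, LinearMap.ker_eq_bot']
    intro w hw
    have h0 := θ.pull_trivParam hz w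
    rw [hw] at h0
    set g := gInv z.2
    have h1 : (θ.toFun z.1 w.1 : Mat3) * mat g + dMatCoord z w = 0 := by
      have := congrArg (fun M => mat g * M) h0
      simp only [mul_add, mul_assoc, mat_inv_mul_cancel_left] at this
      simpa using this.symm
    have h2 : ∀ i : Fin 3, i ≠ 0 → (θ.toFun z.1 w.1 : Mat3) i 0 = 0 := by
      intro i hi
      have := congrFun (congrFun h1 i) 0
      rw [Matrix.add_apply, dMatCoord_zero_col z w hi, Matrix.mul_apply, Fin.sum_univ_three,
        mat_one_zero, mat_two_zero] at this
      simpa [mat_zero_zero_ne_zero] using this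
    have hw1 : w.1 = 0 := by
      ext k
      fin_cases k
      · exact (θ.one_zero z.1 w.1).symm.trans (h2 1 (by simp))
      · exact (θ.two_zero z.1 w.1).symm.trans (h2 2 (by simp))
    have h3 : dMatCoord z w = 0 := by simpa [hw1] using h1
    refine Prod.ext hw1 ?_
    funext i j
    rw [← dMatCoord_succ hz, h3]; rfl
  refine ⟨hinj, (LinearMap.injective_iff_surjective_of_finrank_eq_finrank ?_).1 hinj⟩
  rw [finrank_sl3, Module.finrank_prod, finrank_euclideanSpace_fin, Module.finrank_pi_fintype]
  simp

/-- Restricting to the line z + tu reduces everything to the product rule for matrix-valued curves.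
The result has the form required by `gauge_curvature_identity`. -/
theorem NormalForm.fderiv_pullEntry_trivParam (θ : NormalForm) {z : Plane × GModel}
    (hz : blockDet z.2 ≠ 0) (u w : Plane × GModel) (i j : Fin 3) :
    fderiv ℝ (θ.connection.pullEntry trivParam i j) z u w =
      (-(mat (gInv z.2)⁻¹ * dMatCoord z u * mat (gInv z.2)⁻¹) * (θ.toFun z.1 w.1 : Mat3)
          * mat (gInv z.2)
        + mat (gInv z.2)⁻¹ * Matrix.of (fun i j =>
            fderiv ℝ (fun x => (θ.toFun x w.1 : Mat3) i j) z.1 u.1) * mat (gInv z.2)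
        + mat (gInv z.2)⁻¹ * (θ.toFun z.1 w.1 : Mat3) * dMatCoord z u
        + (-(mat (gInv z.2)⁻¹ * dMatCoord z u * mat (gInv z.2)⁻¹) * dMatCoord z w
          + mat (gInv z.2)⁻¹ * Matrix.of (fun i j =>
            fderiv ℝ (fderiv ℝ (fun z : Plane × GModel => mat (gInv z.2) i j)) z u w))) i j := by
  have hn := isOpen_snd_blockDet_ne_zero.mem_nhds hz
  have hl : HasDerivAt (fun t : ℝ => z + t • u) u 0 := by
    simpa using ((hasDerivAt_id (0 : ℝ)).smul_const u).const_add z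
  have hl0 : z + (0 : ℝ) • u = z := by simp
  have hlt : ∀ᶠ t in nhds (0 : ℝ), blockDet (z + t • u).2 ≠ 0 := by
    have := hl.continuousAt
    rw [ContinuousAt, hl0] at this
    exact this hn
  have hd1 : HasDerivAt (fun t : ℝ => θ.connection.pullEntry trivParam i j (z + t • u) w)
      (fderiv ℝ (θ.connection.pullEntry trivParam i j) z u w) 0 := by
    have hd : DifferentiableAt ℝ (θ.connection.pullEntry trivParam i j) z :=
      (((θ.connection.contDiffOn_pullEntry isOpen_snd_blockDet_ne_zero contMDiffOn_trivParam
        i j).contDiffAt hn).differentiableAt (by simp))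
    have h2 := (hl0 ▸ hd.hasFDerivAt : HasFDerivAt _ _ (z + (0 : ℝ) • u)).comp_hasDerivAt 0 hl
    exact h2.clm_apply (hasDerivAt_const 0 w) |>.congr_deriv (by simp)
  have hG : HasMatDerivAt (fun t : ℝ => mat (gInv (z + t • u).2)) (dMatCoord z u) 0 := by
    intro i j
    have hd : DifferentiableAt ℝ (fun z : Plane × GModel => mat (gInv z.2) i j) z :=
      ((contDiffOn_mat_gInv_snd i j).contDiffAt hn).differentiableAt (by simp)
    have h2 := (hl0 ▸ hd.hasFDerivAt : HasFDerivAt _ _ (z + (0 : ℝ) • u)).comp_hasDerivAt 0 hl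
    exact h2.congr_deriv (by rw [hl0]; rfl)
  have hH : HasMatDerivAt (fun t : ℝ => mat (gInv (z + t • u).2)⁻¹)
      (-(mat (gInv z.2)⁻¹ * dMatCoord z u * mat (gInv z.2)⁻¹)) 0 := by
    have := HasMatDerivAt.inv (g := fun t : ℝ => (gInv (z + t • u).2 : SL3)) hG
    simp only [hl0] at this
    exact this
  have hθ : HasMatDerivAt (fun t : ℝ => (θ.toFun (z + t • u).1 w.1 : Mat3))
      (Matrix.of fun i j => fderiv ℝ (fun x => (θ.toFun x w.1 : Mat3) i j) z.1 u.1) 0 := by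
    intro i j
    have hd : DifferentiableAt ℝ (fun x => (θ.toFun x w.1 : Mat3) i j) z.1 :=
      (θ.smooth w.1 i j).differentiable (by simp) _
    have hl1 : HasDerivAt (fun t : ℝ => (z + t • u).1) u.1 0 :=
      (ContinuousLinearMap.fst ℝ Plane GModel).hasFDerivAt.comp_hasDerivAt 0 hl
    have hd' := hd.hasFDerivAt
    have e : z.1 = (z + (0 : ℝ) • u).1 := by rw [hl0]
    exact HasFDerivAt.comp_hasDerivAt 0 (by rw [← e]; exact hd') hl1
  have hD : HasMatDerivAt (fun t : ℝ => dMatCoord (z + t • u) w)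
      (Matrix.of fun i j =>
        fderiv ℝ (fderiv ℝ (fun z : Plane × GModel => mat (gInv z.2) i j)) z u w) 0 := by
    intro i j
    have hd : DifferentiableAt ℝ (fderiv ℝ (fun z : Plane × GModel => mat (gInv z.2) i j)) z :=
      (((contDiffOn_mat_gInv_snd i j).contDiffAt hn).fderiv_right (m := 1)
        (by norm_num; exact two_le_infty)).differentiableAt (by simp)
    have h2 := (hl0 ▸ hd.hasFDerivAt : HasFDerivAt _ _ (z + (0 : ℝ) • u)).comp_hasDerivAt 0 hl
    exact h2.clm_apply (hasDerivAt_const 0 w) |>.congr_deriv (by simp)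
  have hall := ((hH.mul hθ).mul hG)
  have hall2 := hH.mul hD
  have h3 := ((hall i j).add (hall2 i j)).congr_of_eventuallyEq
    (f₁ := fun t : ℝ => θ.connection.pullEntry trivParam i j (z + t • u) w)
    (hlt.mono fun t ht => congrFun (congrFun (θ.pull_trivParam ht w) i) j)
  rw [hd1.unique h3]
  simp only [hl0, Matrix.add_apply, Matrix.add_mul]

/-- X and Y are the values of ω on tangent vectors in the parametrization; u and v are the plane
components of these. Vertical components contribute neither to the curvature nor to the entries of
the first column below the corner. -/
theorem NormalForm.curvature_star (θ : NormalForm) (p : Plane × stabGroup) (X Y : sl3) :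
    ∃ u v : Plane, θ.connection.curvature (θ.connection.star X) (θ.connection.star Y) p =
        mat p.2⁻¹ * θ.curv p.1 u v * mat p.2 ∧
      (∀ i : Fin 3, i ≠ 0 → (X : Mat3) i 0 =
        (mat p.2⁻¹ * (θ.toFun p.1 u : Mat3) * mat p.2) i 0) ∧
      (∀ i : Fin 3, i ≠ 0 → (Y : Mat3) i 0 =
        (mat p.2⁻¹ * (θ.toFun p.1 v : Mat3) * mat p.2) i 0) := by
  obtain ⟨x, g⟩ := p
  set z : Plane × GModel := (x, gCoord g) with hzdef
  have hz : blockDet z.2 ≠ 0 := blockDet_gCoord_ne_zero g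
  have hn := isOpen_snd_blockDet_ne_zero.mem_nhds hz
  have hg : gInv z.2 = g := gInv_gCoord g
  have hp : trivParam z = (x, g) := Prod.ext rfl hg
  obtain ⟨u, rfl⟩ := (θ.pull_trivParam_bijective hz).2 X
  obtain ⟨w, rfl⟩ := (θ.pull_trivParam_bijective hz).2 Y
  have hcol : ∀ u : Plane × GModel, ∀ i : Fin 3, i ≠ 0 →
      (θ.connection.pull trivParam z u : Mat3) i 0 =
        (mat g⁻¹ * (θ.toFun x u.1 : Mat3) * mat g) i 0 := by
    intro u i hi
    rw [θ.pull_trivParam hz, hg, Matrix.add_apply,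
      mat_inv_mul_col g (fun i hi => dMatCoord_zero_col z u hi) hi, add_zero]
  refine ⟨u.1, w.1, ?_, hcol u, hcol w⟩
  have hsymm : (Matrix.of fun i j =>
        fderiv ℝ (fderiv ℝ (fun z : Plane × GModel => mat (gInv z.2) i j)) z w u) =
      Matrix.of fun i j =>
        fderiv ℝ (fderiv ℝ (fun z : Plane × GModel => mat (gInv z.2) i j)) z u w := by
    ext i j
    exact (((contDiffOn_mat_gInv_snd i j).contDiffAt hn).isSymmSndFDerivAt
      (by simpa using two_le_infty)).eq w u
  rw [← hp]
  ext i j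
  refine (θ.connection.curvature_star isOpen_snd_blockDet_ne_zero contMDiffOn_trivParam hz u w
    i j).trans ?_
  rw [θ.fderiv_pullEntry_trivParam hz, θ.fderiv_pullEntry_trivParam hz, hsymm,
    θ.pull_trivParam hz, θ.pull_trivParam hz, hg]
  rw [← Matrix.sub_apply, ← Matrix.add_apply]
  rw [gauge_curvature_identity (mat_mul_inv g)]
  change _ = (mat (gInv z.2)⁻¹ * θ.curv z.1 u.1 w.1 * mat (gInv z.2)) i j
  rw [hg]
  rfl

/-! ### The explicit connection -/

theorem contDiff_dX {f : Plane → ℝ} (hf : ContDiff ℝ ∞ f) : ContDiff ℝ ∞ (dX f) :=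
  (hf.fderiv_right (m := ∞) (by simp)).clm_apply contDiff_const

theorem contDiff_dY {f : Plane → ℝ} (hf : ContDiff ℝ ∞ f) : ContDiff ℝ ∞ (dY f) :=
  (hf.fderiv_right (m := ∞) (by simp)).clm_apply contDiff_const

theorem fderiv_eq_dX_dY (f : Plane → ℝ) (x v : Plane) :
    fderiv ℝ f x v = v 0 * dX f x + v 1 * dY f x := by
  conv_lhs => rw [plane_eq v]
  rw [map_add, map_smul, map_smul]
  rfl

theorem explicitForm_add (A B C D : Plane → ℝ) (x v w : Plane) :
    explicitForm A B C D x (v + w) = explicitForm A B C D x v + explicitForm A B C D x w := by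
  ext i j
  have h : ∀ k, (v + w) k = v k + w k := fun _ => rfl
  simp only [explicitForm, h]
  fin_cases i <;> fin_cases j <;> simp [-smul_eq_mul] <;> ring

theorem explicitForm_smul (A B C D : Plane → ℝ) (c : ℝ) (x v : Plane) :
    explicitForm A B C D x (c • v) = c • explicitForm A B C D x v := by
  ext i j
  have h : ∀ k, (c • v) k = c * v k := fun _ => rfl
  simp only [explicitForm, h]
  rw [Matrix.smul_apply, smul_eq_mul]
  fin_cases i <;> fin_cases j <;> simp <;> ring

theorem explicitForm_mem (A B C D : Plane → ℝ) (x v : Plane) : explicitForm A B C D x v ∈ sl3 := by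
  rw [LinearMap.mem_ker, Matrix.traceLinearMap_apply, Matrix.trace_fin_three]
  simp [explicitForm]

theorem contDiff_explicitForm {A B C D : Plane → ℝ} (hA : ContDiff ℝ ∞ A)
    (hB : ContDiff ℝ ∞ B) (hC : ContDiff ℝ ∞ C) (hD : ContDiff ℝ ∞ D) (v : Plane) (i j : Fin 3) :
    ContDiff ℝ ∞ (fun x => explicitForm A B C D x v i j) := by
  have h1 := contDiff_dX hA
  have h2 := contDiff_dX hB
  have h3 := contDiff_dX hC
  have h4 := contDiff_dY hB
  have h5 := contDiff_dY hC
  have h6 := contDiff_dY hD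
  fin_cases i <;> fin_cases j <;> simp [explicitForm] <;> fun_prop

/-- The explicit form as a form in normal position. -/
noncomputable def explicitNormalForm {A B C D : Plane → ℝ} (hA : ContDiff ℝ ∞ A)
    (hB : ContDiff ℝ ∞ B) (hC : ContDiff ℝ ∞ C) (hD : ContDiff ℝ ∞ D) : NormalForm where
  toFun x :=
    { toFun := fun v => ⟨explicitForm A B C D x v, explicitForm_mem A B C D x v⟩
      map_add' := fun v w => Subtype.ext (explicitForm_add A B C D x v w)
      map_smul' := fun c v => Subtype.ext (explicitForm_smul A B C D c x v) }
  smooth := contDiff_explicitForm hA hB hC hD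
  zero_zero _ _ := rfl
  one_zero _ _ := rfl
  two_zero _ _ := rfl

/-- An alternating 2-form on the plane is determined by its value on the coordinate vectors. -/
theorem NormalForm.curv_eq_smul (θ : NormalForm) (x u v : Plane) :
    θ.curv x u v = (u 0 * v 1 - u 1 * v 0) •
      θ.curv x (EuclideanSpace.single 0 1) (EuclideanSpace.single 1 1) := by
  have hd : ∀ w i j z, fderiv ℝ (fun x => (θ.toFun x w : Mat3) i j) x z =
      w 0 * fderiv ℝ (fun x => (θ.toFun x (EuclideanSpace.single 0 1) : Mat3) i j) x z
      + w 1 * fderiv ℝ (fun x => (θ.toFun x (EuclideanSpace.single 1 1) : Mat3) i j) x z := by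
    intro w i j z
    have h1 : (fun x => (θ.toFun x w : Mat3) i j) =
      fun x => w 0 * (θ.toFun x (EuclideanSpace.single 0 1) : Mat3) i j
        + w 1 * (θ.toFun x (EuclideanSpace.single 1 1) : Mat3) i j :=
      funext fun x => θ.apply_entry x w i j
    have hs : ∀ v, DifferentiableAt ℝ (fun x => (θ.toFun x v : Mat3) i j) x := fun v =>
      (θ.smooth v i j).differentiable (by simp) x
    rw [h1, fderiv_fun_add ((hs _).const_mul _) ((hs _).const_mul _), fderiv_const_mul (hs _),
      fderiv_const_mul (hs _)]
    rfl
  ext i j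
  simp only [NormalForm.curv, Matrix.add_apply, Matrix.sub_apply, Matrix.smul_apply,
    Matrix.of_apply, Matrix.mul_apply, Fin.sum_univ_three, smul_eq_mul]
  rw [hd v, hd u]
  simp only [θ.apply_entry x u, θ.apply_entry x v, fderiv_eq_dX_dY _ _ u, fderiv_eq_dX_dY _ _ v,
    dX, dY]
  ring

/-- The linear map from `sl(3, ℝ)` modulo the subalgebra of `G` to `ℝ²` that takes a matrix to
the last two entries of its first column. -/
noncomputable def colMap : (sl3 ⧸ stabAlg) →ₗ[ℝ] (Fin 2 → ℝ) :=
  stabAlg.liftQ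
    (LinearMap.pi fun i => Matrix.entryLinearMap ℝ ℝ i.succ 0 ∘ₗ sl3.subtype)
    (fun X hX => by
      rw [LinearMap.mem_ker]
      funext i
      fin_cases i
      · exact hX.1
      · exact hX.2)

/-- The alternating map that sends `e₁ ∧ e₂` to `Z`. -/
noncomputable def wedgeSmul (Z : sl3) : CartanConnection.StructureSpace :=
  (LinearMap.toSpanSingleton ℝ sl3 Z).compAlternatingMap
    ((Matrix.detRowAlternating (R := ℝ) (n := Fin 2)).compLinearMap colMap)

theorem wedgeSmul_apply (Z X Y : sl3) : wedgeSmul Z ![stabAlg.mkQ X, stabAlg.mkQ Y] =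
    ((X : Mat3) 1 0 * (Y : Mat3) 2 0 - (X : Mat3) 2 0 * (Y : Mat3) 1 0) • Z := by
  change Matrix.det (fun i => colMap (![stabAlg.mkQ X, stabAlg.mkQ Y] i)) • Z = _
  congr 1
  exact Matrix.det_fin_two _

/-- The shape defining W is stable under conjugation by G, so it need only be checked at the points
of one section. -/
theorem conj_firstRow (g : stabGroup) (a b : ℝ) :
    ∃ a' b' : ℝ, mat g⁻¹ * !![0, a, b; 0, 0, 0; 0, 0, 0] * mat g =
      !![0, a', b'; 0, 0, 0; 0, 0, 0] := by
  refine ⟨mat g⁻¹ 0 0 * (a * mat g 1 1 + b * mat g 2 1),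
    mat g⁻¹ 0 0 * (a * mat g 1 2 + b * mat g 2 2), ?_⟩
  ext i j
  fin_cases i <;> fin_cases j <;>
    simp [Matrix.mul_apply, Fin.sum_univ_three, mat_one_zero, mat_two_zero] <;> ring

/-- The curvature depends on X and Y only through the determinant of their classes modulo the
subalgebra, so it descends to an alternating map on the quotient. -/
theorem NormalForm.structureFunctionInW (θ : NormalForm)
    (h : ∀ x, ∃ a b : ℝ, θ.curv x (EuclideanSpace.single 0 1) (EuclideanSpace.single 1 1) =
      !![0, a, b; 0, 0, 0; 0, 0, 0]) : θ.connection.StructureFunctionInW := by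
  choose a b hab using h
  have hcg : ∀ p : Plane × stabGroup, ∃ a' b' : ℝ,
      mat p.2⁻¹ * θ.curv p.1 (EuclideanSpace.single 0 1) (EuclideanSpace.single 1 1) * mat p.2 =
        !![0, a', b'; 0, 0, 0; 0, 0, 0] := fun p => by
    rw [hab]; exact conj_firstRow _ _ _
  choose a' b' hab' using hcg
  -- On the last two entries of the first column, conjugation by g is g₀₀ times the lower block of
  -- g⁻¹; κ is the determinant of this map and compares X ∧ Y with u ∧ v.
  set κ : stabGroup → ℝ := fun g =>
    mat g 0 0 ^ 2 * (mat g⁻¹ 1 1 * mat g⁻¹ 2 2 - mat g⁻¹ 1 2 * mat g⁻¹ 2 1) with hκ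
  have hκ0 : ∀ g, κ g ≠ 0 := fun g =>
    mul_ne_zero (pow_ne_zero 2 (mat_zero_zero_ne_zero g)) (blockDet_gCoord_ne_zero g⁻¹)
  refine ⟨fun p : Plane × stabGroup =>
    wedgeSmul ((κ p.2)⁻¹ • ⟨!![0, a' p, b' p; 0, 0, 0; 0, 0, 0], by
      rw [LinearMap.mem_ker, Matrix.traceLinearMap_apply, Matrix.trace_fin_three]; simp⟩), ?_, ?_⟩
  · rintro (p : Plane × stabGroup) X Y
    obtain ⟨u, v, h1, hX, hY⟩ := θ.curvature_star p X Y
    rw [h1, wedgeSmul_apply, Submodule.coe_smul, Submodule.coe_smul, θ.curv_eq_smul,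
      mul_smul_comm, smul_mul_assoc, hab', smul_smul]
    congr 1
    have hcol : ∀ u : Plane, ∀ i : Fin 3, i ≠ 0 →
        (mat p.2⁻¹ * (θ.toFun p.1 u : Mat3) * mat p.2) i 0 =
          (mat p.2⁻¹ i 1 * u 0 + mat p.2⁻¹ i 2 * u 1) * mat p.2 0 0 := by
      intro u i hi
      have h0 := θ.zero_zero p.1 u
      have h1 := θ.one_zero p.1 u
      have h2 := θ.two_zero p.1 u
      simp only [Matrix.mul_apply, Fin.sum_univ_three, mat_one_zero, mat_two_zero, h0, h1, h2]
      ring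
    rw [hX 1 (by simp), hX 2 (by simp), hY 1 (by simp), hY 2 (by simp), hcol _ 1 (by simp),
      hcol _ 2 (by simp), hcol _ 1 (by simp), hcol _ 2 (by simp)]
    have := hκ0 p.2
    rw [mul_inv_eq_iff_eq_mul₀ this, hκ]
    ring
  · rintro (p : Plane × stabGroup)
    refine ⟨(κ p.2)⁻¹ * a' p, (κ p.2)⁻¹ * b' p, ?_⟩
    rw [wedgeSmul_apply]
    ext i j
    fin_cases i <;> fin_cases j <;> simp [colElt, Matrix.single]

theorem explicit_curv {A B C D : Plane → ℝ} (hA : ContDiff ℝ ∞ A)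
    (hB : ContDiff ℝ ∞ B) (hC : ContDiff ℝ ∞ C) (hD : ContDiff ℝ ∞ D) (x : Plane) :
    ∃ a b : ℝ, (explicitNormalForm hA hB hC hD).curv x
      (EuclideanSpace.single 0 1) (EuclideanSpace.single 1 1) =
        !![0, a, b; 0, 0, 0; 0, 0, 0] := by
  have dB := hB.differentiable (by simp) x
  have dC := hC.differentiable (by simp) x
  -- The entries (0,1) and (0,2) are unconstrained and serve as a and b; the other seven vanish by
  -- computation.
  refine ⟨(explicitNormalForm hA hB hC hD).curv x
      (EuclideanSpace.single 0 1) (EuclideanSpace.single 1 1) 0 1,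
    (explicitNormalForm hA hB hC hD).curv x
      (EuclideanSpace.single 0 1) (EuclideanSpace.single 1 1) 0 2, ?_⟩
  ext i j
  fin_cases i <;> fin_cases j
  on_goal 2 => rfl
  on_goal 2 => rfl
  all_goals
    simp [NormalForm.curv, explicitNormalForm, explicitForm, fderiv_const_mul, dB, dC, dX, dY]
  all_goals try ring

/-! ### Graphs -/

theorem hasDerivAt_plane {f g : ℝ → ℝ} {f' g' t : ℝ} (hf : HasDerivAt f f' t)
    (hg : HasDerivAt g g' t) : HasDerivAt (fun t => (!₂[f t, g t] : Plane)) !₂[f', g'] t := by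
  rw [hasDerivAt_iff_hasFDerivAt, ← hasFDerivWithinAt_univ, hasFDerivWithinAt_euclidean]
  intro i
  rw [hasFDerivWithinAt_univ]
  fin_cases i
  · refine hf.hasFDerivAt.congr_fderiv ?_
    ext; simp
  · refine hg.hasFDerivAt.congr_fderiv ?_
    ext; simp

theorem contDiffOn_graph {y : ℝ → ℝ} {J : Set ℝ} (h : ContDiffOn ℝ ∞ y J) :
    ContDiffOn ℝ ∞ (fun t => (!₂[t, y t] : Plane)) J := by
  rw [contDiffOn_euclidean]
  intro i
  fin_cases i
  · exact contDiffOn_id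
  · exact h

theorem deriv_graph {y : ℝ → ℝ} {J : Set ℝ} (hJ : IsOpen J) (h : ContDiffOn ℝ ∞ y J) {t : ℝ}
    (ht : t ∈ J) : deriv (fun t => (!₂[t, y t] : Plane)) t = !₂[1, deriv y t] :=
  (hasDerivAt_plane (hasDerivAt_id t)
    ((h.contDiffAt (hJ.mem_nhds ht)).differentiableAt (by simp)).hasDerivAt).deriv

theorem deriv_deriv_graph {y : ℝ → ℝ} {J : Set ℝ} (hJ : IsOpen J) (h : ContDiffOn ℝ ∞ y J) {t : ℝ}
    (ht : t ∈ J) :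
    deriv (deriv (fun t => (!₂[t, y t] : Plane))) t = !₂[0, deriv (deriv y) t] := by
  have h1 : ContDiffOn ℝ ∞ (deriv y) J := ((contDiffOn_infty_iff_deriv_of_isOpen hJ).1 h).2
  have h2 : deriv (fun t => (!₂[t, y t] : Plane)) =ᶠ[nhds t] fun t => !₂[1, deriv y t] :=
    Filter.eventually_of_mem (hJ.mem_nhds ht) fun s hs => deriv_graph hJ h hs
  have h3 : HasDerivAt (deriv y) (deriv (deriv y) t) t :=
    ((h1.contDiffAt (hJ.mem_nhds ht)).differentiableAt (by simp)).hasDerivAt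
  exact ((hasDerivAt_plane (hasDerivAt_const t (1 : ℝ)) h3).congr_of_eventuallyEq h2).deriv

theorem isRegularCurve_graph {y : ℝ → ℝ} {a b : ℝ} (h : ContDiffOn ℝ ∞ y (Set.Ioo a b)) :
    IsRegularCurve (Set.Ioo a b) (fun t => !₂[t, y t]) := by
  refine ⟨isOpen_Ioo, Set.ordConnected_Ioo, contDiffOn_graph h, fun t ht h0 => ?_⟩
  rw [deriv_graph isOpen_Ioo h ht] at h0
  exact one_ne_zero (congrArg (fun v : Plane => v 0) h0)

/-! ### Geodesics of the explicit connection -/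

theorem explicit_isGeodesic_iff {A B C D : Plane → ℝ} (hA : ContDiff ℝ ∞ A)
    (hB : ContDiff ℝ ∞ B) (hC : ContDiff ℝ ∞ C) (hD : ContDiff ℝ ∞ D) {J : Set ℝ} {x : ℝ → Plane}
    (hx : IsRegularCurve J x) :
    (explicitNormalForm hA hB hC hD).connection.IsGeodesic J x ↔
      IsSolutionCurve A B C D J x := by
  set θ := explicitNormalForm hA hB hC hD
  have key : ∀ t, θ.connection.geodesicDefect
      (fun x => ((x, 1) : trivialBundle.Total)) x t = 0 ↔
      deriv x t 0 * deriv (deriv x) t 1 - deriv (deriv x) t 0 * deriv x t 1 =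
      A (x t) * deriv x t 1 ^ 3 + B (x t) * deriv x t 0 * deriv x t 1 ^ 2
        + C (x t) * deriv x t 0 ^ 2 * deriv x t 1 + D (x t) * deriv x t 0 ^ 3 := by
    intro t
    rw [← sub_eq_zero (a := deriv x t 0 * _ - _)]
    have e : θ.connection.geodesicDefect
      (fun x => ((x, 1) : trivialBundle.Total)) x t =
      deriv x t 0 * deriv (deriv x) t 1 - deriv (deriv x) t 0 * deriv x t 1 -
      (A (x t) * deriv x t 1 ^ 3 + B (x t) * deriv x t 0 * deriv x t 1 ^ 2
        + C (x t) * deriv x t 0 ^ 2 * deriv x t 1 + D (x t) * deriv x t 0 ^ 3) := by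
      unfold CartanConnection.geodesicDefect
      rw [θ.pull_unit_section]
      change _ * (_ + explicitForm A B C D (x t) (deriv x t) 2 1 * _
        + explicitForm A B C D (x t) (deriv x t) 2 2 * _)
        - _ * (_ + explicitForm A B C D (x t) (deriv x t) 1 1 * _
        + explicitForm A B C D (x t) (deriv x t) 1 2 * _) = _
      simp [explicitForm]
      ring
    rw [e]
  constructor
  · exact fun h t ht => (key t).1
      (θ.connection.geodesicDefect_eq_zero hx.1 hx.2.2.1 θ.isNormalSection h t ht)
  · exact fun h => θ.connection.isGeodesic_of_geodesicDefect_eq_zero hx θ.isNormalSection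
      fun t ht => (key t).2 (h t ht)

theorem explicit_geodesicsSatisfy {A B C D : Plane → ℝ} (hA : ContDiff ℝ ∞ A)
    (hB : ContDiff ℝ ∞ B) (hC : ContDiff ℝ ∞ C) (hD : ContDiff ℝ ∞ D) :
    (explicitNormalForm hA hB hC hD).connection.GeodesicsSatisfy A B C D := by
  intro a b y hy hg t ht
  have h := (explicit_isGeodesic_iff hA hB hC hD (isRegularCurve_graph hy)).1 hg t ht
  rw [deriv_graph isOpen_Ioo hy ht, deriv_deriv_graph isOpen_Ioo hy ht] at h
  simpa using h

theorem explicit_hasExplicitForm {A B C D : Plane → ℝ} (hA : ContDiff ℝ ∞ A)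
    (hB : ContDiff ℝ ∞ B) (hC : ContDiff ℝ ∞ C) (hD : ContDiff ℝ ∞ D) :
    (explicitNormalForm hA hB hC hD).connection.HasExplicitForm A B C D :=
  ⟨fun x => (x, 1), contMDiffOn_univ.1 (explicitNormalForm hA hB hC hD).isNormalSection.1,
    fun _ => rfl, fun x v =>
      congrArg Subtype.val ((explicitNormalForm hA hB hC hD).pull_unit_section x v)⟩

/-! ### Local solutions of second-order equations -/

theorem contDiffOn_of_hasDerivAt_comp {E : Type*} [NormedAddCommGroup E] [NormedSpace ℝ E]
    {V : E → E} (hV : ContDiff ℝ ∞ V) {J : Set ℝ} (hJ : IsOpen J) {α : ℝ → E}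
    (hα : ∀ t ∈ J, HasDerivAt α (V (α t)) t) : ContDiffOn ℝ ∞ α J := by
  have hd : DifferentiableOn ℝ α J := fun t ht =>
    (hα t ht).differentiableAt.differentiableWithinAt
  have key : ∀ n : ℕ, ContDiffOn ℝ n α J := by
    intro n
    induction n with
    | zero => exact contDiffOn_zero.2 hd.continuousOn
    | succ n ih =>
      have := (contDiffOn_succ_iff_deriv_of_isOpen (𝕜 := ℝ) (n := n) hJ).2
        ⟨hd, by simp, ((hV.of_le (by exact_mod_cast le_top)).comp_contDiffOn ih).congr
          fun t ht => (hα t ht).deriv⟩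
      exact_mod_cast this
  exact contDiffOn_infty.2 key

/-- Solve the autonomous first-order system for (t, y, y') with t' = 1; smoothness is again by
bootstrap. -/
theorem exists_graph_solution {F : Plane × ℝ → ℝ} (hF : ContDiff ℝ ∞ F) (x₀ : Plane) (k : ℝ) :
    ∃ a b : ℝ, x₀ 0 ∈ Set.Ioo a b ∧ ∃ y : ℝ → ℝ, ContDiffOn ℝ ∞ y (Set.Ioo a b) ∧
      y (x₀ 0) = x₀ 1 ∧ deriv y (x₀ 0) = k ∧
      ∀ t ∈ Set.Ioo a b, deriv (deriv y) t = F (!₂[t, y t], deriv y t) := by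
  set V : ℝ × ℝ × ℝ → ℝ × ℝ × ℝ := fun z => (1, z.2.2, F (!₂[z.1, z.2.1], z.2.2)) with hVdef
  have hpl : ContDiff ℝ ∞ (fun z : ℝ × ℝ × ℝ => (!₂[z.1, z.2.1] : Plane)) := by
    rw [contDiff_euclidean]
    intro i
    fin_cases i
    · exact contDiff_fst
    · exact contDiff_snd.fst
  have hV : ContDiff ℝ ∞ V :=
    contDiff_const.prodMk (contDiff_snd.snd.prodMk (hF.comp (hpl.prodMk contDiff_snd.snd)))
  obtain ⟨α, hα0, ε, hε, hα⟩ :=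
    (hV.contDiffAt.of_le (by simp) :
      ContDiffAt ℝ 1 V (x₀ 0, x₀ 1, k)).exists_forall_mem_closedBall_exists_eq_forall_mem_Ioo_hasDerivAt₀
      (x₀ 0)
  have hmem : x₀ 0 ∈ Set.Ioo (x₀ 0 - ε) (x₀ 0 + ε) := ⟨by linarith, by linarith⟩
  refine ⟨x₀ 0 - ε, x₀ 0 + ε, hmem, fun t => (α t).2.1, ?_, ?_, ?_, ?_⟩
  · exact (contDiffOn_of_hasDerivAt_comp hV isOpen_Ioo hα).snd.fst
  · simp only [hα0]
  all_goals
    have h1 : ∀ t ∈ Set.Ioo (x₀ 0 - ε) (x₀ 0 + ε), HasDerivAt (fun t => (α t).1) 1 t :=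
      fun t ht => (hα t ht).fst
    have h2 : ∀ t ∈ Set.Ioo (x₀ 0 - ε) (x₀ 0 + ε),
        HasDerivAt (fun t => (α t).2.1) (α t).2.2 t := fun t ht => (hα t ht).snd.fst
    have h3 : ∀ t ∈ Set.Ioo (x₀ 0 - ε) (x₀ 0 + ε), HasDerivAt (fun t => (α t).2.2)
        (F (!₂[(α t).1, (α t).2.1], (α t).2.2)) t := fun t ht => (hα t ht).snd.snd
  · rw [(h2 _ hmem).deriv, hα0]
  -- The time component has derivative 1 and the right initial value, so it is the parameter itself
  -- and the solution is a graph over x.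
  · have h4 : ∀ t ∈ Set.Ioo (x₀ 0 - ε) (x₀ 0 + ε), (α t).1 = t := by
      intro t ht
      have := (convex_Ioo _ _).is_const_of_fderivWithin_eq_zero (𝕜 := ℝ)
        (f := fun t => (α t).1 - t) (s := Set.Ioo (x₀ 0 - ε) (x₀ 0 + ε))
        (fun s hs => (((h1 s hs).sub (hasDerivAt_id s)).differentiableAt).differentiableWithinAt)
        (fun s hs => by
          rw [fderivWithin_of_isOpen isOpen_Ioo hs]
          have := ((h1 s hs).sub (hasDerivAt_id s)).hasFDerivAt.fderiv
          refine Eq.trans ?_ (this.trans ?_)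
          · rfl
          · ext; simp) ht hmem
      simp only [hα0] at this
      linarith
    intro t ht
    have h5 : deriv (fun t => (α t).2.1) =ᶠ[nhds t] fun t => (α t).2.2 :=
      Filter.eventually_of_mem (isOpen_Ioo.mem_nhds ht) fun s hs => (h2 s hs).deriv
    rw [h5.deriv_eq, (h3 t ht).deriv, h5.eq_of_nhds, h4 t ht]

/-! ### A form is determined by its geodesics and its curvature -/

section

variable {Q : PrincipalBundle.{u}}

/-- The pull-back of the connection form by a global section in normal position. -/
noncomputable def CartanConnection.IsNormalSection.normalForm {η : CartanConnection Q}
    {s : Plane → Q.Total} (hs : η.IsNormalSection Set.univ s) : NormalForm where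
  toFun := η.pull s
  smooth v i j := contDiffOn_univ.1
    (η.contDiffOn_pull isOpen_univ hs.contMDiffOn (V := fun _ => v) contDiffOn_const i j)
  zero_zero x := hs.zero_zero x (Set.mem_univ _)
  one_zero x := hs.one_zero x (Set.mem_univ _)
  two_zero x := hs.two_zero x (Set.mem_univ _)

/-- The right-hand side of the equation of the geodesics. -/
noncomputable def NormalForm.spray (θ : NormalForm) (x : Plane) (k : ℝ) : ℝ :=
  -(θ.toFun x !₂[1, k] : Mat3) 2 1 - (θ.toFun x !₂[1, k] : Mat3) 2 2 * k
    + k * (θ.toFun x !₂[1, k] : Mat3) 1 1 + k ^ 2 * (θ.toFun x !₂[1, k] : Mat3) 1 2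

theorem NormalForm.contDiff_spray (θ : NormalForm) :
    ContDiff ℝ ∞ (fun z : Plane × ℝ => θ.spray z.1 z.2) := by
  have h : ∀ i j, ContDiff ℝ ∞ fun z : Plane × ℝ => (θ.toFun z.1 !₂[1, z.2] : Mat3) i j := by
    intro i j
    have h1 := (θ.smooth (EuclideanSpace.single 0 1) i j).comp (contDiff_fst (E := Plane) (F := ℝ))
    have h2 := (θ.smooth (EuclideanSpace.single 1 1) i j).comp (contDiff_fst (E := Plane) (F := ℝ))
    convert h1.add (contDiff_snd.mul h2) using 1
    funext z
    rw [θ.apply_entry]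
    simp
  exact (((h 2 1).neg.sub ((h 2 2).mul contDiff_snd)).add (contDiff_snd.mul (h 1 1))).add
    ((contDiff_snd.pow 2).mul (h 1 2))

/-- Through every point, with every slope k, there is a solution of y'' = spray. It is a geodesic,
hence satisfies the given equation too; comparing the two values of y'' at the initial point gives
the identity. -/
theorem CartanConnection.spray_eq_of_geodesicsSatisfy {A B C D : Plane → ℝ}
    {η : CartanConnection Q} (hη : η.GeodesicsSatisfy A B C D) {s : Plane → Q.Total}
    (hs : η.IsNormalSection Set.univ s) (x : Plane) (k : ℝ) :
    hs.normalForm.spray x k = A x * k ^ 3 + B x * k ^ 2 + C x * k + D x := by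
  obtain ⟨a, b, hm, y, hy, hy0, hy1, hode⟩ :=
    exists_graph_solution hs.normalForm.contDiff_spray x k
  have hg : η.IsGeodesic (Set.Ioo a b) (fun t => !₂[t, y t]) := by
    refine η.isGeodesic_of_geodesicDefect_eq_zero (isRegularCurve_graph hy) hs fun t ht => ?_
    unfold CartanConnection.geodesicDefect
    rw [deriv_graph isOpen_Ioo hy ht, deriv_deriv_graph isOpen_Ioo hy ht]
    have := hode t ht
    simp only [NormalForm.spray, CartanConnection.IsNormalSection.normalForm] at this
    simp only [Matrix.cons_val_zero, Matrix.cons_val_one]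
    rw [this]
    ring
  have h1 := hη a b y hy hg _ hm
  have h2 := hode _ hm
  have hx : (!₂[x 0, x 1] : Plane) = x := by ext i; fin_cases i <;> rfl
  rw [hy0, hy1, hx] at h1 h2
  rw [← h2, h1]

/-- In a normal section the coordinate vectors are sent by ω to e₁ and e₂ modulo the subalgebra. The
value of the structure function on e₁ ∧ e₂ is therefore the curvature of the pulled-back form on
these vectors. -/
theorem CartanConnection.curv_of_structureFunctionInW {η : CartanConnection Q}
    (hη : η.StructureFunctionInW) {s : Plane → Q.Total}
    (hs : η.IsNormalSection Set.univ s) (x : Plane) :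
    ∃ a b : ℝ, hs.normalForm.curv x (EuclideanSpace.single 0 1) (EuclideanSpace.single 1 1) =
        !![0, a, b; 0, 0, 0; 0, 0, 0] := by
  obtain ⟨c, hc, hW⟩ := hη
  obtain ⟨a, b, hab⟩ := hW (s x)
  refine ⟨a, b, ?_⟩
  have hmk : ∀ (u : Plane) (i : Fin 3) (hi : i ≠ 0), u 0 = (colElt i hi : Mat3) 1 0 →
      u 1 = (colElt i hi : Mat3) 2 0 → stabAlg.mkQ (η.pull s x u) = stabAlg.mkQ (colElt i hi) := by
    intro u i hi h1 h2
    rw [Submodule.mkQ_apply, Submodule.mkQ_apply, Submodule.Quotient.eq]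
    constructor
    · rw [Submodule.coe_sub, Matrix.sub_apply, hs.one_zero x (Set.mem_univ _), h1, sub_self]
    · rw [Submodule.coe_sub, Matrix.sub_apply, hs.two_zero x (Set.mem_univ _), h2, sub_self]
  have h := hc (s x) (η.pull s x (EuclideanSpace.single 0 1))
    (η.pull s x (EuclideanSpace.single 1 1))
  rw [hmk (EuclideanSpace.single 0 1) 1 (by simp) (by simp [colElt]) (by simp [colElt]),
    hmk (EuclideanSpace.single 1 1) 2 (by simp) (by simp [colElt]) (by simp [colElt]), hab] at h
  rw [h]
  ext i j
  rw [η.curvature_star isOpen_univ hs.contMDiffOn (Set.mem_univ x)]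
  have hd : ∀ u v, fderiv ℝ (η.pullEntry s i j) x u v =
      fderiv ℝ (fun x => (η.pull s x v : Mat3) i j) x u := by
    intro u v
    have hd : DifferentiableAt ℝ (η.pullEntry s i j) x :=
      (contDiffOn_univ.1 (η.contDiffOn_pullEntry isOpen_univ hs.contMDiffOn i j)).differentiable
        (by simp) x
    have h2 := hd.hasFDerivAt.clm_apply (hasFDerivAt_const v x)
    have h3 := h2.fderiv
    refine (((congrArg (fun L => L u) h3).trans ?_)).symm
    simp
  rw [hd, hd]
  rfl

end

/-- Write θ = X dx + Y dy. The curvature entries (1,0) and (2,0), the zero traces and the four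
coefficients of the cubic determine the lower blocks of X and Y linearly; the remaining curvature
entries then determine the first rows. -/
theorem NormalForm.eq_explicitForm (θ : NormalForm) {A B C D : Plane → ℝ}
    (hspray : ∀ x k, θ.spray x k = A x * k ^ 3 + B x * k ^ 2 + C x * k + D x)
    (hcurv : ∀ x, ∃ a b : ℝ,
      θ.curv x (EuclideanSpace.single 0 1) (EuclideanSpace.single 1 1) =
        !![0, a, b; 0, 0, 0; 0, 0, 0]) (x v : Plane) :
    (θ.toFun x v : Mat3) = explicitForm A B C D x v := by
  set X : Plane → Mat3 := fun x => (θ.toFun x (EuclideanSpace.single 0 1) : Mat3) with hX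
  set Y : Plane → Mat3 := fun x => (θ.toFun x (EuclideanSpace.single 1 1) : Mat3) with hY
  have hX00 : ∀ x, X x 0 0 = 0 := fun x => θ.zero_zero x _
  have hY00 : ∀ x, Y x 0 0 = 0 := fun x => θ.zero_zero x _
  have hX10 : ∀ x, X x 1 0 = 1 := fun x => (θ.one_zero x _).trans (by simp)
  have hY10 : ∀ x, Y x 1 0 = 0 := fun x => (θ.one_zero x _).trans (by simp)
  have hX20 : ∀ x, X x 2 0 = 0 := fun x => (θ.two_zero x _).trans (by simp)
  have hY20 : ∀ x, Y x 2 0 = 1 := fun x => (θ.two_zero x _).trans (by simp)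
  have hXt : ∀ x, X x 0 0 + X x 1 1 + X x 2 2 = 0 := fun x => CartanConnection.sl3_trace_eq _
  have hYt : ∀ x, Y x 0 0 + Y x 1 1 + Y x 2 2 = 0 := fun x => CartanConnection.sl3_trace_eq _
  have hK : ∀ x i j, θ.curv x (EuclideanSpace.single 0 1) (EuclideanSpace.single 1 1) i j =
      dX (fun x => Y x i j) x - dY (fun x => X x i j) x
      + ((X x i 0 * Y x 0 j + X x i 1 * Y x 1 j + X x i 2 * Y x 2 j)
        - (Y x i 0 * X x 0 j + Y x i 1 * X x 1 j + Y x i 2 * X x 2 j)) := by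
    intro x i j
    simp only [NormalForm.curv, Matrix.add_apply, Matrix.sub_apply, Matrix.of_apply,
      Matrix.mul_apply, Fin.sum_univ_three]
    rfl
  have hc : ∀ (c : ℝ) x, dX (fun _ => c) x = 0 ∧ dY (fun _ => c) x = 0 := fun c x => by
    simp [dX, dY]
  have hK0 : ∀ x i j, (i ≠ 0 ∨ j = 0) → dX (fun x => Y x i j) x - dY (fun x => X x i j) x
      + ((X x i 0 * Y x 0 j + X x i 1 * Y x 1 j + X x i 2 * Y x 2 j)
        - (Y x i 0 * X x 0 j + Y x i 1 * X x 1 j + Y x i 2 * X x 2 j)) = 0 := by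
    intro x i j hij
    rw [← hK]
    obtain ⟨a, b, hab⟩ := hcurv x
    rw [hab]
    fin_cases i <;> fin_cases j <;> simp at hij ⊢
  have hS : ∀ x k, -X x 2 1 - k * Y x 2 1 - k * X x 2 2 - k ^ 2 * Y x 2 2 + k * X x 1 1
      + k ^ 2 * Y x 1 1 + k ^ 2 * X x 1 2 + k ^ 3 * Y x 1 2 =
      A x * k ^ 3 + B x * k ^ 2 + C x * k + D x := by
    intro x k
    rw [← hspray, NormalForm.spray]
    simp only [θ.apply_entry x !₂[1, k], Matrix.cons_val_zero,
      Matrix.cons_val_one]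
    ring
  have hT1 : ∀ x, X x 1 2 = Y x 1 1 := by
    intro x
    have := hK0 x 1 0 (by simp)
    simp only [hX10, hY10, hX20, hY20, hX00, hY00, hc] at this
    linarith
  have hT2 : ∀ x, X x 2 2 = Y x 2 1 := by
    intro x
    have := hK0 x 2 0 (by simp)
    simp only [hX10, hY10, hX20, hY20, hX00, hY00, hc] at this
    linarith
  -- Two cubics in k agree for all k; the slopes 0, 1, -1 and 2 suffice to compare their
  -- coefficients.
  have hX21 : ∀ x, X x 2 1 = -D x := fun x => by linarith [hS x 0]
  have hX11 : ∀ x, X x 1 1 = 1 / 3 * C x := fun x => by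
    linarith [hS x 0, hS x 1, hS x (-1), hS x 2, hT1 x, hT2 x, hXt x, hYt x, hX00 x, hY00 x]
  have hX22 : ∀ x, X x 2 2 = -(1 / 3 * C x) := fun x => by
    linarith [hX11 x, hXt x, hX00 x]
  have hY21 : ∀ x, Y x 2 1 = -(1 / 3 * C x) := fun x => by
    linarith [hX22 x, hT2 x]
  have hY11 : ∀ x, Y x 1 1 = 1 / 3 * B x := fun x => by
    linarith [hS x 0, hS x 1, hS x (-1), hT1 x, hYt x, hY00 x]
  have hX12 : ∀ x, X x 1 2 = 1 / 3 * B x := fun x => by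
    linarith [hY11 x, hT1 x]
  have hY22 : ∀ x, Y x 2 2 = -(1 / 3 * B x) := fun x => by
    linarith [hY11 x, hYt x, hY00 x]
  have hY12 : ∀ x, Y x 1 2 = A x := fun x => by
    linarith [hS x 0, hS x 1, hS x (-1), hS x 2, hT1 x, hT2 x, hXt x, hYt x, hX00 x, hY00 x]
  have hmul : ∀ (c : ℝ) (f : Plane → ℝ) x, dX (fun x => c * f x) x = c * dX f x ∧
      dY (fun x => c * f x) x = c * dY f x := by
    intro c f x
    have h' : fderiv ℝ (fun x => c * f x) x = c • fderiv ℝ f x :=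
      congrFun (fderiv_const_smul_field (𝕜 := ℝ) (f := f) c) x
    simp [dX, dY, h']
  have hneg : ∀ (f : Plane → ℝ) x, dX (fun x => -f x) x = -dX f x ∧
      dY (fun x => -f x) x = -dY f x := by
    intro f x
    simp [dX, dY, fderiv_fun_neg]
  -- With the blocks known, the entries (0,0), (1,1), (2,1) and (1,2) of the curvature are linear
  -- equations for the first rows. The entry (2,2) adds nothing, as the curvature is trace-free.
  have hX02 : X x 0 2 = Y x 0 1 := by
    have := hK0 x 0 0 (by simp)
    simp only [hX10, hY10, hX20, hY20, hX00, hY00, hc] at this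
    linarith
  have hY01 : Y x 0 1 = 1 / 3 * dY C x - 1 / 3 * dX B x + 1 / 9 * B x * C x - A x * D x := by
    have := hK0 x 1 1 (by simp)
    simp only [hX10, hY10, hX11, hX12, hX21, hY11, hY12, hY21, hmul] at this
    linarith
  have hX01 : X x 0 1 = dY D x - 1 / 3 * dX C x - 2 / 3 * B x * D x + 2 / 9 * C x ^ 2 := by
    have := hK0 x 2 1 (by simp)
    simp only [hX20, hY20, hX11, hX21, hX22, hY11, hY21, hY22, hmul, hneg] at this
    linarith
  have hY02 : Y x 0 2 = 1 / 3 * dY B x - dX A x + 2 / 9 * B x ^ 2 - 2 / 3 * A x * C x := by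
    have := hK0 x 1 2 (by simp)
    simp only [hX10, hY10, hX11, hX12, hX22, hY11, hY12, hY22, hmul] at this
    linarith
  ext i j
  rw [θ.apply_entry]
  change v 0 * X x i j + v 1 * Y x i j = _
  fin_cases i <;> fin_cases j <;>
    simp [explicitForm, hX00, hY00, hX10, hY10, hX20, hY20, hX11, hX12, hX21, hX22, hY11, hY12,
      hY21, hY22, hX01, hX02, hY01, hY02] <;> ring

/-! ### Connections with the same normal form are isomorphic -/

/-- The isomorphism is (x, g) ↦ s(x)g, with inverse given by the trivialization that s defines. It
respects the forms because the gauge formula for s(x)g is the definition of the connection on the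
trivial bundle. -/
theorem NormalForm.isomorphic (θ : NormalForm) {Q : PrincipalBundle.{u}} {η : CartanConnection Q}
    {s : Plane → Q.Total} (hs : η.IsNormalSection Set.univ s)
    (h : ∀ x v, η.pull s x v = θ.toFun x v) : Isomorphic θ.connection η := by
  have hsm : ContMDiff 𝓘(ℝ, Plane) Q.I ∞ s := contMDiffOn_univ.1 hs.contMDiffOn
  have hsec : ∀ x, Q.proj (s x) = x := fun x => hs.proj_eq x (Set.mem_univ _)
  obtain ⟨τ, hτ, hact⟩ := Q.exists_trivialization isOpen_univ hs.contMDiffOn (fun x _ => hsec x)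
  have hτm : ContMDiff Q.I 𝓘(ℝ, GModel) ∞ τ := by
    rw [Set.preimage_univ] at hτ
    exact contMDiffOn_univ.1 hτ
  have hproj : ∀ p : Plane × stabGroup, Q.proj (Q.act (s p.1) p.2) = p.1 := fun p => by
    rw [Q.proj_act, hsec]
  have hσ : ContMDiff trivI Q.I ∞ (fun p : Plane × stabGroup => s p.1) :=
    hsm.comp contMDiff_trivI_fst
  refine ⟨⟨⟨fun p : Plane × stabGroup => Q.act (s p.1) p.2, fun q => (Q.proj q, τ q), ?_, ?_⟩,
    ?_, ?_⟩, ?_, ?_, ?_⟩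
  · rintro (p : Plane × stabGroup)
    refine Prod.ext (hproj p) (Q.act_left_injective (s p.1) ?_)
    have := hact (Q.act (s p.1) p.2) (Set.mem_univ _)
    rwa [hproj] at this
  · exact fun q => hact q (Set.mem_univ _)
  · exact Q.contMDiff_act.comp (hσ.prodMk contMDiff_trivI_snd)
  · exact fun q => contMDiffWithinAt_trivI_prodMk (Q.contMDiff_proj q) (hτm q)
  · exact hproj
  · rintro (p : Plane × stabGroup) g
    exact Q.act_mul (s p.1) p.2 g
  · rintro (p : Plane × stabGroup) v
    apply Subtype.ext
    refine (form_mfderiv_act η (σ := fun p : Plane × stabGroup => s p.1) (γ := Prod.snd)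
      (hσ.mdifferentiable (by simp) p) (mdifferentiable_trivI_snd p) v).trans ?_
    refine Eq.trans ?_ (θ.extend_apply p v).symm
    have e : η.form (s p.1) (mfderiv trivI Q.I (fun p : Plane × stabGroup => s p.1) p v) =
        θ.toFun p.1 (mfderiv trivI 𝓘(ℝ, Plane) Prod.fst p v) :=
      (congrArg (η.form (s p.1)) (mfderiv_comp_apply p
        (hsm.mdifferentiable (by simp) p.1) (mdifferentiable_trivI_fst p) v)).trans (h p.1 _)
    exact congrArg (fun Z : sl3 => mat p.2⁻¹ * (Z : Mat3) * mat p.2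
      + mat p.2⁻¹ * dMat trivI Prod.snd p v) e

/-! ### Sections in normal position -/

/-- A smooth real cube root of `1 / z`. -/
noncomputable def cbrtInv (z : ℝ) : ℝ := z * (z ^ 2) ^ (-(2 / 3) : ℝ)

theorem cbrtInv_pow {z : ℝ} (hz : z ≠ 0) : cbrtInv z ^ 3 * z = 1 := by
  have h0 : (0 : ℝ) < z ^ 2 := by positivity
  have h : ((z ^ 2) ^ (-(2 / 3) : ℝ)) ^ 3 = ((z ^ 2) ^ 2)⁻¹ := by
    rw [← Real.rpow_natCast, ← Real.rpow_mul h0.le, ← Real.rpow_natCast (z ^ 2) 2,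
      ← Real.rpow_neg h0.le]
    norm_num
  rw [cbrtInv, mul_pow, h]
  field_simp

theorem contDiffOn_cbrtInv : ContDiffOn ℝ ∞ cbrtInv {z | z ≠ 0} := by
  intro z hz
  refine ContDiffAt.contDiffWithinAt ?_
  exact contDiffAt_id.mul ((contDiffAt_id.pow 2).rpow_const_of_ne (pow_ne_zero 2 hz))

namespace CartanConnection

variable {Q : PrincipalBundle.{u}} (η : CartanConnection Q)

theorem eq_zero_of_pull_mem_stabAlg {U : Set Plane} (hU : IsOpen U) {s : Plane → Q.Total}
    (hs : ContMDiffOn 𝓘(ℝ, Plane) Q.I ∞ s U) (hsec : ∀ x ∈ U, Q.proj (s x) = x) {x : Plane}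
    (hx : x ∈ U) {v : Plane} (h : η.pull s x v ∈ stabAlg) : v = 0 := by
  have h1 := η.mfderiv_proj_eq_zero h
  have h2 := mfderiv_comp_apply x ((Q.contMDiff_proj.mdifferentiable (by simp)) (s x))
    ((hs.contMDiffAt (hU.mem_nhds hx)).mdifferentiableAt (by simp)) v
  have h3 : Q.proj ∘ s =ᶠ[nhds x] id := Filter.eventually_of_mem (hU.mem_nhds hx) hsec
  rw [h3.mfderiv_eq, mfderiv_id] at h2
  exact h2.trans h1

theorem mat_mul_pull_act {s : Plane → Q.Total} {γ : Plane → stabGroup} {x : Plane}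
    (hs : MDifferentiableAt 𝓘(ℝ, Plane) Q.I s x)
    (hγ : MDifferentiableAt 𝓘(ℝ, Plane) 𝓘(ℝ, GModel) γ x) (v : Plane) :
    mat (γ x) * (η.pull (fun x => Q.act (s x) (γ x)) x v : Mat3) =
      (η.pull s x v : Mat3) * mat (γ x) + dMat 𝓘(ℝ, Plane) γ x v := by
  have h : (η.pull (fun x => Q.act (s x) (γ x)) x v : Mat3) =
      mat (γ x)⁻¹ * (η.pull s x v : Mat3) * mat (γ x) + mat (γ x)⁻¹ * dMat 𝓘(ℝ, Plane) γ x v :=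
    form_mfderiv_act η hs hγ v
  rw [h, mul_add, mul_assoc, mat_inv_mul_cancel_left, mat_inv_mul_cancel_left]

theorem pull_apply_entry (s : Plane → Q.Total) (x v : Plane) (i j : Fin 3) :
    (η.pull s x v : Mat3) i j = v 0 * (η.pull s x (EuclideanSpace.single 0 1) : Mat3) i j
      + v 1 * (η.pull s x (EuclideanSpace.single 1 1) : Mat3) i j := by
  conv_lhs => rw [plane_eq v]
  rw [map_add, map_smul, map_smul]
  rfl

/-- The determinant of the isomorphism of the tangent plane with `sl(3, ℝ)` modulo the subalgebra
of `G` that is given by a section. -/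
noncomputable def solderDet (s : Plane → Q.Total) (x : Plane) : ℝ :=
  (η.pull s x (EuclideanSpace.single 0 1) : Mat3) 1 0
      * (η.pull s x (EuclideanSpace.single 1 1) : Mat3) 2 0
    - (η.pull s x (EuclideanSpace.single 1 1) : Mat3) 1 0
      * (η.pull s x (EuclideanSpace.single 0 1) : Mat3) 2 0

/-- A vector in the kernel would be sent by the section to a vertical tangent vector, which is
impossible for a section. -/
theorem solderDet_ne_zero {U : Set Plane} (hU : IsOpen U) {s : Plane → Q.Total}
    (hs : ContMDiffOn 𝓘(ℝ, Plane) Q.I ∞ s U) (hsec : ∀ x ∈ U, Q.proj (s x) = x) {x : Plane}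
    (hx : x ∈ U) : η.solderDet s x ≠ 0 := by
  intro h0
  set T : Matrix (Fin 2) (Fin 2) ℝ := !![(η.pull s x (EuclideanSpace.single 0 1) : Mat3) 1 0,
    (η.pull s x (EuclideanSpace.single 1 1) : Mat3) 1 0;
    (η.pull s x (EuclideanSpace.single 0 1) : Mat3) 2 0,
    (η.pull s x (EuclideanSpace.single 1 1) : Mat3) 2 0] with hT
  have hd : T.det = 0 := (Matrix.det_fin_two _).trans h0
  obtain ⟨v, hv, hTv⟩ := Matrix.exists_mulVec_eq_zero_iff.2 hd
  refine hv ?_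
  have h1 := congrFun hTv 0
  have h2 := congrFun hTv 1
  simp [hT, Matrix.mulVec, dotProduct] at h1 h2
  have h3 := η.eq_zero_of_pull_mem_stabAlg hU hs hsec hx (v := !₂[v 0, v 1]) (by
    constructor
    · rw [η.pull_apply_entry]
      simp; linarith
    · rw [η.pull_apply_entry]
      simp; linarith)
  funext i
  fin_cases i
  · exact congrArg (fun v : Plane => v 0) h3
  · exact congrArg (fun v : Plane => v 1) h3

theorem contMDiffOn_act {U : Set Plane} {s : Plane → Q.Total} {γ : Plane → stabGroup}
    (hs : ContMDiffOn 𝓘(ℝ, Plane) Q.I ∞ s U)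
    (hγ : ContMDiffOn 𝓘(ℝ, Plane) 𝓘(ℝ, GModel) ∞ γ U) :
    ContMDiffOn 𝓘(ℝ, Plane) Q.I ∞ (fun x => Q.act (s x) (γ x)) U :=
  Q.contMDiff_act.comp_contMDiffOn (hs.prodMk hγ)

theorem dMat_plane (γ : Plane → stabGroup) (x v : Plane) (i j : Fin 3) :
    dMat 𝓘(ℝ, Plane) γ x v i j = fderiv ℝ (fun x => mat (γ x) i j) x v := by
  change mfderiv 𝓘(ℝ, Plane) 𝓘(ℝ, ℝ) _ x v = _
  rw [mfderiv_eq_fderiv]; rfl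

/-- For r = sγ to be normal, the first column of γR = Pγ + dγ must hold with (0, dx, dy) as first
column of R. This expresses the last two columns of γ through δ = γ₀₀, the first column of P and dδ,
and det γ = 1 becomes δ³d = 1 with d the solder determinant. -/
theorem exists_isNormalSection_near {U : Set Plane} (hU : IsOpen U) {s : Plane → Q.Total}
    (hs : ContMDiffOn 𝓘(ℝ, Plane) Q.I ∞ s U) (hsec : ∀ x ∈ U, Q.proj (s x) = x) :
    ∃ r, η.IsNormalSection U r := by
  set P : Fin 2 → Plane → Mat3 := fun j x => (η.pull s x (EuclideanSpace.single j 1) : Mat3)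
    with hP
  have hPs : ∀ j i k, ContDiffOn ℝ ∞ (fun x => P j x i k) U := fun j i k =>
    η.contDiffOn_pull hU hs (V := fun _ => EuclideanSpace.single j 1) contDiffOn_const i k
  set d : Plane → ℝ := η.solderDet s with hd
  have hds : ContDiffOn ℝ ∞ d U :=
    ((hPs 0 1 0).mul (hPs 1 2 0)).sub ((hPs 1 1 0).mul (hPs 0 2 0))
  have hd0 : ∀ x ∈ U, d x ≠ 0 := fun x hx => η.solderDet_ne_zero hU hs hsec hx
  set δ : Plane → ℝ := fun x => cbrtInv (d x) with hδ
  have hδs : ContDiffOn ℝ ∞ δ U := contDiffOn_cbrtInv.comp hds hd0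
  have hδ3 : ∀ x ∈ U, δ x ^ 3 * d x = 1 := fun x hx => cbrtInv_pow (hd0 x hx)
  have hδ0 : ∀ x ∈ U, δ x ≠ 0 := fun x hx h => by
    have := hδ3 x hx
    rw [h] at this; simp at this
  -- The first row of γ, forced by the vanishing of the corner entry; it contains the derivative of
  -- δ.
  set b : Fin 2 → Plane → ℝ := fun j x =>
    δ x * P j x 0 0 + fderiv ℝ δ x (EuclideanSpace.single j 1) with hb
  have hbs : ∀ j, ContDiffOn ℝ ∞ (b j) U := fun j =>
    (hδs.mul (hPs j 0 0)).add
      ((hδs.fderiv_of_isOpen hU (by simp)).clm_apply contDiffOn_const)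
  set m : Plane → GModel := fun x => ![fun j => b j x, fun j => δ x * P j x 1 0,
    fun j => δ x * P j x 2 0] with hm
  have hms : ContDiffOn ℝ ∞ m U := by
    rw [contDiffOn_pi]
    intro i
    rw [contDiffOn_pi]
    intro j
    fin_cases i
    · exact hbs j
    · exact hδs.mul (hPs j 1 0)
    · exact hδs.mul (hPs j 2 0)
  have hmd : ∀ x, blockDet (m x) = δ x ^ 2 * d x := fun x => by
    change δ x * P 0 x 1 0 * (δ x * P 1 x 2 0) - δ x * P 1 x 1 0 * (δ x * P 0 x 2 0) =
      δ x ^ 2 * (P 0 x 1 0 * P 1 x 2 0 - P 1 x 1 0 * P 0 x 2 0)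
    ring
  have hmd0 : ∀ x ∈ U, blockDet (m x) ≠ 0 := fun x hx => by
    rw [hmd]; exact mul_ne_zero (pow_ne_zero 2 (hδ0 x hx)) (hd0 x hx)
  set γ : Plane → stabGroup := fun x => gInv (m x) with hγ
  have hγs : ContMDiffOn 𝓘(ℝ, Plane) 𝓘(ℝ, GModel) ∞ γ U :=
    contMDiffOn_gInv.comp hms.contMDiffOn hmd0
  have hγm : ∀ x ∈ U, ∀ i (j : Fin 2), mat (γ x) i j.succ = m x i j := fun x hx i j =>
    congrFun (congrFun (gCoord_gInv (hmd0 x hx)) i) j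
  have hγ00 : ∀ x ∈ U, mat (γ x) 0 0 = δ x := fun x hx => by
    have h := stabGroup_det (γ x)
    rw [gCoord_gInv (hmd0 x hx), hmd] at h
    have h' : mat (γ x) 0 0 * (δ x ^ 2 * d x) = 1 := h
    have h3 := hδ3 x hx
    have : (mat (γ x) 0 0 - δ x) * (δ x ^ 2 * d x) = 0 := by linear_combination h' - h3
    rcases mul_eq_zero.1 this with h | h
    · linarith
    · exact absurd h (mul_ne_zero (pow_ne_zero 2 (hδ0 x hx)) (hd0 x hx))
  have key : ∀ x ∈ U, ∀ v : Plane, ∀ i,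
      (η.pull (fun x => Q.act (s x) (γ x)) x v : Mat3) i 0 = ![0, v 0, v 1] i := by
    intro x hx v
    have hn := hU.mem_nhds hx
    have h1 := η.mat_mul_pull_act ((hs.contMDiffAt hn).mdifferentiableAt (by simp))
      ((hγs.contMDiffAt hn).mdifferentiableAt (by simp)) v
    set R : Mat3 := (η.pull (fun x => Q.act (s x) (γ x)) x v : Mat3)
    have hf : fderiv ℝ (fun x => mat (γ x) 0 0) x = fderiv ℝ δ x :=
      Filter.EventuallyEq.fderiv_eq (Filter.eventually_of_mem hn hγ00)
    have hfv : fderiv ℝ δ x v = v 0 * fderiv ℝ δ x (EuclideanSpace.single 0 1)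
        + v 1 * fderiv ℝ δ x (EuclideanSpace.single 1 1) := fderiv_eq_dX_dY δ x v
    have e0 := congrFun (congrFun h1 0) 0
    have e1 := congrFun (congrFun h1 1) 0
    have e2 := congrFun (congrFun h1 2) 0
    have m01 : mat (γ x) 0 1 = b 0 x := hγm x hx 0 0
    have m02 : mat (γ x) 0 2 = b 1 x := hγm x hx 0 1
    have m11 : mat (γ x) 1 1 = δ x * P 0 x 1 0 := hγm x hx 1 0
    have m12 : mat (γ x) 1 2 = δ x * P 1 x 1 0 := hγm x hx 1 1
    have m21 : mat (γ x) 2 1 = δ x * P 0 x 2 0 := hγm x hx 2 0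
    have m22 : mat (γ x) 2 2 = δ x * P 1 x 2 0 := hγm x hx 2 1
    simp only [Matrix.add_apply, Matrix.mul_apply, Fin.sum_univ_three, dMat_plane,
      mat_one_zero, mat_two_zero, hγ00 x hx, hf, hfv, m01, m02, m11, m12, m21, m22,
      η.pull_apply_entry s x v] at e0 e1 e2
    simp only [fderiv_fun_const, Pi.zero_apply, zero_apply] at e1 e2
    change _ = (v 0 * P 0 x 0 0 + v 1 * P 1 x 0 0) * _ + _ * _ + _ * _ + _ at e0
    change _ = (v 0 * P 0 x 1 0 + v 1 * P 1 x 1 0) * _ + _ * _ + _ * _ + _ at e1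
    change _ = (v 0 * P 0 x 2 0 + v 1 * P 1 x 2 0) * _ + _ * _ + _ * _ + _ at e2
    have hdx : d x = P 0 x 1 0 * P 1 x 2 0 - P 1 x 1 0 * P 0 x 2 0 := rfl
    -- The rows below the corner form a linear system for the two lower entries of the first column
    -- of R; it is solved by Cramer's rule, after which the corner equation gives zero.
    have hD : δ x * d x ≠ 0 := mul_ne_zero (hδ0 x hx) (hd0 x hx)
    have r1 : R 1 0 = v 0 := by
      refine mul_left_cancel₀ hD ?_
      rw [hdx]
      linear_combination P 1 x 2 0 * e1 - P 1 x 1 0 * e2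
    have r2 : R 2 0 = v 1 := by
      refine mul_left_cancel₀ hD ?_
      rw [hdx]
      linear_combination P 0 x 1 0 * e2 - P 0 x 2 0 * e1
    have r0 : R 0 0 = 0 := by
      refine (mul_eq_zero.1 (?_ : δ x * R 0 0 = 0)).resolve_left (hδ0 x hx)
      rw [r1, r2] at e0
      simp only [hb] at e0
      linear_combination e0
    intro i
    fin_cases i
    · exact r0
    · exact r1
    · exact r2
  exact ⟨fun x => Q.act (s x) (γ x), contMDiffOn_act hs hγs,
    fun x hx => by rw [Q.proj_act, hsec x hx],
    fun x hx v => key x hx v 0, fun x hx v => key x hx v 1, fun x hx v => key x hx v 2⟩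

theorem IsNormalSection.mono {η : CartanConnection Q} {U V : Set Plane} {s : Plane → Q.Total}
    (hs : η.IsNormalSection U s) (h : V ⊆ U) : η.IsNormalSection V s :=
  ⟨hs.contMDiffOn.mono h, fun x hx => hs.proj_eq x (h hx), fun x hx => hs.zero_zero x (h hx),
    fun x hx => hs.one_zero x (h hx), fun x hx => hs.two_zero x (h hx)⟩

/-- For two normal sections related by γ, the first column of the gauge formula makes the lower
block of γ equal to γ₀₀ times the identity. Hence γ₀₀³ = 1, so γ₀₀ = 1 over ℝ, and the rest of the
first row, being the differential of γ₀₀, vanishes. -/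
theorem IsNormalSection.eqOn {η : CartanConnection Q} {U : Set Plane} (hU : IsOpen U)
    {s r : Plane → Q.Total} (hs : η.IsNormalSection U s) (hr : η.IsNormalSection U r) :
    Set.EqOn r s U := by
  obtain ⟨τ, hτ, hact⟩ := Q.exists_trivialization hU hs.contMDiffOn hs.proj_eq
  set γ : Plane → stabGroup := fun x => τ (r x) with hγ
  have hγs : ContMDiffOn 𝓘(ℝ, Plane) 𝓘(ℝ, GModel) ∞ γ U :=
    hτ.comp hr.contMDiffOn fun x hx => by
      change Q.proj (r x) ∈ U
      rw [hr.proj_eq x hx]; exact hx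
  have hrs : ∀ x ∈ U, r x = Q.act (s x) (γ x) := fun x hx => by
    have := hact (r x) (by rw [hr.proj_eq x hx]; exact hx)
    rw [hr.proj_eq x hx] at this
    exact this.symm
  have hcol : ∀ x ∈ U, ∀ (v : Plane) (i : Fin 3), mat (γ x) i 1 * v 0 + mat (γ x) i 2 * v 1 =
      ![0, v 0, v 1] i * mat (γ x) 0 0 + fderiv ℝ (fun x => mat (γ x) i 0) x v := by
    intro x hx v i
    have hn := hU.mem_nhds hx
    have h1 := η.mat_mul_pull_act ((hs.contMDiffOn.contMDiffAt hn).mdifferentiableAt (by simp))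
      ((hγs.contMDiffAt hn).mdifferentiableAt (by simp)) v
    have h2 : η.pull (fun x => Q.act (s x) (γ x)) x v = η.pull r x v :=
      LinearMap.congr_fun
        (η.pull_congr (Filter.eventually_of_mem hn fun y hy => (hrs y hy).symm)) v
    have h3 := congrFun (congrFun h1 i) 0
    rw [h2] at h3
    simp only [Matrix.add_apply, Matrix.mul_apply, Fin.sum_univ_three, dMat_plane,
      mat_one_zero, mat_two_zero, hr.zero_zero x hx, hr.one_zero x hx, hr.two_zero x hx] at h3
    have h4 : (η.pull s x v : Mat3) i 0 = ![0, v 0, v 1] i := by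
      fin_cases i
      · exact hs.zero_zero x hx v
      · exact hs.one_zero x hx v
      · exact hs.two_zero x hx v
    rw [h4] at h3
    linarith
  have hblock : ∀ x ∈ U, mat (γ x) 1 1 = mat (γ x) 0 0 ∧ mat (γ x) 1 2 = 0 ∧
      mat (γ x) 2 1 = 0 ∧ mat (γ x) 2 2 = mat (γ x) 0 0 := by
    intro x hx
    have a1 := hcol x hx (EuclideanSpace.single 0 1) 1
    have a2 := hcol x hx (EuclideanSpace.single 1 1) 1
    have a3 := hcol x hx (EuclideanSpace.single 0 1) 2
    have a4 := hcol x hx (EuclideanSpace.single 1 1) 2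
    simp [mat_one_zero, mat_two_zero] at a1 a2 a3 a4
    exact ⟨a1, a2, a3, a4⟩
  have h00 : ∀ x ∈ U, mat (γ x) 0 0 = 1 := by
    intro x hx
    obtain ⟨a1, a2, a3, a4⟩ := hblock x hx
    have h : mat (γ x) 0 0 * (mat (γ x) 1 1 * mat (γ x) 2 2 - mat (γ x) 1 2 * mat (γ x) 2 1) = 1 :=
      stabGroup_det (γ x)
    rw [a1, a2, a3, a4] at h
    nlinarith [sq_nonneg (mat (γ x) 0 0 + 1), sq_nonneg (mat (γ x) 0 0),
      sq_nonneg (mat (γ x) 0 0 - 1)]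
  intro x hx
  have hone : γ x = 1 := by
    apply mat_injective
    have hf : (fun x => mat (γ x) 0 0) =ᶠ[nhds x] fun _ => 1 :=
      Filter.eventually_of_mem (hU.mem_nhds hx) h00
    have b1 := hcol x hx (EuclideanSpace.single 0 1) 0
    have b2 := hcol x hx (EuclideanSpace.single 1 1) 0
    rw [hf.fderiv_eq] at b1 b2
    simp at b1 b2
    obtain ⟨a1, a2, a3, a4⟩ := hblock x hx
    rw [h00 x hx] at a1 a4
    rw [mat_one]
    ext i j
    fin_cases i <;> fin_cases j <;>
      simp [mat_one_zero, mat_two_zero, a1, a2, a3, a4, b1, b2, h00 x hx]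
  rw [hrs x hx, hone, Q.act_one]

/-- Uniqueness makes local normal sections agree on overlaps, so the diagonal choice coincides near
each point with one of them and inherits its properties. -/
theorem exists_isNormalSection : ∃ s, η.IsNormalSection Set.univ s := by
  have hloc : ∀ x₀ : Plane, ∃ (U : Set Plane) (s : Plane → Q.Total), IsOpen U ∧ x₀ ∈ U ∧
      η.IsNormalSection U s := by
    intro x₀
    obtain ⟨U, s, τ, hU, hx, hs, -, h1, -⟩ := Q.locallyTrivial x₀
    obtain ⟨r, hr⟩ := η.exists_isNormalSection_near hU hs fun x hx => by
      have := (h1 x hx 1).1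
      rwa [Q.act_one] at this
    exact ⟨U, r, hU, hx, hr⟩
  choose U s hU hmem hs using hloc
  have hloc' : ∀ x₀, ∀ x ∈ U x₀, s x x = s x₀ x := fun x₀ x hx =>
    ((hs x₀).mono Set.inter_subset_left).eqOn ((hU x₀).inter (hU x))
      ((hs x).mono Set.inter_subset_right) ⟨hx, hmem x⟩
  have hev : ∀ x, (fun x => s x x) =ᶠ[nhds x] s x := fun x =>
    Filter.eventually_of_mem ((hU x).mem_nhds (hmem x)) (hloc' x)
  have hpull : ∀ x v, η.pull (fun x => s x x) x v = η.pull (s x) x v := fun x v =>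
    LinearMap.congr_fun (η.pull_congr (hev x)) v
  refine ⟨fun x => s x x, fun x _ => ?_, fun x _ => (hs x).proj_eq x (hmem x), fun x _ v => ?_,
    fun x _ v => ?_, fun x _ v => ?_⟩
  · exact (((hs x).contMDiffOn.contMDiffAt ((hU x).mem_nhds (hmem x))).congr_of_eventuallyEq
      (hev x)).contMDiffWithinAt
  · rw [hpull]; exact (hs x).zero_zero x (hmem x) v
  · rw [hpull]; exact (hs x).one_zero x (hmem x) v
  · rw [hpull]; exact (hs x).two_zero x (hmem x) v

end CartanConnection

end ProjConn

theorem theorem5 (A B C D : Plane → ℝ) (hA : ContDiff ℝ ∞ A) (hB : ContDiff ℝ ∞ B)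
    (hC : ContDiff ℝ ∞ C) (hD : ContDiff ℝ ∞ D) :
    ∃ (Q : PrincipalBundle.{0}) (η : CartanConnection Q),
      -- the geodesics of the connection satisfy the equation
      η.GeodesicsSatisfy A B C D ∧
      -- and are exactly its solution curves, also those with vertical tangents
      (∀ (J : Set ℝ) (x : ℝ → Plane), IsRegularCurve J x →
        (η.IsGeodesic J x ↔ IsSolutionCurve A B C D J x)) ∧
      -- the structure function takes values in the subspace
      η.StructureFunctionInW ∧
      -- the connection form is given explicitly
      η.HasExplicitForm A B C D ∧
      -- uniqueness up to isomorphism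
      ∀ (Q' : PrincipalBundle.{u}) (η' : CartanConnection Q'),
        η'.GeodesicsSatisfy A B C D → η'.StructureFunctionInW → Isomorphic η η' := by
  refine ⟨trivialBundle, (explicitNormalForm hA hB hC hD).connection,
    explicit_geodesicsSatisfy hA hB hC hD, fun J x hx => explicit_isGeodesic_iff hA hB hC hD hx,
    (explicitNormalForm hA hB hC hD).structureFunctionInW (explicit_curv hA hB hC hD),
    explicit_hasExplicitForm hA hB hC hD, fun Q' η' hg hW => ?_⟩
  obtain ⟨s, hs⟩ := η'.exists_isNormalSection
  exact (explicitNormalForm hA hB hC hD).isomorphic hs fun x v => Subtype.ext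
    (hs.normalForm.eq_explicitForm (CartanConnection.spray_eq_of_geodesicsSatisfy hg hs)
      (CartanConnection.curv_of_structureFunctionInW hW hs) x v)
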